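/- Let $k$ be an algebraically closed field of characteristic $0$. Let $\Sigma=\{p_1,\dots,p_{21}\}$ be a set of $21$ general points in $\mathbb P^2_k$, let $S=\mathrm{Bl}_\Sigma\mathbb P^2$ be the blow-up of $\mathbb P^2$ along $\Sigma$, let $H$ be the class on $S$ of the pull-back of a line, and let $E_1,\dots,E_{21}$ be the exceptional divisors over $p_1,\dots,p_{21}$. Then the complete linear system $$\Bigl|\,13H-2\sum_{j=1}^{9}E_j-3\sum_{j=10}^{21}E_j\Bigr|$$ on $S$, i.e. the set of effective divisors $D$ on $S$ with $D+2\sum_{j=1}^{9}E_j+3\sum_{j=10}^{21}E_j\sim 13H$, contains a smooth connected curve. Here "general" means: there is a nonempty Zariski open subset of $(\mathbb P^2)^{21}$ such that the assertion holds for every $(p_1,\dots,p_{21})$ in it. -/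

import Mathlib

open AlgebraicGeometry CategoryTheory
open scoped nonZeroDivisors

universe u

namespace PlaneBlowUp

noncomputable section

/-! ### Effective Cartier divisors, linear equivalence and blow-ups

An effective divisor is represented by its (quasi-coherent) ideal sheaf; the sum of two divisors
is the product of the ideal sheaves, and the pull-back is the inverse image ideal sheaf
`Scheme.IdealSheafData.comap`. -/

/-- The closed subscheme cut out by `I` is an effective Cartier divisor: locally, `I` is generated
by one nonzerodivisor. -/
def IsEffectiveCartier {X : Scheme.{u}} (I : X.IdealSheafData) : Prop :=
  ∀ x : X, ∃ U : X.affineOpens, x ∈ U.1 ∧ ∃ f ∈ Γ(X, U.1)⁰, I.ideal U = Ideal.span {f}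

/-- Linear equivalence of the effective Cartier divisors cut out by `I` and `J`: the invertible
sheaves `𝒪(-D) = I` and `𝒪(-D') = J` are isomorphic as sheaves of modules. An isomorphism is given
by linear isomorphisms on the affine open sets which commute with the restriction maps. -/
def LinearlyEquivalent {X : Scheme.{u}} (I J : X.IdealSheafData) : Prop :=
  ∃ φ : ∀ U : X.affineOpens, I.ideal U ≃ₗ[Γ(X, U.1)] J.ideal U,
    ∀ (U V : X.affineOpens) (h : U.1 ≤ V.1) (s : I.ideal V) (t : I.ideal U),
      (t : Γ(X, U.1)) = (X.presheaf.map (homOfLE h).op).hom (s : Γ(X, V.1)) →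
      (φ U t : Γ(X, U.1)) = (X.presheaf.map (homOfLE h).op).hom (φ V s : Γ(X, V.1))

/-- `π : S ⟶ X` is the blow-up of `X` along the closed subscheme cut out by `I`: the inverse
image of that subscheme is an effective Cartier divisor, and `π` is universal (terminal) among the
morphisms to `X` with this property. -/
structure IsBlowUp {S X : Scheme.{u}} (π : S ⟶ X) (I : X.IdealSheafData) : Prop where
  isEffectiveCartier : IsEffectiveCartier (I.comap π)
  existsUnique_lift : ∀ (T : Scheme.{u}) (g : T ⟶ X), IsEffectiveCartier (I.comap g) →
    ∃! h : T ⟶ S, h ≫ π = g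

/-! ### The projective plane -/

attribute [local instance] MvPolynomial.gradedAlgebra

variable (k : Type u) [Field k]

/-- The projective plane over `k`, as the scheme `Proj k[x₀, x₁, x₂]`. -/
abbrev Plane : Scheme.{u} := Proj (MvPolynomial.homogeneousSubmodule (Fin 3) k)

/-- The structure morphism of the projective plane. -/
def planeToSpec : Plane k ⟶ Spec (CommRingCat.of k) :=
  Proj.toSpecZero (MvPolynomial.homogeneousSubmodule (Fin 3) k) ≫
    Spec.map (CommRingCat.ofHom
      (algebraMap k (MvPolynomial.homogeneousSubmodule (Fin 3) k 0)))

/-- The closed subset of the projective plane defined by the vanishing of a set of forms. -/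
def planeZeroLocus (s : Set (MvPolynomial (Fin 3) k)) :
    TopologicalSpace.Closeds (Plane k) :=
  ⟨ProjectiveSpectrum.zeroLocus (MvPolynomial.homogeneousSubmodule (Fin 3) k) s,
    ProjectiveSpectrum.isClosed_zeroLocus _ s⟩

/-- The ideal sheaf of the line `x₀ = 0`. -/
def lineIdeal : (Plane k).IdealSheafData :=
  Scheme.IdealSheafData.vanishingIdeal (planeZeroLocus k {MvPolynomial.X 0})

variable {k}

/-- The ideal sheaf of the point `p = [v₀ : v₁ : v₂]` (with its reduced structure), which is the
locus where all forms `vᵢ xⱼ - vⱼ xᵢ` vanish. -/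
def pointIdeal (p : Projectivization k (Fin 3 → k)) : (Plane k).IdealSheafData :=
  Scheme.IdealSheafData.vanishingIdeal (planeZeroLocus k
    {F | ∃ i j : Fin 3, F = MvPolynomial.C (p.rep i) * MvPolynomial.X j -
      MvPolynomial.C (p.rep j) * MvPolynomial.X i})

/-- The ideal sheaf of the (reduced) set of points `{p₁, …, pₙ}`. -/
def pointsIdeal {n : ℕ} (p : Fin n → Projectivization k (Fin 3 → k)) :
    (Plane k).IdealSheafData :=
  ⨅ i, pointIdeal (p i)

/-- `P` holds for `n` general points of the plane, i.e. on a nonempty Zariski open subset of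
`(ℙ²)ⁿ`: there is a nonzero polynomial `G` in `n` triples of homogeneous coordinates such that `P`
holds for the points `[v₁], …, [vₙ]` whenever `G(v₁, …, vₙ) ≠ 0`. -/
def HoldsForGeneralPoints {n : ℕ}
    (P : (Fin n → Projectivization k (Fin 3 → k)) → Prop) : Prop :=
  ∃ G : MvPolynomial (Fin n × Fin 3) k, G ≠ 0 ∧
    ∀ (v : Fin n → Fin 3 → k) (hv : ∀ i, v i ≠ 0),
      MvPolynomial.eval (fun ij : Fin n × Fin 3 => v ij.1 ij.2) G ≠ 0 →
        P (fun i => Projectivization.mk k (v i) (hv i))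

/-! ### Linear systems on the blow-up of the plane -/

/-- The class `H`: the pull-back of a line to `S`. -/
def hyperplaneDivisor {S : Scheme.{u}} (π : S ⟶ Plane k) : S.IdealSheafData :=
  (lineIdeal k).comap π

/-- The exceptional divisor over the point `p`: the inverse image of `p` in `S`. -/
def exceptionalDivisor {S : Scheme.{u}} (π : S ⟶ Plane k)
    (p : Projectivization k (Fin 3 → k)) : S.IdealSheafData :=
  (pointIdeal p).comap π

/-- The complete linear system `|d H - ∑ mᵢ Eᵢ|`: the effective divisors `D` on `S` such that
`D + ∑ mᵢ Eᵢ` is linearly equivalent to `d H`. -/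
def linearSystem {S : Scheme.{u}} (π : S ⟶ Plane k) {n : ℕ}
    (p : Fin n → Projectivization k (Fin 3 → k)) (d : ℕ) (m : Fin n → ℕ) :
    Set S.IdealSheafData :=
  {D | IsEffectiveCartier D ∧
    LinearlyEquivalent (D * ∏ i, exceptionalDivisor π (p i) ^ m i) (hyperplaneDivisor π ^ d)}

/-- The divisor `D` on the `k`-scheme `S` is a smooth connected curve. -/
def IsSmoothConnectedCurve {S : Scheme.{u}} (f : S ⟶ Spec (CommRingCat.of k))
    (D : S.IdealSheafData) : Prop :=
  SmoothOfRelativeDimension 1 (D.subschemeι ≫ f) ∧ ConnectedSpace D.subscheme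

end

end PlaneBlowUp

/-!
The proof combines a computation over a finite field, which gives linear systems with prescribed
multiplicities and without base points on a nonempty open set of configurations, with Bertini-type
arguments, which give smooth connected members.

*Geometry.* No construction of the blow-up is needed. By the universal property alone, every point
of `S` has a neighbourhood which is an open part of an affine plane, mapped to the projective plane
by a standard affine chart or by one of the charts `(z + (u, uv), 1)`, `(z + (uv, u), 1)` of the
blow-up in a point (`exists_chart_isLocalImmersion`). If a form `F` of degree `d` is irreducible,
and if its pull-back to each chart is the product of the right power of the equation of the
exceptional divisor with a polynomial `F'` defining a smooth curve, then the closure in `S` of the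
generic point of the curve `F = 0` is a member of `|d H - ∑ m i E i|`
(`closure_mem_linearSystem`) and a smooth connected curve (`isSmoothConnectedCurve_closure`).

*A general member.* Let `f c` be forms of degree `d` with multiplicities `m i`, whose strict
transforms have no common zero on `S` (`IsBasePointFree`). Consider the generic combination
`F = ∑ λ c * f c` over an algebraic closure `Ω` of `k(λ)`. At a singular point `ξ` of `F = 0` over
`Ω`, extending the derivations `∂/∂λ c` to `Ω` shows that all `f c` vanish at `ξ`; this is Bertini's
theorem in characteristic zero (`aeval_eq_zero_of_singular`). Over `k(λ)`, the form `F` is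
irreducible since it is linear in the `λ c` and the `f c` have no common factor. Let `P` be a factor
of `F` over a Galois extension of `k(λ)` of degree `g`. The norm of `P` is `F ^ s` for some `s`, up
to a constant, so that `g * deg P = s * deg F`. At points where `F` has the multiplicities `m` and
`m + 1`, the orders `a` and `b` of `P` along the exceptional divisors satisfy `g * a = s * m` and
`g * b = s * (m + 1)`. Hence `g` divides `s`, and `P` has degree `0` or `deg F`
(`totalDegree_eq_zero_or_of_isGalois`). So irreducibility needs no intersection theory, only that
two of the multiplicities differ by one. By the Nullstellensatz, smoothness and irreducibility pass
from `F` to its specializations at general values of the `λ c`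
(`IsBasePointFree.exists_mem_linearSystem`).

*Base point freeness.* It suffices that the conditions imposed by the points on the forms of degree
13 are independent, and that the forms of degree 16 which satisfy them are generated by those of
degree 13: for every point of `S`, a form of degree 16 which satisfies the conditions and whose
strict transform does not vanish there is obtained from a form of degree 13
(`isBasePointFree_of_generates`). There are 99 conditions, and the forms of degrees 13 and 16 make
up spaces of dimensions 105 and 153. So six forms of degree 13 have to be found for which 54
of the products with monomials of degree 3 are linearly independent
(`mem_span_range_productForm`).

*Computation.* Independence is an open condition, defined over the integers. So it suffices to find
one configuration of points over the field with 7 elements for which the 99 conditions, and the 54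
products, are linearly independent (`linearIndependent_conditionMatrix`,
`linearIndependent_productForm`). This is Gaussian elimination, carried out on natural numbers: a
row vector is packed into one number in a large base, so that a row operation is one multiplication
and one addition.
-/

noncomputable section

namespace PlaneBlowUp

attribute [local instance] MvPolynomial.gradedAlgebra

/-! ### Ideal sheaves on affine charts -/

/-- On affine schemes, the inverse image of an ideal sheaf is the extension of its ideal. -/
lemma ideal_comap_top {X Y : Scheme.{u}} [IsAffine X] [IsAffine Y] (f : X ⟶ Y)
    (J : Y.IdealSheafData) :
    (J.comap f).ideal ⟨⊤, isAffineOpen_top X⟩ =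
      (J.ideal ⟨⊤, isAffineOpen_top Y⟩).map f.appTop.hom := by
  apply le_antisymm
  · have h : J.comap f ≤ Scheme.IdealSheafData.equivOfIsAffine.symm
        ((J.ideal ⟨⊤, isAffineOpen_top Y⟩).map f.appTop.hom) := by
      rw [← Scheme.IdealSheafData.le_map_iff_comap_le]
      apply Scheme.IdealSheafData.le_of_isAffine
      rw [Scheme.IdealSheafData.ideal_map_of_isAffineHom, ← Ideal.map_le_iff_le_comap]
      have := (Scheme.IdealSheafData.equivOfIsAffine (X := X)).apply_symm_apply
        ((J.ideal ⟨⊤, isAffineOpen_top Y⟩).map f.appTop.hom)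
      exact this.ge
    have h2 := h ⟨⊤, isAffineOpen_top X⟩
    have := (Scheme.IdealSheafData.equivOfIsAffine (X := X)).apply_symm_apply
        ((J.ideal ⟨⊤, isAffineOpen_top Y⟩).map f.appTop.hom)
    exact h2.trans this.le
  · rw [Ideal.map_le_iff_le_comap]
    have h := J.le_map_comap f ⟨⊤, isAffineOpen_top Y⟩
    rw [Scheme.IdealSheafData.ideal_map_of_isAffineHom] at h
    exact h

/-- The ideal of `A` which corresponds to the inverse image of the ideal sheaf `J` under
`κ : Spec A ⟶ X`. -/
def pullIdeal {X : Scheme.{u}} {A : CommRingCat.{u}} (κ : Spec A ⟶ X) (J : X.IdealSheafData) :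
    Ideal A :=
  ((J.comap κ).ideal ⟨⊤, isAffineOpen_top _⟩).comap (Scheme.ΓSpecIso A).inv.hom

lemma pullIdeal_comap {X Y : Scheme.{u}} {A : CommRingCat.{u}} (κ : Spec A ⟶ X) (f : X ⟶ Y)
    (J : Y.IdealSheafData) : pullIdeal κ (J.comap f) = pullIdeal (κ ≫ f) J := by
  rw [pullIdeal, pullIdeal, Scheme.IdealSheafData.comap_comp]

lemma comap_hom_eq_map_inv {A B : CommRingCat.{u}} (e : A ≅ B) (I : Ideal A) :
    I.comap e.inv.hom = I.map e.hom.hom :=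
  Ideal.comap_symm (I := I) e.commRingCatIsoToRingEquiv

lemma pullIdeal_SpecMap {X : Scheme.{u}} {A B : CommRingCat.{u}} (φ : A ⟶ B) (κ : Spec A ⟶ X)
    (J : X.IdealSheafData) : pullIdeal (Spec.map φ ≫ κ) J = (pullIdeal κ J).map φ.hom := by
  rw [pullIdeal, Scheme.IdealSheafData.comap_comp, ideal_comap_top, comap_hom_eq_map_inv,
    pullIdeal, comap_hom_eq_map_inv, Ideal.map_map, Ideal.map_map, ← CommRingCat.hom_comp,
    ← CommRingCat.hom_comp, Scheme.ΓSpecIso_naturality]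

lemma pullIdeal_fromSpec {X : Scheme.{u}} {U : X.Opens} (hU : IsAffineOpen U)
    (J : X.IdealSheafData) : pullIdeal hU.fromSpec J = J.ideal ⟨U, hU⟩ := by
  rw [pullIdeal, Scheme.IdealSheafData.ideal_comap_of_isOpenImmersion, Ideal.comap_comap,
    ← CommRingCat.hom_comp]
  have hle : (⟨U, hU⟩ : X.affineOpens) ≤ ⟨hU.fromSpec ''ᵁ ⊤,
      (isAffineOpen_top _).image_of_isOpenImmersion _⟩ := by
    change U ≤ hU.fromSpec ''ᵁ ⊤
    simp
  have key : (Scheme.ΓSpecIso Γ(X, U)).inv ≫ (hU.fromSpec.appIso ⊤).inv =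
      X.presheaf.map (eqToHom (by simp : hU.fromSpec ''ᵁ ⊤ = U)).op := by
    rw [← cancel_mono (hU.fromSpec.appIso ⊤).hom, Category.assoc, Iso.inv_hom_id, Category.comp_id]
    rw [Scheme.Hom.appIso_hom']
    rw [Scheme.Hom.map_appLE]
    rw [Scheme.Hom.appLE, hU.fromSpec_app_self, Category.assoc, ← Functor.map_comp]
    exact (Category.comp_id _).symm.trans (congrArg _ ((CategoryTheory.Functor.map_id _ _).symm))
  rw [key]
  conv_rhs => rw [← J.map_ideal hle]
  have := comap_hom_eq_map_inv
    (X.presheaf.mapIso (eqToIso (by simp : hU.fromSpec ''ᵁ ⊤ = U)).op).symm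
    (J.ideal ⟨hU.fromSpec ''ᵁ ⊤, (isAffineOpen_top _).image_of_isOpenImmersion _⟩)
  exact this

lemma exists_eq_SpecMap_fromSpec {X : Scheme.{u}} {A : CommRingCat.{u}} (κ : Spec A ⟶ X)
    {U : X.Opens} (hU : IsAffineOpen U) (h : Set.range κ ⊆ U) :
    ∃ φ : Γ(X, U) ⟶ A, κ = Spec.map φ ≫ hU.fromSpec := by
  refine ⟨Spec.preimage (IsOpenImmersion.lift hU.fromSpec κ (by rwa [hU.range_fromSpec])), ?_⟩
  rw [Spec.map_preimage, IsOpenImmersion.lift_fac]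

lemma exists_isIso_eq_SpecMap_fromSpec {X : Scheme.{u}} {A : CommRingCat.{u}} (κ : Spec A ⟶ X)
    [IsOpenImmersion κ] :
    ∃ φ : Γ(X, κ.opensRange) ⟶ A, IsIso φ ∧
      κ = Spec.map φ ≫ (isAffineOpen_opensRange κ).fromSpec := by
  obtain ⟨φ, hφ⟩ := exists_eq_SpecMap_fromSpec κ (isAffineOpen_opensRange κ) subset_rfl
  refine ⟨φ, ?_, hφ⟩
  have h1 : IsOpenImmersion (Spec.map φ) := by
    have : IsOpenImmersion (Spec.map φ ≫ (isAffineOpen_opensRange κ).fromSpec) := by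
      rw [← hφ]; infer_instance
    exact IsOpenImmersion.of_comp _ (isAffineOpen_opensRange κ).fromSpec
  have h2 : Function.Surjective (Spec.map φ) := by
    intro x
    have : (isAffineOpen_opensRange κ).fromSpec x ∈ Set.range κ := by
      have := Set.mem_range_self (f := (isAffineOpen_opensRange κ).fromSpec) x
      rwa [IsAffineOpen.range_fromSpec] at this
    obtain ⟨y, hy⟩ := this
    refine ⟨y, (isAffineOpen_opensRange κ).fromSpec.isOpenEmbedding.injective ?_⟩
    rw [← hy, ← Scheme.Hom.comp_apply, ← hφ]
  have h3 : Epi (Spec.map φ).base := (TopCat.epi_iff_surjective _).mpr h2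
  have : IsIso (Spec.map φ) := IsOpenImmersion.isIso _
  have : IsIso (Scheme.Spec.map φ.op) := this
  exact (isIso_op_iff φ).mp (isIso_of_reflects_iso φ.op Scheme.Spec)

lemma pullIdeal_mul {X : Scheme.{u}} {A : CommRingCat.{u}} (κ : Spec A ⟶ X) [IsOpenImmersion κ]
    (I J : X.IdealSheafData) : pullIdeal κ (I * J) = pullIdeal κ I * pullIdeal κ J := by
  obtain ⟨φ, -, h⟩ := exists_isIso_eq_SpecMap_fromSpec κ
  rw [h]
  simp only [pullIdeal_SpecMap, pullIdeal_fromSpec, Scheme.IdealSheafData.ideal_mul, Pi.mul_apply,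
    Ideal.map_mul]

lemma pullIdeal_one {X : Scheme.{u}} {A : CommRingCat.{u}} (κ : Spec A ⟶ X) :
    pullIdeal κ (1 : X.IdealSheafData) = 1 := by
  rw [pullIdeal, Scheme.IdealSheafData.one_eq_top, Scheme.IdealSheafData.comap_top]
  simp

lemma pullIdeal_pow {X : Scheme.{u}} {A : CommRingCat.{u}} (κ : Spec A ⟶ X) [IsOpenImmersion κ]
    (I : X.IdealSheafData) (n : ℕ) : pullIdeal κ (I ^ n) = pullIdeal κ I ^ n := by
  induction n with
  | zero => rw [pow_zero, pow_zero, pullIdeal_one]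
  | succ n ih => rw [pow_succ, pow_succ, pullIdeal_mul, ih]

lemma pullIdeal_prod {X : Scheme.{u}} {A : CommRingCat.{u}} (κ : Spec A ⟶ X) [IsOpenImmersion κ]
    {ι : Type*} (s : Finset ι) (I : ι → X.IdealSheafData) :
    pullIdeal κ (∏ i ∈ s, I i) = ∏ i ∈ s, pullIdeal κ (I i) := by
  classical
  induction s using Finset.induction_on with
  | empty => rw [Finset.prod_empty, Finset.prod_empty, pullIdeal_one]
  | insert i s hi ih => rw [Finset.prod_insert hi, Finset.prod_insert hi, pullIdeal_mul, ih]

lemma pullIdeal_mono {X : Scheme.{u}} {A : CommRingCat.{u}} (κ : Spec A ⟶ X)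
    {I J : X.IdealSheafData} (h : I ≤ J) : pullIdeal κ I ≤ pullIdeal κ J :=
  Ideal.comap_mono (Scheme.IdealSheafData.comap_mono κ h _)

/-- It suffices to check that a divisor is effective Cartier on an open cover by spectra. -/
lemma isEffectiveCartier_of_cover {X : Scheme.{u}} {D : X.IdealSheafData}
    (h : ∀ x : X, ∃ (A : CommRingCat.{u}) (κ : Spec A ⟶ X) (_ : IsOpenImmersion κ),
      x ∈ Set.range κ ∧ ∃ f ∈ (A : Type u)⁰, pullIdeal κ D = Ideal.span {f}) :
    IsEffectiveCartier D := by
  intro x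
  obtain ⟨A, κ, _, hx, f, hf, hD⟩ := h x
  obtain ⟨φ, _, h⟩ := exists_isIso_eq_SpecMap_fromSpec κ
  refine ⟨⟨κ.opensRange, isAffineOpen_opensRange κ⟩, hx, (inv φ).hom f, ?_, ?_⟩
  · refine mem_nonZeroDivisors_of_injective (f := φ.hom)
      ((asIso φ).commRingCatIsoToRingEquiv).injective ?_
    rwa [← CommRingCat.comp_apply, IsIso.inv_hom_id]
  · rw [h, pullIdeal_SpecMap, pullIdeal_fromSpec] at hD
    have := congrArg (Ideal.map (inv φ).hom) hD
    rw [Ideal.map_map, ← CommRingCat.hom_comp, IsIso.hom_inv_id, Ideal.map_span,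
      Set.image_singleton] at this
    rw [← this]
    exact (Ideal.map_id _).symm

lemma isEffectiveCartier_comap_of_pullIdeal {X : Scheme.{u}} {A : CommRingCat.{u}}
    (κ : Spec A ⟶ X) {I : X.IdealSheafData} {f : A} (hf : f ∈ (A : Type u)⁰)
    (h : pullIdeal κ I = Ideal.span {f}) : IsEffectiveCartier (I.comap κ) :=
  isEffectiveCartier_of_cover fun x ↦ ⟨A, 𝟙 _, inferInstance, ⟨x, rfl⟩, f, hf, by
    rw [pullIdeal_comap, Category.id_comp, h]⟩

/-! ### Local structure of a blow-up -/

lemma IsBlowUp.hom_ext {S X T : Scheme.{u}} {π : S ⟶ X} {I : X.IdealSheafData}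
    (h : IsBlowUp π I) {a b : T ⟶ S} (hab : a ≫ π = b ≫ π)
    (hI : IsEffectiveCartier (I.comap (b ≫ π))) : a = b :=
  (h.existsUnique_lift T (b ≫ π) hI).unique hab rfl

/-- If an affine open part `Spec A` of a blow-up maps to an affine scheme `Spec B` over the base
on which the centre becomes a Cartier divisor and which is determined by its map to the base, then
the two agree near any given point. The inverse comes from the universal property: `Spec B` lifts
to the blow-up, and uniqueness of lifts shows that the two maps are inverse to each other. -/
theorem IsBlowUp.exists_localization_isOpenImmersion {S X : Scheme.{u}} {π : S ⟶ X}
    {I : X.IdealSheafData} (hπ : IsBlowUp π I) {A B : CommRingCat.{u}} (κ : Spec A ⟶ S)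
    [IsOpenImmersion κ] (w : Spec B ⟶ X) (ψ : B ⟶ A) (hψ : Spec.map ψ ≫ w = κ ≫ π)
    {fA : A} (hfA : fA ∈ (A : Type u)⁰) (hA : pullIdeal (κ ≫ π) I = Ideal.span {fA})
    {fB : B} (hfB : fB ∈ (B : Type u)⁰) (hB : pullIdeal w I = Ideal.span {fB})
    (hw : ∀ (C : CommRingCat.{u}) (g₁ g₂ : B ⟶ C), g₁.hom fB ∈ (C : Type u)⁰ →
      Spec.map g₁ ≫ w = Spec.map g₂ ≫ w → g₁ = g₂) (a : Spec A) :
    ∃ (g : B) (κ' : Spec (CommRingCat.of (Localization.Away g)) ⟶ S), IsOpenImmersion κ' ∧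
      κ a ∈ Set.range κ' ∧
      κ' ≫ π = Spec.map (CommRingCat.ofHom (algebraMap B (Localization.Away g))) ≫ w := by
  obtain ⟨ω, hω, -⟩ := hπ.existsUnique_lift _ w (isEffectiveCartier_comap_of_pullIdeal w hfB hB)
  have hψω : Spec.map ψ ≫ ω = κ := hπ.hom_ext (by rw [Category.assoc, hω, hψ])
    (isEffectiveCartier_comap_of_pullIdeal _ hfA hA)
  set b : Spec B := Spec.map ψ a with hb
  have hbmem : b ∈ ω ⁻¹ᵁ κ.opensRange := by
    change ω b ∈ Set.range κ
    rw [hb, ← Scheme.Hom.comp_apply, hψω]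
    exact ⟨a, rfl⟩
  obtain ⟨_, ⟨g, rfl⟩, hbg, hg⟩ :=
    PrimeSpectrum.isTopologicalBasis_basic_opens.exists_subset_of_mem_open hbmem (ω ⁻¹ᵁ κ.opensRange).isOpen
  let ι : B ⟶ CommRingCat.of (Localization.Away g) :=
    CommRingCat.ofHom (algebraMap B (Localization.Away g))
  let j := Spec.map ι
  have hjo : IsOpenImmersion j := by dsimp only [j, ι]; infer_instance
  have hjr : Set.range j = (PrimeSpectrum.basicOpen g : Set (PrimeSpectrum B)) :=
    PrimeSpectrum.localization_away_comap_range (Localization.Away g) g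
  -- the lift of the localized chart lands in `Spec A`
  have hsub : Set.range (j ≫ ω) ⊆ Set.range κ := by
    rintro _ ⟨x, rfl⟩
    rw [Scheme.Hom.comp_apply]
    have : j x ∈ (PrimeSpectrum.basicOpen g : Set (PrimeSpectrum B)) := hjr ▸ ⟨x, rfl⟩
    exact hg this
  let r := IsOpenImmersion.lift κ (j ≫ ω) hsub
  have hr : r ≫ κ = j ≫ ω := IsOpenImmersion.lift_fac _ _ _
  let ρ : A ⟶ CommRingCat.of (Localization.Away g) := Spec.preimage r
  have hρ : Spec.map ρ = r := Spec.map_preimage r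
  have hψρ : ψ ≫ ρ = ι := by
    symm
    refine hw _ ι (ψ ≫ ρ) ?_ ?_
    · have := hfB
      exact IsLocalization.map_nonZeroDivisors_le (Submonoid.powers g) (Localization.Away g)
        (Submonoid.mem_map_of_mem _ hfB)
    · rw [Spec.map_comp, hρ, Category.assoc, hψ, ← Category.assoc, hr, Category.assoc, hω]
  -- the localizations of both rings at `g` are isomorphic
  obtain ⟨gA, hgA⟩ : ∃ gA : A, gA = ψ.hom g := ⟨_, rfl⟩
  let jA : A ⟶ CommRingCat.of (Localization.Away gA) :=
    CommRingCat.ofHom (algebraMap A (Localization.Away gA))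
  have hjAo : IsOpenImmersion (Spec.map jA) := by dsimp only [jA]; infer_instance
  have hu : IsUnit (ρ.hom gA) := by
    have : ρ.hom gA = ι.hom g := by rw [← hψρ, hgA]; rfl
    rw [this]
    exact IsLocalization.Away.algebraMap_isUnit g
  obtain ⟨ρ', hρ'⟩ : ∃ ρ' : CommRingCat.of (Localization.Away gA) ⟶
      CommRingCat.of (Localization.Away g), jA ≫ ρ' = ρ :=
    ⟨CommRingCat.ofHom (IsLocalization.Away.lift (S := Localization.Away gA) gA hu),
      CommRingCat.hom_ext (IsLocalization.Away.lift_comp gA hu)⟩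
  have hu' : IsUnit ((ψ ≫ jA).hom g) := by
    have : (ψ ≫ jA).hom g = algebraMap A (Localization.Away gA) gA :=
      congrArg (algebraMap A (Localization.Away gA)) hgA.symm
    rw [this]
    exact IsLocalization.Away.algebraMap_isUnit gA
  obtain ⟨ψ', hψ'⟩ : ∃ ψ' : CommRingCat.of (Localization.Away g) ⟶
      CommRingCat.of (Localization.Away gA), ι ≫ ψ' = ψ ≫ jA :=
    ⟨CommRingCat.ofHom (IsLocalization.Away.lift (S := Localization.Away g) g hu'),
      CommRingCat.hom_ext (IsLocalization.Away.lift_comp g hu')⟩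
  have h1 : Spec.map ρ' ≫ Spec.map ψ' = 𝟙 _ := by
    rw [← cancel_mono j, Category.assoc, ← Spec.map_comp, ← Spec.map_comp, hψ', Category.assoc,
      hρ', hψρ, Category.id_comp]
  have h2 : Spec.map ψ' ≫ Spec.map ρ' = 𝟙 _ := by
    rw [← cancel_mono (Spec.map jA), ← cancel_mono κ]
    simp only [Category.assoc, Category.id_comp]
    rw [← Spec.map_comp_assoc jA ρ', hρ', hρ, hr, ← Spec.map_comp_assoc, hψ', Spec.map_comp,
      Category.assoc, hψω]
  have hiso : IsIso (Spec.map ρ') := ⟨Spec.map ψ', h1, h2⟩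
  have hro : IsOpenImmersion r := by
    rw [← hρ, ← hρ', Spec.map_comp]; infer_instance
  refine ⟨g, j ≫ ω, by rw [← hr]; infer_instance, ?_, by rw [Category.assoc, hω]⟩
  have : b ∈ Set.range j := by rw [hjr]; exact hbg
  obtain ⟨y, hy⟩ := this
  refine ⟨y, ?_⟩
  rw [Scheme.Hom.comp_apply, hy, hb, ← Scheme.Hom.comp_apply, hψω]

/-! ### Homogeneous coordinates -/

section

open MvPolynomial HomogeneousLocalization

variable {k : Type u} [Field k]

/-- Evaluation of the homogeneous fractions with denominator a power of `f` at homogeneous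
coordinates `a`, for which `f` takes an invertible value. -/
def evAway {C : Type u} [CommRing C] (f : MvPolynomial (Fin 3) k) (c : k →+* C) (a : Fin 3 → C)
    (hu : IsUnit (eval₂Hom c a f)) : Away (homogeneousSubmodule (Fin 3) k) f →+* C :=
  (IsLocalization.Away.lift (S := Localization.Away f) f hu).comp
    (algebraMap (Away (homogeneousSubmodule (Fin 3) k) f) (Localization.Away f))

lemma evAway_mk {C : Type u} [CommRing C] {f : MvPolynomial (Fin 3) k} (c : k →+* C)
    (a : Fin 3 → C) (hu : IsUnit (eval₂Hom c a f)) {d : ℕ}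
    (hf : f ∈ homogeneousSubmodule (Fin 3) k d) (n : ℕ) (G : MvPolynomial (Fin 3) k) (hG) :
    evAway f c a hu (Away.mk _ hf n G hG) * eval₂Hom c a f ^ n = eval₂Hom c a G := by
  have h : algebraMap (Away (homogeneousSubmodule (Fin 3) k) f) (Localization.Away f)
      (Away.mk _ hf n G hG) * algebraMap _ _ (f ^ n) = algebraMap _ _ G := by
    rw [HomogeneousLocalization.algebraMap_apply, Away.val_mk, Localization.mk_eq_mk']
    exact IsLocalization.mk'_spec _ _ _
  have h2 := congrArg (IsLocalization.Away.lift (S := Localization.Away f) f hu) h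
  rw [map_mul, IsLocalization.Away.lift_eq, IsLocalization.Away.lift_eq, map_pow] at h2
  exact h2

lemma evAway_unique {C : Type u} [CommRing C] {f : MvPolynomial (Fin 3) k} (c : k →+* C)
    (a : Fin 3 → C) (hu : IsUnit (eval₂Hom c a f)) {d : ℕ}
    (hf : f ∈ homogeneousSubmodule (Fin 3) k d)
    (χ : Away (homogeneousSubmodule (Fin 3) k) f →+* C)
    (h : ∀ n G hG, χ (Away.mk _ hf n G hG) * eval₂Hom c a f ^ n = eval₂Hom c a G) :
    χ = evAway f c a hu := by
  ext x
  obtain ⟨n, G, hG, rfl⟩ := Away.mk_surjective _ hf x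
  apply (hu.pow n).mul_right_cancel
  rw [h, evAway_mk]

/-- The morphism with homogeneous coordinates `a` to the plane, for coordinates at which a given
form `f` is invertible. -/
def toPlane {C : CommRingCat.{u}} (f : MvPolynomial (Fin 3) k) {d : ℕ}
    (hf : f ∈ homogeneousSubmodule (Fin 3) k d) (hd : 0 < d) (c : k →+* C) (a : Fin 3 → C)
    (hu : IsUnit (eval₂Hom c a f)) : Spec C ⟶ Plane k :=
  Spec.map (CommRingCat.ofHom (evAway f c a hu)) ≫ Proj.awayι _ f hf hd

lemma SpecMap_toPlane {C C' : CommRingCat.{u}} (φ : C ⟶ C') (f : MvPolynomial (Fin 3) k) {d : ℕ}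
    (hf : f ∈ homogeneousSubmodule (Fin 3) k d) (hd : 0 < d) (c : k →+* C) (a : Fin 3 → C)
    (hu : IsUnit (eval₂Hom c a f)) (hu' : IsUnit (eval₂Hom (φ.hom.comp c) (φ.hom ∘ a) f)) :
    Spec.map φ ≫ toPlane f hf hd c a hu = toPlane f hf hd (φ.hom.comp c) (φ.hom ∘ a) hu' := by
  rw [toPlane, toPlane, ← Category.assoc, ← Spec.map_comp]
  congr 2
  apply CommRingCat.hom_ext
  refine evAway_unique _ _ hu' hf _ fun n G hG ↦ ?_
  have h := congrArg φ.hom (evAway_mk c a hu hf n G hG)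
  have hh : ∀ p, eval₂Hom (φ.hom.comp c) (φ.hom ∘ a) p = φ.hom (eval₂Hom c a p) := fun p ↦
    (MvPolynomial.eval₂_comp_left φ.hom c a p).symm
  rw [map_mul, map_pow] at h
  rw [hh, hh]
  exact h

/-- Passing from the open set `D(f)` to `D(f * g)` does not change the morphism with given
homogeneous coordinates. -/
lemma toPlane_mul {C : CommRingCat.{u}} {f g : MvPolynomial (Fin 3) k} {d e : ℕ}
    (hf : f ∈ homogeneousSubmodule (Fin 3) k d) (hd : 0 < d)
    (hg : g ∈ homogeneousSubmodule (Fin 3) k e) {x : MvPolynomial (Fin 3) k} (hx : x = f * g)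
    (hxm : x ∈ homogeneousSubmodule (Fin 3) k (d + e)) (hde : 0 < d + e)
    (c : k →+* C) (a : Fin 3 → C)
    (hu : IsUnit (eval₂Hom c a f)) (hu' : IsUnit (eval₂Hom c a x)) :
    toPlane f hf hd c a hu = toPlane x hxm hde c a hu' := by
  rw [toPlane, toPlane, ← Proj.SpecMap_awayMap_awayι _ hf hd hg hx, ← Category.assoc,
    ← Spec.map_comp]
  congr 2
  apply CommRingCat.hom_ext
  symm
  refine evAway_unique _ _ hu hf _ fun n G hG ↦ ?_
  change evAway x c a hu' (awayMap _ hg hx (Away.mk _ hf n G hG)) * _ = _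
  rw [awayMap_mk]
  have h := evAway_mk c a hu' hxm n (G * g ^ n) (by
    rw [smul_add]
    exact SetLike.mul_mem_graded hG (SetLike.pow_mem_graded n hg))
  have hg' : IsUnit (eval₂Hom c a g) := by
    rw [hx, map_mul] at hu'
    exact isUnit_of_mul_isUnit_right hu'
  apply (hg'.pow n).mul_right_cancel
  have hxe : eval₂Hom c a x = eval₂Hom c a f * eval₂Hom c a g := by rw [hx, map_mul]
  rw [hxe, map_mul, mul_pow, ← mul_assoc, map_pow] at h
  exact h

lemma toPlane_planeToSpec {C : CommRingCat.{u}} (f : MvPolynomial (Fin 3) k) {d : ℕ}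
    (hf : f ∈ homogeneousSubmodule (Fin 3) k d) (hd : 0 < d) (c : k →+* C) (a : Fin 3 → C)
    (hu : IsUnit (eval₂Hom c a f)) :
    toPlane f hf hd c a hu ≫ planeToSpec k = Spec.map (CommRingCat.ofHom c) := by
  rw [toPlane, planeToSpec, Category.assoc, Proj.awayι_toSpecZero_assoc, ← Spec.map_comp,
    ← Spec.map_comp]
  congr 1
  ext r
  have h := evAway_mk c a hu hf 0 (MvPolynomial.C r) (by
    rw [zero_smul, mem_homogeneousSubmodule]; exact isHomogeneous_C _ _)
  rw [pow_zero, mul_one] at h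
  simp only [coe_eval₂Hom, eval₂_C] at h
  change evAway f c a hu _ = c r
  rw [← h]
  congr 1
  ext
  rw [Away.val_mk]
  rfl

lemma toPlane_apply_mem_basicOpen {C : CommRingCat.{u}} (f : MvPolynomial (Fin 3) k) {d : ℕ}
    (hf : f ∈ homogeneousSubmodule (Fin 3) k d) (hd : 0 < d) (c : k →+* C) (a : Fin 3 → C)
    (hu : IsUnit (eval₂Hom c a f)) {g : MvPolynomial (Fin 3) k} {e : ℕ}
    (hg : g ∈ homogeneousSubmodule (Fin 3) k e) (he : 0 < e) (x : PrimeSpectrum C) :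
    toPlane f hf hd c a hu x ∈ Proj.basicOpen (homogeneousSubmodule (Fin 3) k) g ↔
      eval₂Hom c a g ∉ x.asIdeal := by
  have h1 : toPlane f hf hd c a hu x ∈ Proj.basicOpen (homogeneousSubmodule (Fin 3) k) g ↔
      Spec.map (CommRingCat.ofHom (evAway f c a hu)) x ∈
        Proj.awayι _ f hf hd ⁻¹ᵁ Proj.basicOpen (homogeneousSubmodule (Fin 3) k) g := Iff.rfl
  rw [h1, Proj.awayι_preimage_basicOpen _ hf hd hg he]
  change evAway f c a hu (Away.isLocalizationElem hf hg) ∉ x.asIdeal ↔ _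
  have h := evAway_mk c a hu hf e (g ^ d) (by
    rw [smul_eq_mul, mul_comm]; exact SetLike.pow_mem_graded d hg)
  rw [map_pow] at h
  rw [not_iff_not]
  have h2 : evAway f c a hu (Away.isLocalizationElem hf hg) * eval₂Hom c a f ^ e =
    eval₂Hom c a g ^ d := h
  rw [← x.2.pow_mem_iff_mem d hd (r := eval₂Hom c a g), ← h2]
  exact ((Ideal.unit_mul_mem_iff_mem _ (hu.pow e)).symm).trans (by rw [mul_comm])

lemma X_mem_homogeneousSubmodule (j : Fin 3) :
    (X j : MvPolynomial (Fin 3) k) ∈ homogeneousSubmodule (Fin 3) k 1 :=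
  isHomogeneous_X _ _

lemma eval₂Hom_mul_of_isHomogeneous {σ C : Type*} [Fintype σ] [CommRing C] (c : k →+* C) (t : C)
    (a : σ → C) {n : ℕ} {G : MvPolynomial σ k} (hG : G.IsHomogeneous n) :
    eval₂Hom c (fun i ↦ t * a i) G = t ^ n * eval₂Hom c a G := by
  simp only [coe_eval₂Hom, eval₂_eq', Finset.mul_sum]
  refine Finset.sum_congr rfl fun d hd ↦ ?_
  have h : ∑ i, d i = n := by
    rw [← hG (mem_support_iff.mp hd), Finsupp.weight_apply, Finsupp.sum_fintype _ _ (by simp)]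
    simp
  simp only [mul_pow, Finset.prod_mul_distrib, Finset.prod_pow_eq_pow_sum, h]
  ring

/-- The morphism `Spec C ⟶ ℙ²` with homogeneous coordinates `a`, normalized by `a j = 1`. -/
def coordMap {C : CommRingCat.{u}} (j : Fin 3) (c : k →+* C) (a : Fin 3 → C) (ha : a j = 1) :
    Spec C ⟶ Plane k :=
  toPlane (X j) (X_mem_homogeneousSubmodule j) one_pos c a (by simp [ha])

lemma SpecMap_coordMap {C C' : CommRingCat.{u}} (φ : C ⟶ C') (j : Fin 3) (c : k →+* C)
    (a : Fin 3 → C) (ha : a j = 1) :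
    Spec.map φ ≫ coordMap j c a ha =
      coordMap j (φ.hom.comp c) (φ.hom ∘ a) (by simp [ha]) :=
  SpecMap_toPlane _ _ _ _ _ _ _ _

lemma coordMap_planeToSpec {C : CommRingCat.{u}} (j : Fin 3) (c : k →+* C) (a : Fin 3 → C)
    (ha : a j = 1) : coordMap j c a ha ≫ planeToSpec k = Spec.map (CommRingCat.ofHom c) :=
  toPlane_planeToSpec _ _ _ _ _ _

lemma coordMap_apply_mem_basicOpen {C : CommRingCat.{u}} (j : Fin 3) (c : k →+* C) (a : Fin 3 → C)
    (ha : a j = 1) {g : MvPolynomial (Fin 3) k} {e : ℕ}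
    (hg : g ∈ homogeneousSubmodule (Fin 3) k e) (he : 0 < e) (x : PrimeSpectrum C) :
    coordMap j c a ha x ∈ Proj.basicOpen (homogeneousSubmodule (Fin 3) k) g ↔
      eval₂Hom c a g ∉ x.asIdeal :=
  toPlane_apply_mem_basicOpen _ _ _ _ _ _ hg he x

lemma range_coordMap_subset {C : CommRingCat.{u}} (j : Fin 3) (c : k →+* C) (a : Fin 3 → C)
    (ha : a j = 1) :
    Set.range (coordMap j c a ha) ⊆ Proj.basicOpen (homogeneousSubmodule (Fin 3) k) (X j) := by
  rintro _ ⟨x, rfl⟩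
  refine (coordMap_apply_mem_basicOpen j c a ha (X_mem_homogeneousSubmodule j) one_pos x).mpr ?_
  simpa [ha] using (Ideal.ne_top_iff_one _).mp x.2.ne_top

/-- Every morphism from an affine scheme to a standard chart is given by coordinates. -/
lemma exists_eq_coordMap {C : CommRingCat.{u}} (q : Spec C ⟶ Plane k) (j : Fin 3)
    (hq : Set.range q ⊆ Proj.basicOpen (homogeneousSubmodule (Fin 3) k) (X j)) :
    ∃ (c : k →+* C) (a : Fin 3 → C) (ha : a j = 1), q = coordMap j c a ha := by
  have hr : Set.range q ⊆ Set.range (Proj.awayι (homogeneousSubmodule (Fin 3) k) (X j)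
      (X_mem_homogeneousSubmodule j) one_pos) := by
    have := Proj.opensRange_awayι (homogeneousSubmodule (Fin 3) k) (X j)
      (X_mem_homogeneousSubmodule j) one_pos
    rw [← this] at hq
    exact hq
  obtain ⟨χ, hχ⟩ : ∃ χ : CommRingCat.of (Away (homogeneousSubmodule (Fin 3) k) (X j)) ⟶ C,
      q = Spec.map χ ≫ Proj.awayι _ _ (X_mem_homogeneousSubmodule j) one_pos :=
    ⟨Spec.preimage (IsOpenImmersion.lift _ q hr), by
      rw [Spec.map_preimage, IsOpenImmersion.lift_fac]⟩
  -- the universal coordinates on the standard chart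
  let c₀ : k →+* Away (homogeneousSubmodule (Fin 3) k) (X j) :=
    (fromZeroRingHom _ _).comp (algebraMap k (homogeneousSubmodule (Fin 3) k 0))
  let a₀ : Fin 3 → Away (homogeneousSubmodule (Fin 3) k) (X j) := fun i ↦
    Away.mk _ (X_mem_homogeneousSubmodule j) 1 (X i) (by
      rw [one_smul]; exact X_mem_homogeneousSubmodule i)
  have ha₀ : a₀ j = 1 := by
    ext
    rw [Away.val_mk, val_one]
    simp only [pow_one]
    exact Localization.mk_self (⟨X j, _⟩ : Submonoid.powers (X j : MvPolynomial (Fin 3) k))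
  have hval : ∀ i, algebraMap (MvPolynomial (Fin 3) k)
      (Localization.Away (X j : MvPolynomial (Fin 3) k)) (X j) * (a₀ i).val =
        algebraMap _ _ (X i : MvPolynomial (Fin 3) k) := by
    intro i
    rw [Away.val_mk, Localization.mk_eq_mk']
    rw [mul_comm]
    simp
  have key : ∀ n G hG, eval₂Hom c₀ a₀ G = Away.mk _ (X_mem_homogeneousSubmodule j) n G hG := by
    intro n G hG
    ext
    have h1 : (eval₂Hom c₀ a₀ G).val = eval₂Hom
        ((algebraMap _ (Localization.Away (X j : MvPolynomial (Fin 3) k))).comp c₀)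
        (fun i ↦ (a₀ i).val) G :=
      MvPolynomial.eval₂_comp_left (algebraMap (Away (homogeneousSubmodule (Fin 3) k) (X j))
        (Localization.Away (X j : MvPolynomial (Fin 3) k))) c₀ a₀ G
    have hu : IsUnit (algebraMap (MvPolynomial (Fin 3) k) (Localization.Away (X j)) (X j)) :=
      IsLocalization.map_units (Localization.Away (X j : MvPolynomial (Fin 3) k))
        (⟨X j, Submonoid.mem_powers _⟩ : Submonoid.powers (X j : MvPolynomial (Fin 3) k))
    apply (hu.pow n).mul_left_cancel
    have hG' : G.IsHomogeneous n := by simpa using hG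
    rw [h1, ← eval₂Hom_mul_of_isHomogeneous _ _ _ hG']
    simp only [hval]
    rw [Away.val_mk, Localization.mk_eq_mk', mul_comm, ← map_pow]
    erw [IsLocalization.mk'_spec]
    have : (eval₂Hom
        ((algebraMap _ (Localization.Away (X j : MvPolynomial (Fin 3) k))).comp c₀) fun i ↦
          algebraMap (MvPolynomial (Fin 3) k)
            (Localization.Away (X j : MvPolynomial (Fin 3) k)) (X i)) =
        algebraMap (MvPolynomial (Fin 3) k) (Localization.Away (X j)) := by
      apply MvPolynomial.ringHom_ext
      · intro r
        simp only [coe_eval₂Hom, eval₂_C]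
        rfl
      · intro i
        simp
    rw [this]
  refine ⟨χ.hom.comp c₀, χ.hom ∘ a₀, by simp [ha₀], ?_⟩
  rw [hχ, coordMap, toPlane]
  congr 2
  apply CommRingCat.hom_ext
  refine evAway_unique _ _ _ (X_mem_homogeneousSubmodule j) _ fun n G hG ↦ ?_
  have h2 : eval₂Hom (χ.hom.comp c₀) (χ.hom ∘ a₀) G = χ.hom (eval₂Hom c₀ a₀ G) :=
    (MvPolynomial.eval₂_comp_left χ.hom c₀ a₀ G).symm
  rw [h2, key n G hG]
  simp [ha₀]

/-- Coordinates of the same morphism in two standard charts are proportional. -/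
lemma eq_mul_of_coordMap_eq {C : CommRingCat.{u}} {j j' : Fin 3} {c c' : k →+* C}
    {a a' : Fin 3 → C} {ha : a j = 1} {ha' : a' j' = 1}
    (h : coordMap j c a ha = coordMap j' c' a' ha') :
    c = c' ∧ IsUnit (a j') ∧ ∀ i, a i = a j' * a' i := by
  -- `a j'` vanishes nowhere, since the image of the morphism lies in the `j'`-th standard chart
  have hunit : ∀ {j j' : Fin 3} {c c' : k →+* C} {a a' : Fin 3 → C} {ha : a j = 1}
      {ha' : a' j' = 1}, coordMap j c a ha = coordMap j' c' a' ha' → IsUnit (a j') := by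
    intro j j' c c' a a' ha ha' h
    by_contra hu
    obtain ⟨m, hm, hmem⟩ := exists_max_ideal_of_mem_nonunits hu
    have h1 := range_coordMap_subset j' c' a' ha' ⟨(⟨m, hm.isPrime⟩ : PrimeSpectrum C), rfl⟩
    rw [← h] at h1
    have h2 := (coordMap_apply_mem_basicOpen j c a ha (X_mem_homogeneousSubmodule j')
      one_pos ⟨m, hm.isPrime⟩).mp h1
    simp only [coe_eval₂Hom, eval₂_X] at h2
    exact h2 hmem
  have hu := hunit h
  have hu' := hunit h.symm
  -- compare both coordinate maps on the intersection of the two charts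
  have hxm : (X j * X j' : MvPolynomial (Fin 3) k) ∈ homogeneousSubmodule (Fin 3) k (1 + 1) :=
    SetLike.mul_mem_graded (X_mem_homogeneousSubmodule j) (X_mem_homogeneousSubmodule j')
  have hux : IsUnit (eval₂Hom c a (X j * X j')) := by simp [ha, hu]
  have hux' : IsUnit (eval₂Hom c' a' (X j * X j')) := by simp [ha', hu']
  rw [coordMap, coordMap, toPlane_mul _ _ (X_mem_homogeneousSubmodule j') rfl hxm two_pos c a _ hux,
    toPlane_mul _ _ (X_mem_homogeneousSubmodule j) (mul_comm (X j) (X j')) hxm two_pos c' a' _ hux',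
    toPlane, toPlane, cancel_mono] at h
  have h1 := congrArg CommRingCat.Hom.hom (Spec.map_injective h)
  have h2 : evAway _ c a hux = evAway _ c' a' hux' := h1
  refine ⟨?_, hu, fun i ↦ ?_⟩
  · ext r
    have e1 := evAway_mk c a hux hxm 0 (MvPolynomial.C r) (by
      rw [zero_smul, mem_homogeneousSubmodule]; exact isHomogeneous_C _ _)
    have e2 := evAway_mk c' a' hux' hxm 0 (MvPolynomial.C r) (by
      rw [zero_smul, mem_homogeneousSubmodule]; exact isHomogeneous_C _ _)
    rw [h2] at e1
    rw [pow_zero, mul_one] at e1 e2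
    simpa using e1.symm.trans e2
  · have hm : (X i * X j : MvPolynomial (Fin 3) k) ∈
        homogeneousSubmodule (Fin 3) k (1 • (1 + 1)) := by
      rw [one_smul]
      exact SetLike.mul_mem_graded (X_mem_homogeneousSubmodule i) (X_mem_homogeneousSubmodule j)
    have e1 := evAway_mk c a hux hxm 1 _ hm
    have e2 := evAway_mk c' a' hux' hxm 1 _ hm
    rw [h2] at e1
    simp only [pow_one, map_mul, coe_eval₂Hom, eval₂_X, ha, ha', mul_one, one_mul] at e1 e2
    rw [← e1, mul_comm]
    congr 1
    exact hu'.mul_right_cancel e2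

/-- The coordinates `(1, u, v)`, with `1` in position `j`. -/
def stdCoord (k : Type u) [Field k] (j : Fin 3) : Fin 3 → MvPolynomial (Fin 2) k :=
  j.insertNth 1 X

/-- The standard affine charts of the plane. -/
def stdChart (k : Type u) [Field k] (j : Fin 3) :
    Spec (CommRingCat.of (MvPolynomial (Fin 2) k)) ⟶ Plane k :=
  coordMap (C := CommRingCat.of (MvPolynomial (Fin 2) k)) j MvPolynomial.C (stdCoord k j)
    (by simp [stdCoord])

lemma coordMap_eq_stdChart {C : CommRingCat.{u}} (j : Fin 3) (c : k →+* C)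
    (a : Fin 3 → C) (ha : a j = 1) :
    coordMap j c a ha = Spec.map (CommRingCat.ofHom
      (eval₂Hom c (fun i ↦ a (j.succAbove i)) : MvPolynomial (Fin 2) k →+* C)) ≫ stdChart k j := by
  rw [stdChart, SpecMap_coordMap]
  congr 1
  · ext r; simp
  · funext i
    refine Fin.succAboveCases j ?_ (fun l ↦ ?_) i
    · simp [stdCoord, ha]
    · simp [stdCoord]

/-- The standard chart is isomorphic to `Proj.awayι`; both compositions are the identity because
they preserve the coordinates. -/
instance (j : Fin 3) : IsOpenImmersion (stdChart k j) := by
  obtain ⟨c, a, ha, h⟩ := exists_eq_coordMap (Proj.awayι (homogeneousSubmodule (Fin 3) k) (X j)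
    (X_mem_homogeneousSubmodule j) one_pos) j (by
      have := Proj.opensRange_awayι (homogeneousSubmodule (Fin 3) k) (X j)
        (X_mem_homogeneousSubmodule j) one_pos
      rw [← this]
      exact subset_rfl)
  rw [coordMap_eq_stdChart] at h
  set ι := Proj.awayι (homogeneousSubmodule (Fin 3) k) (X j) (X_mem_homogeneousSubmodule j) one_pos
  set φ : CommRingCat.of (MvPolynomial (Fin 2) k) ⟶ _ := CommRingCat.ofHom
    (eval₂Hom c (fun i ↦ a (j.succAbove i)) : MvPolynomial (Fin 2) k →+* _)
  obtain ⟨g, hg⟩ : ∃ g, g ≫ ι = stdChart k j := ⟨_, rfl⟩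
  have h1 : Spec.map φ ≫ g = 𝟙 _ := by
    rw [← cancel_mono ι, Category.assoc, hg, ← h, Category.id_comp]
  have h2 : g ≫ Spec.map φ = 𝟙 _ := by
    obtain ⟨θ, hθ⟩ := Spec.map_surjective (g ≫ Spec.map φ)
    have h3 : Spec.map θ ≫ stdChart k j = stdChart k j := by
      rw [hθ, Category.assoc, ← h, hg]
    conv_lhs at h3 => rw [stdChart, SpecMap_coordMap]
    obtain ⟨h4, -, h5⟩ := eq_mul_of_coordMap_eq h3
    rw [← hθ, ← Spec.map_id]
    congr 1
    apply CommRingCat.hom_ext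
    apply MvPolynomial.ringHom_ext
    · exact fun r ↦ congrArg (fun f : k →+* MvPolynomial (Fin 2) k ↦ f r) h4
    · intro i
      have h6 := h5 (j.succAbove i)
      simpa [stdCoord] using h6
  have : IsIso g := ⟨Spec.map φ, h2, h1⟩
  rw [← hg]
  infer_instance

/-! ### The ideals of a point and of a line in coordinates -/

lemma pullIdeal_vanishingIdeal {X : Scheme.{u}} {A : CommRingCat.{u}} (κ : Spec A ⟶ X)
    [IsOpenImmersion κ] (Z : TopologicalSpace.Closeds X) :
    pullIdeal κ (Scheme.IdealSheafData.vanishingIdeal Z) =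
      PrimeSpectrum.vanishingIdeal (κ ⁻¹' (Z : Set X)) := by
  obtain ⟨φ, _, h⟩ := exists_isIso_eq_SpecMap_fromSpec κ
  obtain ⟨e, rfl⟩ : ∃ e : Γ(X, κ.opensRange) ≅ A, e.hom = φ := ⟨asIso φ, rfl⟩
  rw [congrArg (pullIdeal · (Scheme.IdealSheafData.vanishingIdeal Z)) h, pullIdeal_SpecMap,
    pullIdeal_fromSpec, Scheme.IdealSheafData.vanishingIdeal_ideal,
    ← comap_hom_eq_map_inv e]
  have hid' : ∀ y, e.hom.hom (e.inv.hom y) = y := fun y ↦ by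
    rw [← CommRingCat.comp_apply, Iso.inv_hom_id]; rfl
  have h1 : ∀ x : Spec A, κ x = (isAffineOpen_opensRange κ).fromSpec (Spec.map e.hom x) := by
    intro x
    exact (congrArg (fun q : Spec A ⟶ X ↦ q x) h).trans (Scheme.Hom.comp_apply _ _ _)
  have h2 : ∀ y : Spec Γ(X, κ.opensRange), κ (Spec.map e.inv y) =
      (isAffineOpen_opensRange κ).fromSpec y := by
    intro y
    have : Spec.map e.inv ≫ κ = (isAffineOpen_opensRange κ).fromSpec := by
      refine (congrArg (Spec.map e.inv ≫ ·) h).trans ?_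
      rw [← Category.assoc, ← Spec.map_comp, Iso.hom_inv_id, Spec.map_id, Category.id_comp]
    rw [← Scheme.Hom.comp_apply, this]
  ext b
  rw [Ideal.mem_comap, PrimeSpectrum.mem_vanishingIdeal, PrimeSpectrum.mem_vanishingIdeal]
  constructor
  · intro H x hx
    have hx' : κ x ∈ (Z : Set X) := hx
    have hx2 : (isAffineOpen_opensRange κ).fromSpec (Spec.map e.hom x) ∈ (Z : Set X) := by
      rw [← h1 x]; exact hx'
    have h2 : e.hom.hom (e.inv.hom b) ∈ x.asIdeal := H (Spec.map e.hom x) hx2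
    rwa [hid'] at h2
  · intro H y hy
    exact H (Spec.map e.inv y) (by
      change κ (Spec.map e.inv y) ∈ (Z : Set X)
      rw [h2 y]; exact hy)

lemma mem_planeZeroLocus_iff (s : Set (MvPolynomial (Fin 3) k)) (x : Plane k) :
    x ∈ planeZeroLocus k s ↔
      ∀ F ∈ s, x ∉ Proj.basicOpen (homogeneousSubmodule (Fin 3) k) F := by
  change s ⊆ _ ↔ _
  simp only [Set.subset_def]
  refine forall₂_congr fun F _ ↦ ?_
  exact (not_not (a := F ∈ x.asHomogeneousIdeal)).symm

lemma pullIdeal_stdChart_vanishingIdeal (j : Fin 3) (s : Set (MvPolynomial (Fin 3) k))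
    (hs : ∀ F ∈ s, F ∈ homogeneousSubmodule (Fin 3) k 1) :
    pullIdeal (stdChart k j) (Scheme.IdealSheafData.vanishingIdeal (planeZeroLocus k s)) =
      (Ideal.span (eval₂Hom MvPolynomial.C (stdCoord k j) '' s)).radical := by
  rw [pullIdeal_vanishingIdeal, ← PrimeSpectrum.vanishingIdeal_zeroLocus_eq_radical,
    PrimeSpectrum.zeroLocus_span]
  congr 1
  ext x
  rw [PrimeSpectrum.mem_zeroLocus, Set.image_subset_iff]
  refine (mem_planeZeroLocus_iff s (stdChart k j x)).trans ?_
  refine forall₂_congr fun F hF ↦ ?_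
  rw [stdChart, coordMap_apply_mem_basicOpen _ _ _ _ (hs F hF) one_pos]
  exact not_not

/-- The ideal generated by the `2 × 2` minors of the coordinates of a point `p` and of `a`. -/
def minorsIdeal {C : Type*} [CommRing C] (c : k →+* C) (a : Fin 3 → C) (p : Fin 3 → k) : Ideal C :=
  Ideal.span (Set.range fun il : Fin 3 × Fin 3 ↦ c (p il.1) * a il.2 - c (p il.2) * a il.1)

lemma map_minorsIdeal {C C' : Type*} [CommRing C] [CommRing C'] (φ : C →+* C') (c : k →+* C)
    (a : Fin 3 → C) (p : Fin 3 → k) :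
    (minorsIdeal c a p).map φ = minorsIdeal (φ.comp c) (φ ∘ a) p := by
  rw [minorsIdeal, Ideal.map_span, ← Set.range_comp, minorsIdeal]
  congr 2
  funext il
  simp

lemma minorsIdeal_eq_top {C : Type*} [CommRing C] (c : k →+* C) {a : Fin 3 → C} {j : Fin 3}
    (ha : a j = 1) {p : Fin 3 → k} (hp : p ≠ 0) (hpj : p j = 0) : minorsIdeal c a p = ⊤ := by
  obtain ⟨i, hi⟩ := Function.ne_iff.mp hp
  refine Ideal.eq_top_of_isUnit_mem _ (Ideal.subset_span ⟨(i, j), rfl⟩) ?_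
  simp only [ha, hpj, map_zero, zero_mul, sub_zero, mul_one]
  exact (isUnit_iff_ne_zero.mpr hi).map c

lemma minorsIdeal_eq_span {C : Type*} [CommRing C] (c : k →+* C) {a : Fin 3 → C} {j : Fin 3}
    (ha : a j = 1) {p : Fin 3 → k} (hpj : p j ≠ 0) :
    minorsIdeal c a p = Ideal.span (Set.range fun i ↦ a i - c (p i / p j)) := by
  have hc : c (p j) * c (p j)⁻¹ = 1 := by rw [← map_mul, mul_inv_cancel₀ hpj, map_one]
  apply le_antisymm
  · rw [minorsIdeal, Ideal.span_le]
    rintro _ ⟨⟨i, l⟩, rfl⟩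
    have e : c (p i) * a l - c (p l) * a i = c (p i) * (a l - c (p l / p j)) -
        c (p l) * (a i - c (p i / p j)) := by
      rw [div_eq_mul_inv, div_eq_mul_inv, map_mul, map_mul]; ring
    simp only [e]
    exact sub_mem (Ideal.mul_mem_left _ _ (Ideal.subset_span ⟨l, rfl⟩))
      (Ideal.mul_mem_left _ _ (Ideal.subset_span ⟨i, rfl⟩))
  · rw [Ideal.span_le]
    rintro _ ⟨i, rfl⟩
    have e : a i - c (p i / p j) = c (p j)⁻¹ * (c (p j) * a i - c (p i) * a j) := by
      rw [mul_sub, ← mul_assoc, mul_comm (c (p j)⁻¹), hc, ha, div_eq_mul_inv, map_mul]; ring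
    simp only [e]
    exact Ideal.mul_mem_left _ _ (Ideal.subset_span ⟨(j, i), rfl⟩)

/-- In a standard chart, the ideal of a point is the kernel of an evaluation, or the unit ideal. -/
lemma isRadical_minorsIdeal_stdCoord (j : Fin 3) {p : Fin 3 → k} (hp : p ≠ 0) :
    (minorsIdeal MvPolynomial.C (stdCoord k j) p).IsRadical := by
  have hst : stdCoord k j j = 1 := by simp [stdCoord]
  by_cases hpj : p j = 0
  · rw [minorsIdeal_eq_top _ hst hp hpj]
    exact le_top
  rw [minorsIdeal_eq_span _ hst hpj]
  set J := Ideal.span (Set.range fun i ↦ stdCoord k j i - MvPolynomial.C (p i / p j)) with hJ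
  set x : Fin 2 → k := fun i ↦ p (j.succAbove i) / p j with hx
  have h1 : ∀ f, f - MvPolynomial.C (eval x f) ∈ J := by
    intro f
    rw [← Ideal.Quotient.eq]
    have : (Ideal.Quotient.mk J) = (Ideal.Quotient.mk J).comp
        ((MvPolynomial.C).comp (eval x)) := by
      apply MvPolynomial.ringHom_ext
      · intro r; simp
      · intro i
        simp only [RingHom.comp_apply, eval_X]
        rw [Ideal.Quotient.eq]
        refine Ideal.subset_span ⟨j.succAbove i, ?_⟩
        simp [stdCoord, hx]
    exact congrArg (fun g : MvPolynomial (Fin 2) k →+* _ ↦ g f) this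
  have h2 : J ≤ RingHom.ker (eval x) := by
    rw [hJ, Ideal.span_le]
    rintro _ ⟨i, rfl⟩
    rw [SetLike.mem_coe, RingHom.mem_ker]
    refine Fin.succAboveCases j ?_ (fun l ↦ ?_) i
    · simp [stdCoord, div_self hpj]
    · simp [stdCoord, hx]
  intro f hf
  obtain ⟨n, hn⟩ := hf
  have h3 := h2 hn
  rw [RingHom.mem_ker, map_pow] at h3
  have h4 := h1 f
  rwa [eq_zero_of_pow_eq_zero h3, map_zero, sub_zero] at h4

/-- In coordinates `a`, the ideal of the point `p` is generated by the `2 × 2` minors of the matrix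
with rows `p` and `a`. As the vanishing ideal is known up to radicals only, this is shown first in
the standard charts, from which the general case is pulled back. -/
lemma pullIdeal_coordMap_pointIdeal {C : CommRingCat.{u}} (j : Fin 3) (c : k →+* C)
    (a : Fin 3 → C) (ha : a j = 1) (p : Projectivization k (Fin 3 → k)) :
    pullIdeal (coordMap j c a ha) (pointIdeal p) = minorsIdeal c a p.rep := by
  have h : pullIdeal (stdChart k j) (pointIdeal p) =
      minorsIdeal MvPolynomial.C (stdCoord k j) p.rep := by
    rw [pointIdeal, pullIdeal_stdChart_vanishingIdeal, minorsIdeal]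
    · have e : (eval₂Hom MvPolynomial.C (stdCoord k j) '' {F | ∃ i l : Fin 3,
          F = MvPolynomial.C (p.rep i) * MvPolynomial.X l -
          MvPolynomial.C (p.rep l) * MvPolynomial.X i}) =
          Set.range fun il : Fin 3 × Fin 3 ↦ MvPolynomial.C (p.rep il.1) * stdCoord k j il.2 -
            MvPolynomial.C (p.rep il.2) * stdCoord k j il.1 := by
        ext F
        constructor
        · rintro ⟨_, ⟨i, l, rfl⟩, rfl⟩
          exact ⟨(i, l), by simp⟩
        · rintro ⟨⟨i, l⟩, rfl⟩
          exact ⟨_, ⟨i, l, rfl⟩, by simp⟩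
      rw [e]
      exact (isRadical_minorsIdeal_stdCoord j p.rep_nonzero).radical
    · rintro _ ⟨i, l, rfl⟩
      exact Submodule.sub_mem _ (isHomogeneous_C_mul_X _ _) (isHomogeneous_C_mul_X _ _)
  rw [coordMap_eq_stdChart, pullIdeal_SpecMap, h, map_minorsIdeal]
  congr 1
  · ext r; simp
  · funext i
    refine Fin.succAboveCases j ?_ (fun l ↦ ?_) i
    · simp [stdCoord, ha]
    · simp [stdCoord]

lemma pullIdeal_coordMap_lineIdeal {C : CommRingCat.{u}} (j : Fin 3) (c : k →+* C)
    (a : Fin 3 → C) (ha : a j = 1) :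
    pullIdeal (coordMap j c a ha) (lineIdeal k) = Ideal.span {a 0} := by
  have h : pullIdeal (stdChart k j) (lineIdeal k) = Ideal.span {stdCoord k j 0} := by
    rw [lineIdeal, pullIdeal_stdChart_vanishingIdeal]
    · rw [Set.image_singleton, coe_eval₂Hom, eval₂_X]
      refine Ideal.IsRadical.radical ?_
      obtain rfl | ⟨l, hl⟩ := Fin.eq_self_or_eq_succAbove j 0
      · simp [stdCoord, Ideal.IsRadical]
      · rw [hl, stdCoord, Fin.insertNth_apply_succAbove]
        have : (Ideal.span {(X l : MvPolynomial (Fin 2) k)}).IsPrime :=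
          (Ideal.span_singleton_prime (X_ne_zero l)).mpr (MvPolynomial.X_prime)
        exact this.isRadical
    · rintro _ rfl
      exact X_mem_homogeneousSubmodule 0
  rw [coordMap_eq_stdChart, pullIdeal_SpecMap, h, Ideal.map_span, Set.image_singleton]
  congr 2
  obtain rfl | ⟨l, hl⟩ := Fin.eq_self_or_eq_succAbove j 0
  · simp [stdCoord, ha]
  · rw [hl]; simp [stdCoord]

/-! ### Charts of the blow-up -/

/-- The ideal of a set of points lies between the product and the intersection of the ideals of the
points. -/
lemma prod_minorsIdeal_le {n : ℕ} {C : CommRingCat.{u}} (j : Fin 3) (c : k →+* C)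
    (a : Fin 3 → C) (ha : a j = 1) (p : Fin n → Projectivization k (Fin 3 → k)) :
    (∏ i, minorsIdeal c a (p i).rep ≤ pullIdeal (coordMap j c a ha) (pointsIdeal p)) ∧
      ∀ i, pullIdeal (coordMap j c a ha) (pointsIdeal p) ≤ minorsIdeal c a (p i).rep := by
  constructor
  · have h : ∏ i, pullIdeal (stdChart k j) (pointIdeal (p i)) ≤
        pullIdeal (stdChart k j) (pointsIdeal p) := by
      rw [← pullIdeal_prod]
      refine pullIdeal_mono _ (le_iInf fun i ↦ ?_)
      rw [← Finset.mul_prod_erase _ _ (Finset.mem_univ i)]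
      intro U
      rw [Scheme.IdealSheafData.ideal_mul]
      exact Ideal.mul_le_left (I := (pointIdeal (p i)).ideal U)
    have h2 := Ideal.map_mono (f := (eval₂Hom c (fun i ↦ a (j.succAbove i)) :
      MvPolynomial (Fin 2) k →+* C)) h
    rw [← Ideal.mapHom_apply, map_prod] at h2
    simp only [Ideal.mapHom_apply] at h2
    have h3 : ∀ J, pullIdeal (coordMap j c a ha) J = (pullIdeal (stdChart k j) J).map
        (eval₂Hom c (fun i ↦ a (j.succAbove i)) : MvPolynomial (Fin 2) k →+* C) := by
      intro J
      rw [coordMap_eq_stdChart, pullIdeal_SpecMap]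
      rfl
    simp only [← pullIdeal_coordMap_pointIdeal j c a ha, h3]
    exact h2
  · intro i
    rw [← pullIdeal_coordMap_pointIdeal j c a ha]
    exact pullIdeal_mono _ (iInf_le _ i)

lemma pullIdeal_coordMap_pointsIdeal_of_eq_top {n : ℕ} {C : CommRingCat.{u}} (j : Fin 3)
    (c : k →+* C) (a : Fin 3 → C) (ha : a j = 1) (p : Fin n → Projectivization k (Fin 3 → k))
    (h : ∀ i, minorsIdeal c a (p i).rep = ⊤) :
    pullIdeal (coordMap j c a ha) (pointsIdeal p) = ⊤ := by
  refine top_le_iff.mp (le_trans ?_ (prod_minorsIdeal_le j c a ha p).1)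
  simp [h, ← Ideal.one_eq_top]

lemma pullIdeal_coordMap_pointsIdeal_of_ne {n : ℕ} {C : CommRingCat.{u}} (j : Fin 3)
    (c : k →+* C) (a : Fin 3 → C) (ha : a j = 1) (p : Fin n → Projectivization k (Fin 3 → k))
    (i : Fin n) (h : ∀ i', i' ≠ i → minorsIdeal c a (p i').rep = ⊤) :
    pullIdeal (coordMap j c a ha) (pointsIdeal p) = minorsIdeal c a (p i).rep := by
  refine le_antisymm ((prod_minorsIdeal_le j c a ha p).2 i)
    (le_trans ?_ (prod_minorsIdeal_le j c a ha p).1)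
  rw [← Finset.mul_prod_erase _ _ (Finset.mem_univ i), Finset.prod_eq_one, mul_one]
  intro i' hi'
  rw [h i' (Finset.ne_of_mem_erase hi'), Ideal.one_eq_top]

/-- A chart of the blow-up of the plane in points: an affine plane with coordinates `a` of its map
to the projective plane, an equation `e` of the exceptional divisor, and the set `T` of the points
whose inverse images have to be removed from the affine plane. -/
structure Chart (k : Type u) [Field k] (n : ℕ) where
  /-- the index of a coordinate equal to `1` -/
  j : Fin 3
  /-- the coordinates of the map to the projective plane -/
  a : Fin 3 → MvPolynomial (Fin 2) k
  a_j : a j = 1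
  /-- the equation of the exceptional divisor -/
  e : MvPolynomial (Fin 2) k
  /-- the points to be removed -/
  T : Set (Fin n)

/-- The map from a chart to the plane. -/
def Chart.map {n : ℕ} (ch : Chart k n) : Spec (CommRingCat.of (MvPolynomial (Fin 2) k)) ⟶ Plane k :=
  coordMap (C := CommRingCat.of (MvPolynomial (Fin 2) k)) ch.j MvPolynomial.C ch.a ch.a_j

/-- The chart is compatible with the universal property of the blow-up: the centre is cut out by
`e` away from the removed points, and maps to the chart are determined by their images in the
plane. -/
structure Chart.IsCompatible {n : ℕ} (ch : Chart k n) (p : Fin n → Projectivization k (Fin 3 → k)) :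
    Prop where
  e_ne_zero : ch.e ≠ 0
  minorsIdeal_eq : ∀ i ∉ ch.T, minorsIdeal MvPolynomial.C ch.a (p i).rep = Ideal.span {ch.e}
  pullIdeal_eq : ∀ (C : CommRingCat.{u})
    (φ : CommRingCat.of (MvPolynomial (Fin 2) k) ⟶ C),
    (∀ i ∈ ch.T, (minorsIdeal MvPolynomial.C ch.a (p i).rep).map φ.hom = ⊤) →
      pullIdeal (Spec.map φ ≫ ch.map) (pointsIdeal p) = Ideal.span {φ.hom ch.e}
  hom_ext : ∀ (C : CommRingCat.{u}) (g₁ g₂ : CommRingCat.of (MvPolynomial (Fin 2) k) ⟶ C),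
    g₁.hom ch.e ∈ (C : Type u)⁰ → Spec.map g₁ ≫ ch.map = Spec.map g₂ ≫ ch.map → g₁ = g₂

/-- `κ` is the open immersion of a localization of the chart into the blow-up. -/
structure Chart.IsLocalImmersion {n : ℕ} (ch : Chart k n)
    (p : Fin n → Projectivization k (Fin 3 → k)) {S : Scheme.{u}} (π : S ⟶ Plane k)
    (g : MvPolynomial (Fin 2) k)
    (κ : Spec (CommRingCat.of (Localization.Away g)) ⟶ S) : Prop where
  isOpenImmersion : IsOpenImmersion κ
  comp_eq : κ ≫ π = Spec.map (CommRingCat.ofHom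
    (algebraMap (MvPolynomial (Fin 2) k) (Localization.Away g))) ≫ ch.map
  map_minorsIdeal_eq_top : ∀ i ∈ ch.T, (minorsIdeal MvPolynomial.C ch.a (p i).rep).map
    (algebraMap (MvPolynomial (Fin 2) k) (Localization.Away g)) = ⊤

/-- If a neighbourhood of a point `s` of the blow-up maps compatibly to a chart, and if `s` does not
lie over one of the removed points, then a localization of the chart is an open neighbourhood of
`s`. -/
theorem Chart.IsCompatible.exists_isLocalImmersion {n : ℕ} {ch : Chart k n}
    {p : Fin n → Projectivization k (Fin 3 → k)} (hch : ch.IsCompatible p) {S : Scheme.{u}}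
    {π : S ⟶ Plane k} (hπ : IsBlowUp π (pointsIdeal p)) {A : CommRingCat.{u}} (κ : Spec A ⟶ S)
    [IsOpenImmersion κ] (s : Spec A) {fA : A} (hfA : fA ∈ (A : Type u)⁰)
    (hA : pullIdeal (κ ≫ π) (pointsIdeal p) = Ideal.span {fA})
    (ψ : CommRingCat.of (MvPolynomial (Fin 2) k) ⟶ A) (hψ : Spec.map ψ ≫ ch.map = κ ≫ π)
    (hT : ∀ i ∈ ch.T, ¬ (minorsIdeal MvPolynomial.C ch.a (p i).rep).map ψ.hom ≤ s.asIdeal) :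
    ∃ g κ', ch.IsLocalImmersion p π g κ' ∧ κ s ∈ Set.range κ' := by
  classical
  -- a function on the chart which vanishes at the removed points, but not at the image of `s`
  obtain ⟨g₀, hg₀, hg₀s⟩ : ∃ g₀, (∀ i ∈ ch.T, g₀ ∈ minorsIdeal MvPolynomial.C ch.a (p i).rep) ∧
      ψ.hom g₀ ∉ s.asIdeal := by
    have : ∀ i, ∃ h, (i ∈ ch.T → h ∈ minorsIdeal MvPolynomial.C ch.a (p i).rep) ∧
        ψ.hom h ∉ s.asIdeal := by
      intro i
      by_cases hi : i ∈ ch.T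
      · have h := hT i hi
        rw [Ideal.map_le_iff_le_comap] at h
        obtain ⟨h, h1, h2⟩ := Set.not_subset.mp h
        exact ⟨h, fun _ ↦ h1, h2⟩
      · exact ⟨1, fun h ↦ absurd h hi, by
          rw [map_one]; exact (Ideal.ne_top_iff_one _).mp s.2.ne_top⟩
    choose h h1 h2 using this
    refine ⟨∏ i, h i, fun i hi ↦ Ideal.mem_of_dvd _ (Finset.dvd_prod_of_mem h (Finset.mem_univ i))
      (h1 i hi), ?_⟩
    rw [map_prod, Ideal.IsPrime.prod_mem_iff (hp := s.2)]
    simpa using h2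
  -- localize both sides at `g₀`
  let R := MvPolynomial (Fin 2) k
  let B : CommRingCat.{u} := CommRingCat.of (Localization.Away g₀)
  let ιB : CommRingCat.of R ⟶ B := CommRingCat.ofHom (algebraMap R (Localization.Away g₀))
  obtain ⟨gA, hgA⟩ : ∃ gA : A, gA = ψ.hom g₀ := ⟨_, rfl⟩
  let A' : CommRingCat.{u} := CommRingCat.of (Localization.Away gA)
  let ιA : A ⟶ A' := CommRingCat.ofHom (algebraMap A (Localization.Away gA))
  have hoA : IsOpenImmersion (Spec.map ιA) := by dsimp only [ιA]; infer_instance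
  have hu' : IsUnit ((ψ ≫ ιA).hom g₀) := by
    have : (ψ ≫ ιA).hom g₀ = algebraMap A (Localization.Away gA) gA :=
      congrArg (algebraMap A (Localization.Away gA)) hgA.symm
    rw [this]
    exact IsLocalization.Away.algebraMap_isUnit gA
  obtain ⟨ψ', hψ'⟩ : ∃ ψ' : B ⟶ A', ιB ≫ ψ' = ψ ≫ ιA :=
    ⟨CommRingCat.ofHom (IsLocalization.Away.lift (S := Localization.Away g₀) g₀ hu'),
      CommRingCat.hom_ext (IsLocalization.Away.lift_comp g₀ hu')⟩
  obtain ⟨s', hs'⟩ : ∃ s' : Spec A', Spec.map ιA s' = s := by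
    have : s ∈ Set.range (Spec.map ιA) := by
      have h : Set.range (Spec.map ιA) = (PrimeSpectrum.basicOpen gA : Set (PrimeSpectrum A)) :=
        PrimeSpectrum.localization_away_comap_range (Localization.Away gA) gA
      rw [h, hgA]
      exact hg₀s
    exact this
  have htop : ∀ i ∈ ch.T, (minorsIdeal MvPolynomial.C ch.a (p i).rep).map ιB.hom = ⊤ := by
    intro i hi
    refine Ideal.eq_top_of_isUnit_mem _ (Ideal.mem_map_of_mem _ (hg₀ i hi)) ?_
    exact IsLocalization.Away.algebraMap_isUnit g₀
  have hinj : Function.Injective (algebraMap R (Localization.Away g₀)) := by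
    refine IsLocalization.injective _ (M := Submonoid.powers g₀) ?_
    refine Submonoid.powers_le.mpr (mem_nonZeroDivisors_of_ne_zero ?_)
    rintro rfl
    simp at hg₀s
  obtain ⟨g₁, κ₁, hκ₁, hmem, hcomp⟩ := hπ.exists_localization_isOpenImmersion
    (Spec.map ιA ≫ κ) (Spec.map ιB ≫ ch.map) ψ' (by
      rw [← Spec.map_comp_assoc, hψ', Spec.map_comp, Category.assoc, hψ, Category.assoc])
    (fA := ιA.hom fA)
    (IsLocalization.map_nonZeroDivisors_le (Submonoid.powers gA) (Localization.Away gA)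
        (Submonoid.mem_map_of_mem _ hfA))
    (by rw [Category.assoc, pullIdeal_SpecMap, hA, Ideal.map_span, Set.image_singleton])
    (fB := ιB.hom ch.e)
    (by
      refine IsLocalization.map_nonZeroDivisors_le (Submonoid.powers g₀) (Localization.Away g₀)
        (Submonoid.mem_map_of_mem _ (mem_nonZeroDivisors_of_ne_zero hch.e_ne_zero)))
    (hch.pullIdeal_eq B ιB htop)
    (by
      intro C g₁ g₂ hg h
      rw [← Spec.map_comp_assoc, ← Spec.map_comp_assoc] at h
      have := hch.hom_ext C (ιB ≫ g₁) (ιB ≫ g₂) hg h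
      apply CommRingCat.hom_ext
      apply IsLocalization.ringHom_ext (Submonoid.powers g₀)
      exact congrArg CommRingCat.Hom.hom this) s'
  -- an iterated localization is a localization
  let A₁ := Localization.Away (g₁ : Localization.Away g₀)
  obtain ⟨m, b, hb⟩ := IsLocalization.Away.surj g₀ (g₁ : Localization.Away g₀)
  have hloc0 : IsLocalization.Away (algebraMap R (Localization.Away g₀) b) A₁ := by
    rw [← hb]
    refine IsLocalization.Away.of_associated (r := (g₁ : Localization.Away g₀)) ?_
    exact (associated_mul_unit_right _ _ ((IsLocalization.Away.algebraMap_isUnit g₀).pow m))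
  have hloc : IsLocalization.Away (g₀ * b) A₁ :=
    IsLocalization.Away.mul' (Localization.Away g₀) A₁ g₀ b
  let E : Localization.Away (g₀ * b) ≃ₐ[R] A₁ :=
    IsLocalization.algEquiv (Submonoid.powers (g₀ * b)) _ _
  let E' : CommRingCat.of (Localization.Away (g₀ * b)) ≅ CommRingCat.of A₁ :=
    E.toRingEquiv.toCommRingCatIso
  have hE' : CommRingCat.ofHom (algebraMap R (Localization.Away (g₀ * b))) =
      (ιB ≫ CommRingCat.ofHom (algebraMap B A₁)) ≫ E'.inv := by
    apply CommRingCat.hom_ext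
    exact RingHom.ext fun x ↦ (E.symm.commutes x).symm
  refine ⟨g₀ * b, Spec.map E'.inv ≫ κ₁, ⟨inferInstance, ?_, fun i hi ↦ ?_⟩, ?_⟩
  · rw [Category.assoc, hcomp, hE']
    simp only [Spec.map_comp, Category.assoc]
  · refine Ideal.eq_top_of_isUnit_mem _ (Ideal.mem_map_of_mem _ (hg₀ i hi)) ?_
    refine isUnit_of_mul_isUnit_left (y := algebraMap R _ b) ?_
    rw [← map_mul]
    exact IsLocalization.Away.algebraMap_isUnit _
  · obtain ⟨y, hy⟩ := hmem
    refine ⟨Spec.map E'.hom y, ?_⟩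
    rw [Scheme.Hom.comp_apply, ← Scheme.Hom.comp_apply (Spec.map E'.hom), ← Spec.map_comp]
    rw [Iso.inv_hom_id, Spec.map_id]
    exact hy.trans (by rw [Scheme.Hom.comp_apply, hs'])

/-- A standard affine chart of the plane, with all points removed. -/
def Chart.std (k : Type u) [Field k] (n : ℕ) (j : Fin 3) : Chart k n where
  j := j
  a := stdCoord k j
  a_j := by simp [stdCoord]
  e := 1
  T := Set.univ

/-- The affine coordinates of a point of the plane which is not on the line `x₂ = 0`. -/
def affCoord (p : Projectivization k (Fin 3 → k)) (l : Fin 2) : k :=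
  p.rep l.castSucc / p.rep 2

/-- The coordinates `(z + (u, uv), 1)` if `l = 0`, and `(z + (uv, u), 1)` if `l = 1`. -/
def excCoord (z : Fin 2 → k) (l : Fin 2) : Fin 3 → MvPolynomial (Fin 2) k :=
  Fin.snoc (α := fun _ ↦ MvPolynomial (Fin 2) k)
    (fun l' ↦ MvPolynomial.C (z l') + X 0 * (if l' = l then 1 else X 1)) 1

/-- One of the two charts around the exceptional divisor over the `i`-th point. -/
def Chart.exc {n : ℕ} (p : Fin n → Projectivization k (Fin 3 → k)) (i : Fin n) (l : Fin 2) :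
    Chart k n where
  j := 2
  a := excCoord (affCoord (p i)) l
  a_j := Fin.snoc_last (α := fun _ ↦ MvPolynomial (Fin 2) k) _ _
  e := X 0
  T := {i}ᶜ

lemma Chart.SpecMap_map {n : ℕ} (ch : Chart k n) {C : CommRingCat.{u}}
    (φ : CommRingCat.of (MvPolynomial (Fin 2) k) ⟶ C) :
    Spec.map φ ≫ ch.map = coordMap ch.j (φ.hom.comp MvPolynomial.C) (φ.hom ∘ ch.a)
      (by simp [ch.a_j]) :=
  SpecMap_coordMap _ _ _ _ _

lemma Chart.std_isCompatible {n : ℕ} (p : Fin n → Projectivization k (Fin 3 → k)) (j : Fin 3) :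
    (Chart.std k n j).IsCompatible p where
  e_ne_zero := one_ne_zero
  minorsIdeal_eq i hi := absurd trivial hi
  pullIdeal_eq C φ h := by
    rw [Chart.SpecMap_map, pullIdeal_coordMap_pointsIdeal_of_eq_top]
    · rw [Chart.std, map_one, Ideal.span_singleton_one]
    · intro i
      rw [← map_minorsIdeal]
      exact h i trivial
  hom_ext C g₁ g₂ _ h := by
    have h' : Spec.map g₁ ≫ stdChart k j = Spec.map g₂ ≫ stdChart k j := h
    rw [cancel_mono] at h'
    exact Spec.map_injective h'

lemma minorsIdeal_eq_span_affCoord {C : Type*} [CommRing C] (c : k →+* C) {a : Fin 3 → C}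
    (ha : a 2 = 1) {p : Projectivization k (Fin 3 → k)} (hp : p.rep 2 ≠ 0) :
    minorsIdeal c a p.rep =
      Ideal.span (Set.range fun l : Fin 2 ↦ a l.castSucc - c (affCoord p l)) := by
  rw [minorsIdeal_eq_span c ha hp]
  apply le_antisymm <;> rw [Ideal.span_le]
  · rintro _ ⟨r, rfl⟩
    refine Fin.lastCases ?_ (fun l ↦ ?_) r
    · change a 2 - c (p.rep 2 / p.rep 2) ∈ _
      rw [ha, div_self hp, map_one, sub_self]
      exact zero_mem _
    · exact Ideal.subset_span ⟨l, rfl⟩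
  · rintro _ ⟨l, rfl⟩
    exact Ideal.subset_span ⟨l.castSucc, rfl⟩

lemma minorsIdeal_excCoord {p : Projectivization k (Fin 3 → k)} (hp : p.rep 2 ≠ 0) (l : Fin 2) :
    minorsIdeal MvPolynomial.C (excCoord (affCoord p) l) p.rep = Ideal.span {X 0} := by
  have h2 : excCoord (affCoord p) l 2 = 1 :=
    Fin.snoc_last (α := fun _ ↦ MvPolynomial (Fin 2) k) _ _
  have hl : ∀ l', excCoord (affCoord p) l l'.castSucc - MvPolynomial.C (affCoord p l') =
      X 0 * (if l' = l then 1 else X 1) := by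
    intro l'
    rw [excCoord, Fin.snoc_castSucc, add_sub_cancel_left]
  rw [minorsIdeal_eq_span_affCoord _ h2 hp]
  simp only [hl]
  apply le_antisymm <;> rw [Ideal.span_le]
  · rintro _ ⟨l', rfl⟩
    exact Ideal.mul_mem_right _ _ (Ideal.mem_span_singleton_self _)
  · rintro _ rfl
    exact Ideal.subset_span ⟨l, by simp⟩

/-- In the chart `(z + (u, uv), 1)`, the map to the plane determines `u`, and it determines `v` if
`u` is a nonzerodivisor. -/
lemma Chart.exc_isCompatible {n : ℕ} (p : Fin n → Projectivization k (Fin 3 → k))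
    (i : Fin n) (hp : (p i).rep 2 ≠ 0) (l : Fin 2) : (Chart.exc p i l).IsCompatible p where
  e_ne_zero := X_ne_zero _
  minorsIdeal_eq i' hi' := by
    obtain rfl : i' = i := not_not.mp hi'
    exact minorsIdeal_excCoord hp l
  pullIdeal_eq C φ h := by
    rw [Chart.SpecMap_map, pullIdeal_coordMap_pointsIdeal_of_ne _ _ _ _ _ i]
    · rw [← map_minorsIdeal]
      have := congrArg (Ideal.map φ.hom) (minorsIdeal_excCoord hp l)
      rw [Ideal.map_span, Set.image_singleton] at this
      exact this
    · intro i' hi'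
      rw [← map_minorsIdeal]
      exact h i' hi'
  hom_ext C g₁ g₂ hg h := by
    rw [Chart.SpecMap_map, Chart.SpecMap_map] at h
    obtain ⟨hc, -, ha⟩ := eq_mul_of_coordMap_eq h
    have hc' : ∀ r, g₁.hom (MvPolynomial.C r) = g₂.hom (MvPolynomial.C r) :=
      fun r ↦ congrArg (fun f : k →+* C ↦ f r) hc
    have ha' : ∀ l' : Fin 2, g₁.hom (excCoord (affCoord (p i)) l l'.castSucc) =
        g₂.hom (excCoord (affCoord (p i)) l l'.castSucc) := by
      intro l'
      have := ha l'.castSucc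
      have h2 : (g₁.hom ∘ (Chart.exc p i l).a) (Chart.exc p i l).j = 1 := by
        rw [Function.comp_apply, (Chart.exc p i l).a_j, map_one]
      rw [h2, one_mul] at this
      exact this
    simp only [excCoord, Fin.snoc_castSucc, map_add, hc', map_mul, add_right_inj] at ha'
    have h0 : g₁.hom (X 0) = g₂.hom (X 0) := by simpa using ha' l
    have h1 : g₁.hom (X 1) = g₂.hom (X 1) := by
      obtain ⟨l', hl'⟩ : ∃ l' : Fin 2, l' ≠ l := exists_ne l
      have := ha' l'
      simp only [hl', if_false, ← h0] at this
      exact (mul_cancel_left_mem_nonZeroDivisors hg).mp this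
    apply CommRingCat.hom_ext
    apply MvPolynomial.ringHom_ext hc'
    intro i
    fin_cases i
    · exact h0
    · exact h1

lemma exists_isOpenImmersion_isUnit {A : CommRingCat.{u}} (s : Spec A) {h : A}
    (hs : h ∉ s.asIdeal) :
    ∃ (A' : CommRingCat.{u}) (ι : A ⟶ A') (s' : Spec A'), IsOpenImmersion (Spec.map ι) ∧
      Spec.map ι s' = s ∧ IsUnit (ι.hom h) ∧ ∀ f ∈ (A : Type u)⁰, ι.hom f ∈ (A' : Type u)⁰ := by
  have hmem : s ∈ Set.range
      (Spec.map (CommRingCat.ofHom (algebraMap A (Localization.Away h)))) := by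
    have h1 : Set.range (Spec.map (CommRingCat.ofHom (algebraMap A (Localization.Away h)))) =
        (PrimeSpectrum.basicOpen h : Set (PrimeSpectrum A)) :=
      PrimeSpectrum.localization_away_comap_range (Localization.Away h) h
    rw [h1]
    exact hs
  obtain ⟨s', hs'⟩ := hmem
  exact ⟨CommRingCat.of (Localization.Away h),
    CommRingCat.ofHom (algebraMap A (Localization.Away h)), s', inferInstance, hs',
    IsLocalization.Away.algebraMap_isUnit h, fun f hf ↦
      IsLocalization.map_nonZeroDivisors_le (Submonoid.powers h) (Localization.Away h)
        (Submonoid.mem_map_of_mem _ hf)⟩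

lemma exists_mem_basicOpen_X (x : Plane k) :
    ∃ j : Fin 3, x ∈ Proj.basicOpen (homogeneousSubmodule (Fin 3) k) (X j) := by
  have h := Proj.iSup_basicOpen_eq_top' (homogeneousSubmodule (Fin 3) k)
    (fun j : Fin 3 ↦ (X j : MvPolynomial (Fin 3) k)) (fun j ↦ ⟨1, X_mem_homogeneousSubmodule j⟩) (by
      refine top_le_iff.mp fun F _ ↦ ?_
      induction F using MvPolynomial.induction_on with
      | C r => exact Subalgebra.algebraMap_mem _ (⟨MvPolynomial.C r, isHomogeneous_C _ _⟩ :
          homogeneousSubmodule (Fin 3) k 0)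
      | add F G hF hG => exact add_mem (hF trivial) (hG trivial)
      | mul_X F i hF => exact mul_mem (hF trivial) (Algebra.subset_adjoin ⟨i, rfl⟩))
  have hx : x ∈ (⊤ : (Plane k).Opens) := trivial
  rw [← h] at hx
  exact TopologicalSpace.Opens.mem_iSup.mp hx

/-- The charts cover the blow-up. Away from the exceptional divisors this is clear; near a point of
the `i`-th exceptional divisor, the pull-backs of the two affine coordinates centred at the `i`-th
point generate the ideal of the divisor, so one of them does so locally. -/
theorem exists_chart_isLocalImmersion {n : ℕ} {p : Fin n → Projectivization k (Fin 3 → k)}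
    (hp : ∀ i, (p i).rep 2 ≠ 0) (hinj : ∀ i i', affCoord (p i) = affCoord (p i') → i = i')
    {S : Scheme.{u}} {π : S ⟶ Plane k} (hπ : IsBlowUp π (pointsIdeal p)) (s : S) :
    ∃ ch : Chart k n, ((∃ j, ch = Chart.std k n j) ∨ ∃ i l, ch = Chart.exc p i l) ∧
      ∃ g κ, ch.IsLocalImmersion p π g κ ∧ s ∈ Set.range κ := by
  classical
  obtain ⟨⟨U, hU⟩, hsU, f₀, hf₀, hI₀⟩ := hπ.isEffectiveCartier s
  have hU' : IsAffineOpen U := hU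
  have hoU : IsOpenImmersion hU'.fromSpec := inferInstance
  obtain ⟨j, hj, hj2⟩ : ∃ j, π s ∈ Proj.basicOpen (homogeneousSubmodule (Fin 3) k) (X j) ∧
      (π s ∈ Proj.basicOpen (homogeneousSubmodule (Fin 3) k) (X 2) → j = 2) := by
    by_cases h : π s ∈ Proj.basicOpen (homogeneousSubmodule (Fin 3) k) (X 2)
    · exact ⟨2, h, fun _ ↦ rfl⟩
    · obtain ⟨j, hj⟩ := exists_mem_basicOpen_X (π s)
      exact ⟨j, hj, fun h' ↦ absurd h' h⟩
  -- an affine neighbourhood mapping to the standard chart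
  obtain ⟨A, κ, hκ, s, rfl, f, hf, hI, c, a, ha, hq⟩ : ∃ (A : CommRingCat.{u}) (κ : Spec A ⟶ S)
      (_ : IsOpenImmersion κ) (s' : Spec A) (_ : κ s' = s) (f : A) (_ : f ∈ (A : Type u)⁰)
      (_ : pullIdeal (κ ≫ π) (pointsIdeal p) = Ideal.span {f}) (c : k →+* A) (a : Fin 3 → A)
      (ha : a j = 1), κ ≫ π = coordMap j c a ha := by
    obtain ⟨s₀, hs₀⟩ : ∃ s₀, hU'.fromSpec s₀ = s := by
      have : s ∈ Set.range hU'.fromSpec := by rw [hU'.range_fromSpec]; exact hsU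
      exact this
    obtain ⟨_, ⟨h, rfl⟩, hs₀h, hh⟩ :=
      PrimeSpectrum.isTopologicalBasis_basic_opens.exists_subset_of_mem_open
      (show s₀ ∈ (hU'.fromSpec ≫ π) ⁻¹ᵁ
        Proj.basicOpen (homogeneousSubmodule (Fin 3) k) (X j) by
          rw [← hs₀, ← Scheme.Hom.comp_apply] at hj
          exact hj) (TopologicalSpace.Opens.isOpen _)
    obtain ⟨A, ι, s', hι, hs', hu, hnzd⟩ := exists_isOpenImmersion_isUnit s₀ hs₀h
    have hr : Set.range ((Spec.map ι ≫ hU'.fromSpec) ≫ π) ⊆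
        Proj.basicOpen (homogeneousSubmodule (Fin 3) k) (X j) := by
      rintro _ ⟨x, rfl⟩
      have hx : h ∉ (Spec.map ι x).asIdeal := by
        intro hx
        exact x.2.ne_top (Ideal.eq_top_of_isUnit_mem _ hx hu)
      rw [Category.assoc, Scheme.Hom.comp_apply]
      exact hh hx
    obtain ⟨c, a, ha, hq⟩ := exists_eq_coordMap _ j hr
    refine ⟨A, Spec.map ι ≫ hU'.fromSpec, inferInstance, s', by
      rw [Scheme.Hom.comp_apply, hs', hs₀], ι.hom f₀, hnzd _ hf₀, ?_, c, a, ha, hq⟩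
    rw [Category.assoc, pullIdeal_SpecMap, ← pullIdeal_comap, pullIdeal_fromSpec, hI₀,
      Ideal.map_span, Set.image_singleton]
  -- away from the exceptional divisors, the standard chart of the plane is a chart
  by_cases hall : ∀ i, ¬ minorsIdeal c a (p i).rep ≤ s.asIdeal
  · refine ⟨Chart.std k n j, Or.inl ⟨j, rfl⟩, ?_⟩
    let ψ : CommRingCat.of (MvPolynomial (Fin 2) k) ⟶ A :=
      CommRingCat.ofHom (eval₂Hom c (fun i ↦ a (j.succAbove i)))
    have hψ : ψ.hom ∘ stdCoord k j = a := by
      funext i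
      refine Fin.succAboveCases j ?_ (fun l ↦ ?_) i
      · simp [stdCoord, ha]
      · simp [stdCoord, ψ]
    have hψc : ψ.hom.comp MvPolynomial.C = c := by
      ext r; simp [ψ]
    refine (Chart.std_isCompatible p j).exists_isLocalImmersion hπ κ s hf hI ψ ?_ ?_
    · rw [hq, coordMap_eq_stdChart]; rfl
    · intro i _
      rw [map_minorsIdeal, hψc]
      have := hall i
      rwa [← hψ] at this
  push Not at hall
  obtain ⟨i, hi⟩ := hall
  -- the points do not lie on the line `x₂ = 0`, so that the chart with `j = 2` was chosen
  have ha2 : a 2 ∉ s.asIdeal := by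
    intro h2
    have h1 : ∀ l, a l ∈ s.asIdeal := by
      intro l
      have h3 : c ((p i).rep 2) * a l - c ((p i).rep l) * a 2 ∈ s.asIdeal :=
        hi (Ideal.subset_span ⟨(2, l), rfl⟩)
      have h4 : c ((p i).rep 2) * a l ∈ s.asIdeal := by
        simpa using add_mem h3 (Ideal.mul_mem_left _ (c ((p i).rep l)) h2)
      exact (Ideal.unit_mul_mem_iff_mem _ ((isUnit_iff_ne_zero.mpr (hp i)).map c)).mp h4
    exact (Ideal.ne_top_iff_one _).mp s.2.ne_top (ha ▸ h1 j)
  obtain rfl : j = 2 := by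
    apply hj2
    rw [← Scheme.Hom.comp_apply, hq]
    refine (coordMap_apply_mem_basicOpen j c a ha (X_mem_homogeneousSubmodule 2) one_pos s).mpr ?_
    simpa using ha2
  -- the other points do not lie below `s`
  have hother : ∀ i', i' ≠ i → ¬ minorsIdeal c a (p i').rep ≤ s.asIdeal := by
    intro i' hi' h
    refine hi' (hinj i' i (funext fun l ↦ ?_))
    by_contra hne
    rw [minorsIdeal_eq_span_affCoord c ha (hp _)] at h hi
    have h1 := sub_mem (hi (Ideal.subset_span ⟨l, rfl⟩)) (h (Ideal.subset_span ⟨l, rfl⟩))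
    simp only [sub_sub_sub_cancel_left, ← map_sub] at h1
    exact s.2.ne_top (Ideal.eq_top_of_isUnit_mem _ h1
      ((isUnit_iff_ne_zero.mpr (sub_ne_zero.mpr hne)).map c))
  obtain ⟨h, hh, hhs⟩ : ∃ h, (∀ i', i' ≠ i → h ∈ minorsIdeal c a (p i').rep) ∧ h ∉ s.asIdeal := by
    have : ∀ i', ∃ h, (i' ≠ i → h ∈ minorsIdeal c a (p i').rep) ∧ h ∉ s.asIdeal := by
      intro i'
      by_cases hi' : i' = i
      · exact ⟨1, fun h ↦ absurd hi' h, (Ideal.ne_top_iff_one _).mp s.2.ne_top⟩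
      · obtain ⟨h, h1, h2⟩ := Set.not_subset.mp (hother i' hi')
        exact ⟨h, fun _ ↦ h1, h2⟩
    choose h h1 h2 using this
    refine ⟨∏ i, h i, fun i hi ↦ Ideal.mem_of_dvd _ (Finset.dvd_prod_of_mem h (Finset.mem_univ i))
      (h1 i hi), ?_⟩
    rw [Ideal.IsPrime.prod_mem_iff (hp := s.2)]
    simpa using h2
  obtain ⟨A₁, ι, s, hι, rfl, hu, hnzd⟩ := exists_isOpenImmersion_isUnit s hhs
  obtain ⟨c₁, hc₁⟩ : ∃ c₁, c₁ = ι.hom.comp c := ⟨_, rfl⟩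
  obtain ⟨a₁, ha₁⟩ : ∃ a₁, a₁ = ι.hom ∘ a := ⟨_, rfl⟩
  have ha₁2 : a₁ 2 = 1 := by simp [ha₁, ha]
  have htop : ∀ i', i' ≠ i → minorsIdeal c₁ a₁ (p i').rep = ⊤ := by
    intro i' hi'
    rw [hc₁, ha₁, ← map_minorsIdeal]
    exact Ideal.eq_top_of_isUnit_mem _ (Ideal.mem_map_of_mem _ (hh i' hi')) hu
  have hq₁ : (Spec.map ι ≫ κ) ≫ π = coordMap 2 c₁ a₁ ha₁2 := by
    subst hc₁ ha₁
    rw [Category.assoc, hq, SpecMap_coordMap]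
  have hI₁ : Ideal.span (Set.range fun l : Fin 2 ↦ a₁ l.castSucc - c₁ (affCoord (p i) l)) =
      Ideal.span {ι.hom f} := by
    rw [← minorsIdeal_eq_span_affCoord c₁ ha₁2 (hp i),
      ← pullIdeal_coordMap_pointsIdeal_of_ne 2 c₁ a₁ ha₁2 p i htop, ← hq₁, Category.assoc,
      pullIdeal_SpecMap, hI, Ideal.map_span, Set.image_singleton]
  have hf₁ := hnzd f hf
  -- one of the two coordinates generates the ideal of the exceptional divisor
  have hdvd : ∀ l : Fin 2, ∃ b, a₁ l.castSucc - c₁ (affCoord (p i) l) = ι.hom f * b := by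
    intro l
    have : a₁ l.castSucc - c₁ (affCoord (p i) l) ∈ Ideal.span {ι.hom f} := by
      rw [← hI₁]; exact Ideal.subset_span ⟨l, rfl⟩
    exact Ideal.mem_span_singleton.mp this
  choose b hb using hdvd
  obtain ⟨l, hl⟩ : ∃ l, b l ∉ s.asIdeal := by
    by_contra! hcon
    have h1 : ι.hom f ∈ Ideal.span (Set.range fun l : Fin 2 ↦
        a₁ l.castSucc - c₁ (affCoord (p i) l)) := by
      rw [hI₁]; exact Ideal.mem_span_singleton_self _
    obtain ⟨r, hr⟩ := (Ideal.mem_span_range_iff_exists_fun).mp h1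
    simp only [hb] at hr
    have h2 : ι.hom f * (∑ l, r l * b l) = ι.hom f * 1 := by
      rw [Finset.mul_sum, mul_one]
      exact (Finset.sum_congr rfl fun l _ ↦ by ring).trans hr
    have h3 := (mul_cancel_left_mem_nonZeroDivisors hf₁).mp h2
    refine (Ideal.ne_top_iff_one _).mp s.2.ne_top ?_
    rw [← h3]
    exact Ideal.sum_mem _ fun l _ ↦ Ideal.mul_mem_left _ _ (hcon l)
  obtain ⟨A₂, ι₂, s, hι₂, rfl, hu₂, hnzd₂⟩ := exists_isOpenImmersion_isUnit s hl
  refine ⟨Chart.exc p i l, Or.inr ⟨i, l, rfl⟩, ?_⟩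
  obtain ⟨w, hw⟩ := hu₂.exists_right_inv
  obtain ⟨l', hl'⟩ : ∃ l' : Fin 2, l' ≠ l := exists_ne l
  -- the coordinates `u` and `v` in the neighbourhood of `s`
  let ψ : CommRingCat.of (MvPolynomial (Fin 2) k) ⟶ A₂ :=
    CommRingCat.ofHom (eval₂Hom (ι₂.hom.comp c₁)
      ![ι₂.hom (ι.hom f * b l), ι₂.hom (b l') * w])
  have hψc : ψ.hom.comp MvPolynomial.C = ι₂.hom.comp c₁ := by
    ext r; simp [ψ]
  have hψX : ∀ r, ψ.hom (X r) = ![ι₂.hom (ι.hom f * b l), ι₂.hom (b l') * w] r := by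
    intro r; simp [ψ]
  have hψ : ψ.hom ∘ (Chart.exc p i l).a = ι₂.hom ∘ a₁ := by
    funext r
    refine Fin.lastCases ?_ (fun r ↦ ?_) r
    · change ψ.hom ((Chart.exc p i l).a (Chart.exc p i l).j) = ι₂.hom (a₁ 2)
      rw [(Chart.exc p i l).a_j, ha₁2, map_one, map_one]
    · change ψ.hom (excCoord (affCoord (p i)) l r.castSucc) = ι₂.hom (a₁ r.castSucc)
      rw [eq_add_of_sub_eq' (hb r), excCoord, Fin.snoc_castSucc, map_add, map_add, map_mul, hψX]
      congr 1
      · exact congrArg (fun g : k →+* A₂ ↦ g _) hψc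
      · by_cases hr : r = l
        · subst hr
          simp
        · obtain rfl : r = l' := by omega
          simp only [hr, if_false, hψX]
          simp only [Matrix.cons_val_zero, Matrix.cons_val_one, map_mul]
          linear_combination (ι₂.hom (ι.hom f) * ι₂.hom (b r)) * hw
  obtain ⟨g, κ', h1, h2⟩ := (Chart.exc_isCompatible p i (hp i) l).exists_isLocalImmersion hπ
    (Spec.map ι₂ ≫ Spec.map ι ≫ κ) s (hnzd₂ _ hf₁) (by
      rw [Category.assoc, Category.assoc, pullIdeal_SpecMap, pullIdeal_SpecMap, hI, Ideal.map_span,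
        Set.image_singleton, Ideal.map_span, Set.image_singleton]) ψ (by
      have h1 : (Spec.map ι₂ ≫ Spec.map ι ≫ κ) ≫ π = Spec.map ι₂ ≫ coordMap 2 c₁ a₁ ha₁2 := by
        rw [← hq₁]; simp only [Category.assoc]
      rw [h1, Chart.SpecMap_map, SpecMap_coordMap]
      congr 1) (by
      intro i' hi'
      rw [map_minorsIdeal, hψc, hψ, ← map_minorsIdeal, htop i' hi', Ideal.map_top]
      exact fun h ↦ s.2.ne_top (top_le_iff.mp h))
  refine ⟨g, κ', h1, ?_⟩
  simpa only [Scheme.Hom.comp_apply] using h2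

/-! ### Strict transforms in the charts -/

/-- Substitution of the coordinates of a chart into a form. -/
def Chart.pull {n : ℕ} (ch : Chart k n) : MvPolynomial (Fin 3) k →+* MvPolynomial (Fin 2) k :=
  eval₂Hom MvPolynomial.C ch.a

@[simp] lemma Chart.pull_C {n : ℕ} (ch : Chart k n) (r : k) :
    ch.pull (MvPolynomial.C r) = MvPolynomial.C r := by simp [Chart.pull]

@[simp] lemma Chart.pull_X {n : ℕ} (ch : Chart k n) (l : Fin 3) : ch.pull (X l) = ch.a l := by
  simp [Chart.pull]

/-- The map of the chart to the plane is birational: up to powers of `e`, every polynomial on the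
chart comes from a form, and a form is determined by its degree and its pull-back. -/
structure Chart.IsBirational {n : ℕ} (ch : Chart k n) : Prop where
  exists_linear : ∃ x : MvPolynomial (Fin 3) k, x.IsHomogeneous 1 ∧ ch.pull x = ch.e
  exists_form : ∀ b, ∃ N D H, MvPolynomial.IsHomogeneous H D ∧ ch.pull H = ch.e ^ N * b
  eq_zero : ∀ D H, MvPolynomial.IsHomogeneous H D → ch.pull H = 0 → H = 0

lemma not_dvd_of_isHomogeneous_lt {F x : MvPolynomial (Fin 3) k} {d : ℕ} (hF : F.IsHomogeneous d)
    (hd : 2 ≤ d) (hx : x.IsHomogeneous 1) (hx0 : x ≠ 0) : ¬ F ∣ x := by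
  rintro ⟨y, rfl⟩
  have h1 := hx.totalDegree hx0
  have h2 := hF.totalDegree (left_ne_zero_of_mul hx0)
  rw [totalDegree_mul_of_isDomain (left_ne_zero_of_mul hx0) (right_ne_zero_of_mul hx0)] at h1
  omega

/-- `F'` is the strict transform in the chart of the irreducible plane curve `F`. -/
structure Chart.IsStrictTransform {n : ℕ} (ch : Chart k n) (F : MvPolynomial (Fin 3) k) (d : ℕ)
    (F' : MvPolynomial (Fin 2) k) (M : ℕ) : Prop where
  isBirational : ch.IsBirational
  e_ne_zero : ch.e ≠ 0
  isHomogeneous : F.IsHomogeneous d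
  two_le : 2 ≤ d
  prime : Prime F
  pull_eq : ch.pull F = ch.e ^ M * F'
  dvd_of_dvd_mul : ∀ b, F' ∣ ch.e * b → F' ∣ b

namespace Chart.IsStrictTransform

variable {n : ℕ} {ch : Chart k n} {F : MvPolynomial (Fin 3) k} {d : ℕ}
  {F' : MvPolynomial (Fin 2) k} {M : ℕ}

/-- A form whose pull-back is divisible by the strict transform of `F` is divisible by `F`. -/
lemma dvd_of_dvd_pull (h : ch.IsStrictTransform F d F' M) {G : MvPolynomial (Fin 3) k} {D : ℕ}
    (hG : G.IsHomogeneous D) {N : ℕ} (hdvd : F' ∣ ch.e ^ N * ch.pull G) : F ∣ G := by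
  obtain ⟨h, he, hF, hd, hFp, hFF', -⟩ := h
  obtain ⟨b, hb⟩ := hdvd
  obtain ⟨N', D', H, hH, hHb⟩ := h.exists_form b
  obtain ⟨x, hx, hxe⟩ := h.exists_linear
  have hj : (X ch.j : MvPolynomial (Fin 3) k).IsHomogeneous 1 := isHomogeneous_X _ _
  have hpj : ch.pull (X ch.j) = 1 := by rw [pull_X, ch.a_j]
  have hL : (x ^ (M + N' + N) * G).IsHomogeneous (1 * (M + N' + N) + D) := (hx.pow _).mul hG
  have hR := hF.mul hH
  -- `x ^ _ * G` and `F * H` have equal pull-backs; powers of `X ch.j`, whose pull-back is `1`,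
  -- make the degrees equal
  have key : X ch.j ^ (d + D') * (x ^ (M + N' + N) * G) -
      X ch.j ^ (1 * (M + N' + N) + D) * (F * H) = 0 := by
    refine h.eq_zero (d + D' + (1 * (M + N' + N) + D)) _ ?_ ?_
    · refine IsHomogeneous.sub ?_ ?_
      · have e : d + D' + (1 * (M + N' + N) + D) = 1 * (d + D') + (1 * (M + N' + N) + D) := by ring
        rw [e]
        exact (hj.pow (d + D')).mul hL
      · have e : d + D' + (1 * (M + N' + N) + D) = 1 * (1 * (M + N' + N) + D) + (d + D') := by ring
        rw [e]
        exact (hj.pow (1 * (M + N' + N) + D)).mul hR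
    · simp only [map_sub, map_mul, map_pow, hpj, hxe, one_pow, one_mul, hFF', hHb]
      linear_combination ch.e ^ (M + N') * hb
  have h2 : F ∣ X ch.j ^ (d + D') * (x ^ (M + N' + N) * G) := by
    rw [sub_eq_zero.mp key]
    exact (Dvd.intro _ rfl).mul_left _
  have hx0 : x ≠ 0 := by
    rintro rfl
    exact he (by rw [← hxe, map_zero])
  rcases hFp.dvd_or_dvd h2 with h3 | h3
  · exact absurd (hFp.dvd_of_dvd_pow h3) (not_dvd_of_isHomogeneous_lt hF hd hj (X_ne_zero _))
  rcases hFp.dvd_or_dvd h3 with h4 | h4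
  · exact absurd (hFp.dvd_of_dvd_pow h4) (not_dvd_of_isHomogeneous_lt hF hd hx hx0)
  · exact h4

lemma ne_zero (h : ch.IsStrictTransform F d F' M) : F' ≠ 0 := by
  obtain ⟨h, -, hF, -, hFp, hFF', -⟩ := h
  rintro rfl
  rw [mul_zero] at hFF'
  exact hFp.ne_zero (h.eq_zero d F hF hFF')

lemma not_dvd_e_pow (h : ch.IsStrictTransform F d F' M) (N : ℕ) : ¬ F' ∣ ch.e ^ N := by
  intro hdvd
  have := h.dvd_of_dvd_pull (isHomogeneous_one _ _) (N := N) (by simpa using hdvd)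
  exact h.prime.not_isUnit (isUnit_of_dvd_one this)

/-- The strict transform of an irreducible curve is irreducible. It is not empty in any chart, as
the complement of the image of a chart is contained in lines. -/
lemma prime' (h : ch.IsStrictTransform F d F' M) : Prime F' := by
  have hF'e' : ∀ N b, F' ∣ ch.e ^ N * b → F' ∣ b := by
    intro N
    induction N with
    | zero => intro b hb; simpa using hb
    | succ N ih => intro b hb; exact ih _ (h.dvd_of_dvd_mul _ (by rwa [← mul_assoc, ← pow_succ']))
  refine ⟨h.ne_zero, fun hu ↦
    h.not_dvd_e_pow 0 (hu.dvd), fun b₁ b₂ hb ↦ ?_⟩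
  obtain ⟨N₁, D₁, H₁, hH₁, hb₁⟩ := h.isBirational.exists_form b₁
  obtain ⟨N₂, D₂, H₂, hH₂, hb₂⟩ := h.isBirational.exists_form b₂
  have h1 : F ∣ H₁ * H₂ := by
    refine h.dvd_of_dvd_pull (hH₁.mul hH₂) (N := 0) ?_
    rw [pow_zero, one_mul, map_mul, hb₁, hb₂]
    exact hb.trans ⟨ch.e ^ N₁ * ch.e ^ N₂, by ring⟩
  have h2 : ∀ {N b H}, ch.pull H = ch.e ^ N * b → F ∣ H → F' ∣ b := by
    rintro N b _ hb ⟨H, rfl⟩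
    refine hF'e' N b ⟨ch.e ^ M * ch.pull H, ?_⟩
    rw [← hb, map_mul, h.pull_eq]
    ring
  exact (h.prime.dvd_or_dvd h1).imp (h2 hb₁) (h2 hb₂)

end Chart.IsStrictTransform

/-- A criterion for `IsBirational`: the affine coordinates come from forms, and the image of the
chart contains a dense open subset of the plane. -/
lemma Chart.isBirational_of [Infinite k] {n : ℕ} {ch : Chart k n} (x : MvPolynomial (Fin 3) k)
    (hx : x.IsHomogeneous 1) (hxe : ch.pull x = ch.e) (he : ch.e ≠ 0)
    (hX : ∀ i, ∃ N D H, MvPolynomial.IsHomogeneous H D ∧ ch.pull H = ch.e ^ N * X i)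
    (hdense : ∀ v : Fin 3 → k, v ch.j ≠ 0 → eval v x ≠ 0 →
      ∃ w, v = v ch.j • fun l ↦ eval w (ch.a l)) : ch.IsBirational where
  exists_linear := ⟨x, hx, hxe⟩
  exists_form b := by
    have hj : (X ch.j : MvPolynomial (Fin 3) k).IsHomogeneous 1 := isHomogeneous_X _ _
    have hpj : ch.pull (X ch.j) = 1 := by rw [pull_X, ch.a_j]
    induction b using MvPolynomial.induction_on with
    | C r => exact ⟨0, 0, MvPolynomial.C r, isHomogeneous_C _ _, by simp⟩
    | add b₁ b₂ h₁ h₂ =>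
      obtain ⟨N₁, D₁, H₁, hH₁, hb₁⟩ := h₁
      obtain ⟨N₂, D₂, H₂, hH₂, hb₂⟩ := h₂
      refine ⟨N₁ + N₂, D₁ + D₂ + N₁ + N₂, X ch.j ^ (D₂ + N₁) * (x ^ N₂ * H₁) +
        X ch.j ^ (D₁ + N₂) * (x ^ N₁ * H₂), IsHomogeneous.add ?_ ?_, ?_⟩
      · have e : D₁ + D₂ + N₁ + N₂ = 1 * (D₂ + N₁) + (1 * N₂ + D₁) := by ring
        rw [e]
        exact (hj.pow _).mul ((hx.pow _).mul hH₁)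
      · have e : D₁ + D₂ + N₁ + N₂ = 1 * (D₁ + N₂) + (1 * N₁ + D₂) := by ring
        rw [e]
        exact (hj.pow _).mul ((hx.pow _).mul hH₂)
      · simp only [map_add, map_mul, map_pow, hpj, hxe, hb₁, hb₂]
        ring
    | mul_X b i h =>
      obtain ⟨N₁, D₁, H₁, hH₁, hb₁⟩ := h
      obtain ⟨N₂, D₂, H₂, hH₂, hb₂⟩ := hX i
      refine ⟨N₁ + N₂, D₁ + D₂, H₁ * H₂, hH₁.mul hH₂, ?_⟩
      rw [map_mul, hb₁, hb₂]
      ring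
  eq_zero D H hH h0 := by
    have hx0 : x ≠ 0 := by
      rintro rfl
      exact he (by rw [← hxe, map_zero])
    have h1 : X ch.j * x * H = 0 := by
      refine MvPolynomial.funext fun v ↦ ?_
      simp only [map_mul, eval_X, map_zero]
      by_cases hv : v ch.j = 0
      · simp [hv]
      by_cases hvx : eval v x = 0
      · simp [hvx]
      obtain ⟨w, hw⟩ := hdense v hv hvx
      have h2 : eval v H = v ch.j ^ D * eval w (ch.pull H) := by
        have h3 := eval₂Hom_mul_of_isHomogeneous (RingHom.id k) (v ch.j)
          (fun l ↦ eval w (ch.a l)) hH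
        have h4 : eval v H = eval₂Hom (RingHom.id k) (fun l ↦ v ch.j * eval w (ch.a l)) H := by
          conv_lhs => rw [hw]
          rfl
        rw [h4, h3]
        congr 1
        rw [pull, coe_eval₂Hom, coe_eval₂Hom, eval₂_comp_left]
        congr 1
        ext r
        simp
      rw [h2, h0, map_zero, mul_zero, mul_zero]
    simpa [X_ne_zero, hx0] using h1

lemma Chart.std_isBirational [Infinite k] (n : ℕ) (j : Fin 3) : (Chart.std k n j).IsBirational := by
  refine Chart.isBirational_of (X j) (isHomogeneous_X _ _) ?_ one_ne_zero (fun i ↦ ?_) ?_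
  · simp [Chart.std, stdCoord]
  · exact ⟨0, 1, X (j.succAbove i), isHomogeneous_X _ _, by simp [Chart.std, stdCoord]⟩
  · intro v hv _
    refine ⟨fun l ↦ v (j.succAbove l) / v j, ?_⟩
    have hv' : v j ≠ 0 := hv
    funext i
    change v i = v j * eval _ (stdCoord k j i)
    refine Fin.succAboveCases j ?_ (fun l ↦ ?_) i
    · simp [stdCoord]
    · simp [stdCoord, mul_div_cancel₀, hv']

/-- The map `(u, v) ↦ [z + (u, uv) : 1]` has the inverse `u = x - z 0`, `v = (y - z 1) / u`. -/
lemma Chart.exc_isBirational [Infinite k] {n : ℕ} (p : Fin n → Projectivization k (Fin 3 → k))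
    (i : Fin n) (l : Fin 2) : (Chart.exc p i l).IsBirational := by
  have ha : ∀ l' : Fin 2, (Chart.exc p i l).a l'.castSucc = MvPolynomial.C (affCoord (p i) l') +
      X 0 * (if l' = l then 1 else X 1) := by
    intro l'
    change excCoord (affCoord (p i)) l l'.castSucc = _
    rw [excCoord, Fin.snoc_castSucc]
  have ha2 : (Chart.exc p i l).a 2 = 1 := (Chart.exc p i l).a_j
  -- linear forms vanishing at the point
  let x : Fin 2 → MvPolynomial (Fin 3) k := fun l' ↦
    X l'.castSucc - MvPolynomial.C (affCoord (p i) l') * X 2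
  have hx : ∀ l', (x l').IsHomogeneous 1 := fun l' ↦
    (isHomogeneous_X _ _).sub (isHomogeneous_C_mul_X _ _)
  have hpx : ∀ l', (Chart.exc p i l).pull (x l') = X 0 * (if l' = l then 1 else X 1) := by
    intro l'
    have h1 : (Chart.exc p i l).pull (X l'.castSucc) = _ := (Chart.pull_X _ _).trans (ha l')
    have h2 : (Chart.exc p i l).pull (X 2) = 1 := (Chart.pull_X _ _).trans ha2
    change (Chart.exc p i l).pull (X l'.castSucc - MvPolynomial.C (affCoord (p i) l') * X 2) = _
    rw [map_sub, map_mul, h1, h2, Chart.pull_C]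
    ring
  obtain ⟨l', hl'⟩ : ∃ l' : Fin 2, l' ≠ l := exists_ne l
  refine Chart.isBirational_of (x l) (hx l) ?_ (X_ne_zero _) (fun r ↦ ?_) ?_
  · rw [hpx, if_pos rfl, mul_one]; rfl
  · fin_cases r
    · exact ⟨0, 1, x l, hx l, by rw [hpx, if_pos rfl]; simp⟩
    · exact ⟨1, 1, x l', hx l', by rw [hpx, if_neg hl', pow_one]; rfl⟩
  · intro v hv hvx
    change v 2 ≠ 0 at hv
    simp only [x, map_sub, map_mul, eval_X, eval_C] at hvx
    refine ⟨![(v l.castSucc - affCoord (p i) l * v 2) / v 2,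
      (v l'.castSucc - affCoord (p i) l' * v 2) / (v l.castSucc - affCoord (p i) l * v 2)], ?_⟩
    funext r
    change v r = v 2 * eval _ ((Chart.exc p i l).a r)
    refine Fin.lastCases ?_ (fun r ↦ ?_) r
    · change v 2 = v 2 * eval _ ((Chart.exc p i l).a 2)
      rw [ha2]; simp
    · rw [ha]
      by_cases hr : r = l
      · subst hr
        simp only [if_true, map_add, map_mul, eval_C, eval_X, map_one, Matrix.cons_val_zero]
        field_simp
        ring
      · obtain rfl : r = l' := by omega
        simp only [hr, if_false, map_add, map_mul, eval_C, eval_X, Matrix.cons_val_zero,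
          Matrix.cons_val_one]
        rw [div_mul_div_cancel₀' hvx]
        field_simp
        ring

/-! ### The strict transform as an irreducible divisor -/

/-- A blow-up is bijective away from the centre. -/
lemma IsBlowUp.existsUnique_preimage {S X : Scheme.{u}} {π : S ⟶ X} {I : X.IdealSheafData}
    (hπ : IsBlowUp π I) {B : CommRingCat.{u}} (w : Spec B ⟶ X) [IsOpenImmersion w]
    (hw : pullIdeal w I = ⊤) (z : Spec B) : ∃ η : S, ∀ s, π s = w z ↔ s = η := by
  have hone : ∀ {A : CommRingCat.{u}} (ρ : B ⟶ A), IsEffectiveCartier (I.comap (Spec.map ρ ≫ w)) :=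
    fun ρ ↦ isEffectiveCartier_comap_of_pullIdeal _ (one_mem _)
      (by rw [pullIdeal_SpecMap, hw, Ideal.map_top, Ideal.span_singleton_one])
  obtain ⟨σ, hσ, -⟩ := hπ.existsUnique_lift _ w (by
    have := hone (𝟙 B)
    rwa [Spec.map_id, Category.id_comp] at this)
  refine ⟨σ z, fun s ↦ ⟨fun hs ↦ ?_, ?_⟩⟩
  · obtain ⟨_, ⟨U, hU, rfl⟩, hsU, hUw⟩ := S.isBasis_affineOpens.exists_subset_of_mem_open
      (show s ∈ π ⁻¹ᵁ w.opensRange from ⟨z, hs.symm⟩) (TopologicalSpace.Opens.isOpen _)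
    have hU' : IsAffineOpen U := hU
    obtain ⟨s₀, hs₀⟩ : ∃ s₀, hU'.fromSpec s₀ = s := by
      have : s ∈ Set.range hU'.fromSpec := by rw [hU'.range_fromSpec]; exact hsU
      exact this
    have hsub : Set.range (hU'.fromSpec ≫ π) ⊆ Set.range w := by
      rintro _ ⟨x, rfl⟩
      rw [Scheme.Hom.comp_apply]
      have : hU'.fromSpec x ∈ Set.range hU'.fromSpec := ⟨x, rfl⟩
      rw [hU'.range_fromSpec] at this
      exact hUw this
    obtain ⟨ρ, hρ⟩ : ∃ ρ : B ⟶ Γ(S, U), Spec.map ρ ≫ w = hU'.fromSpec ≫ π :=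
      ⟨Spec.preimage (IsOpenImmersion.lift w _ hsub), by
        rw [Spec.map_preimage, IsOpenImmersion.lift_fac]⟩
    have h1 : hU'.fromSpec = Spec.map ρ ≫ σ := by
      refine hπ.hom_ext (by rw [Category.assoc, hσ, hρ]) ?_
      rw [Category.assoc, hσ]
      exact hone ρ
    have h2 : Spec.map ρ s₀ = z := by
      apply w.isOpenEmbedding.injective
      rw [← Scheme.Hom.comp_apply, hρ, Scheme.Hom.comp_apply, hs₀, hs]
    rw [← hs₀, h1, Scheme.Hom.comp_apply, h2]
  · rintro rfl
    rw [← Scheme.Hom.comp_apply, hσ]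

/-- The generic point of an irreducible plane curve. -/
def curvePoint {F : MvPolynomial (Fin 3) k} {d : ℕ} (hF : F.IsHomogeneous d) (hd : 2 ≤ d)
    (hFp : Prime F) : Plane k :=
  (⟨⟨Ideal.span {F}, Ideal.homogeneous_span _ _ (by rintro _ rfl; exact ⟨d, hF⟩)⟩,
    (Ideal.span_singleton_prime hFp.ne_zero).mpr hFp, fun h ↦ by
      have h0 : (X 0 : MvPolynomial (Fin 3) k) ∈
          HomogeneousIdeal.irrelevant (homogeneousSubmodule (Fin 3) k) :=
        HomogeneousIdeal.mem_irrelevant_of_mem _ one_pos (X_mem_homogeneousSubmodule 0)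
      exact not_dvd_of_isHomogeneous_lt hF hd (isHomogeneous_X _ 0) (X_ne_zero _)
        (Ideal.mem_span_singleton.mp (h h0))⟩ :
    ProjectiveSpectrum (homogeneousSubmodule (Fin 3) k))

lemma curvePoint_mem_basicOpen {F : MvPolynomial (Fin 3) k} {d : ℕ} (hF : F.IsHomogeneous d)
    (hd : 2 ≤ d) (hFp : Prime F) (G : MvPolynomial (Fin 3) k) :
    curvePoint hF hd hFp ∈ Proj.basicOpen (homogeneousSubmodule (Fin 3) k) G ↔ ¬ F ∣ G :=
  not_congr Ideal.mem_span_singleton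

lemma eq_curvePoint {F : MvPolynomial (Fin 3) k} {d : ℕ} (hF : F.IsHomogeneous d)
    (hd : 2 ≤ d) (hFp : Prime F) (x : Plane k)
    (h : ∀ D G, 0 < D → G ∈ homogeneousSubmodule (Fin 3) k D →
      (x ∈ Proj.basicOpen (homogeneousSubmodule (Fin 3) k) G ↔ ¬ F ∣ G)) :
    x = curvePoint hF hd hFp := by
  apply ProjectiveSpectrum.ext
  apply HomogeneousIdeal.ext'
  intro D G hG
  obtain rfl | hD := Nat.eq_zero_or_pos D
  · have hG0 : G.IsHomogeneous 0 := hG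
    rw [← totalDegree_zero_iff_isHomogeneous, totalDegree_eq_zero_iff_eq_C] at hG0
    have : ∀ y : ProjectiveSpectrum (homogeneousSubmodule (Fin 3) k),
        G ∈ y.asHomogeneousIdeal ↔ G = 0 := by
      intro y
      refine ⟨fun hy ↦ ?_, fun hy ↦ hy ▸ zero_mem _⟩
      by_contra hne
      refine y.isPrime.ne_top (Ideal.eq_top_of_isUnit_mem _ hy ?_)
      rw [hG0] at hne ⊢
      exact (isUnit_iff_ne_zero.mpr fun h ↦ hne (by rw [h, map_zero])).map _
    exact (this x).trans (this _).symm
  · exact not_iff_not.mp ((h D G hD hG).trans (curvePoint_mem_basicOpen hF hd hFp G).symm)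

lemma not_minorsIdeal_le_of_coordMap_eq_curvePoint {F : MvPolynomial (Fin 3) k} {d : ℕ}
    (hF : F.IsHomogeneous d) (hd : 2 ≤ d) (hFp : Prime F) {C : CommRingCat.{u}} {j : Fin 3}
    {c : k →+* C} {a : Fin 3 → C} {ha : a j = 1} {x : PrimeSpectrum C}
    (hx : coordMap j c a ha x = curvePoint hF hd hFp) {p : Fin 3 → k} (hp : p 2 ≠ 0) :
    ¬ minorsIdeal c a p ≤ x.asIdeal := by
  intro hle
  let L : MvPolynomial (Fin 3) k := MvPolynomial.C (p 2) * X 0 - MvPolynomial.C (p 0) * X 2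
  have hL : L.IsHomogeneous 1 := (isHomogeneous_C_mul_X _ _).sub (isHomogeneous_C_mul_X _ _)
  have hL0 : L ≠ 0 := by
    intro h
    have := congrArg (eval ![1, 0, 0]) h
    simp [L] at this
    exact hp this
  have h1 := (coordMap_apply_mem_basicOpen j c a ha hL one_pos x).not
  rw [hx, curvePoint_mem_basicOpen, not_not, not_not] at h1
  refine not_dvd_of_isHomogeneous_lt hF hd hL hL0 (h1.mpr (hle ?_))
  have : eval₂Hom c a L = c (p 2) * a 0 - c (p 0) * a 2 := by simp [L]
  rw [this]
  exact Ideal.subset_span ⟨(2, 0), rfl⟩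

/-- The ideal of the strict transform in a localization of a chart is generated by `F'`: either `F'`
is a unit and the strict transform does not meet the localization, or `F'` is prime and its zero
locus has the generic point `η`. -/
theorem Chart.IsStrictTransform.pullIdeal_closure {n : ℕ} {ch : Chart k n}
    {F : MvPolynomial (Fin 3) k} {d : ℕ} {F' : MvPolynomial (Fin 2) k} {M : ℕ}
    (h : ch.IsStrictTransform F d F' M) {p : Fin n → Projectivization k (Fin 3 → k)}
    (hp : ∀ i, (p i).rep 2 ≠ 0) (hch : ch.IsCompatible p) {S : Scheme.{u}} {π : S ⟶ Plane k}
    {g : MvPolynomial (Fin 2) k} {κ : Spec (CommRingCat.of (Localization.Away g)) ⟶ S}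
    (hκ : ch.IsLocalImmersion p π g κ) {η : S}
    (hη : ∀ s, π s = curvePoint h.isHomogeneous h.two_le h.prime ↔ s = η) :
    pullIdeal κ (Scheme.IdealSheafData.vanishingIdeal ⟨closure {η}, isClosed_closure⟩) =
      Ideal.span {algebraMap (MvPolynomial (Fin 2) k) (Localization.Away g) F'} := by
  have := hκ.isOpenImmersion
  let R := MvPolynomial (Fin 2) k
  let ι : CommRingCat.of R ⟶ CommRingCat.of (Localization.Away g) :=
    CommRingCat.ofHom (algebraMap R (Localization.Away g))
  have hw := hκ.comp_eq.trans (ch.SpecMap_map ι)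
  have heval : ∀ G, eval₂Hom (ι.hom.comp MvPolynomial.C) (ι.hom ∘ ch.a) G =
      algebraMap R (Localization.Away g) (ch.pull G) := fun G ↦
    (MvPolynomial.eval₂_comp_left ι.hom MvPolynomial.C ch.a G).symm
  have hmem : ∀ (x : Spec (CommRingCat.of (Localization.Away g))) {D G}, 0 < D →
      G ∈ homogeneousSubmodule (Fin 3) k D →
      (π (κ x) ∈ Proj.basicOpen (homogeneousSubmodule (Fin 3) k) G ↔
        algebraMap R (Localization.Away g) (ch.pull G) ∉ x.asIdeal) := by
    intro x D G hD hG
    rw [← Scheme.Hom.comp_apply, hw, ← heval]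
    exact coordMap_apply_mem_basicOpen _ _ _ _ hG hD x
  rw [pullIdeal_vanishingIdeal]
  by_cases hdis : ∃ N, F' ∣ g ^ N
  · obtain ⟨N, hN⟩ := hdis
    have hu : IsUnit (algebraMap R (Localization.Away g) F') := by
      refine isUnit_of_dvd_unit (map_dvd (algebraMap R (Localization.Away g)) hN) ?_
      rw [map_pow]
      exact (IsLocalization.Away.algebraMap_isUnit g).pow N
    rw [Ideal.span_singleton_eq_top.mpr hu]
    -- a point over the generic point of the curve would lie on an exceptional divisor
    have hnot : η ∉ Set.range κ := by
      rintro ⟨x, rfl⟩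
      have hx := (hη (κ x)).mpr rfl
      have h1 : algebraMap R (Localization.Away g) (ch.pull F) ∈ x.asIdeal := by
        by_contra hcon
        have := (hmem x (by have := h.two_le; omega) h.isHomogeneous).mpr hcon
        rw [hx, curvePoint_mem_basicOpen] at this
        exact this dvd_rfl
      have he : algebraMap R (Localization.Away g) ch.e ∈ x.asIdeal := by
        rw [h.pull_eq, map_mul, mul_comm] at h1
        have h2 := (Ideal.unit_mul_mem_iff_mem _ hu).mp h1
        rw [map_pow] at h2
        exact x.2.mem_of_pow_mem _ h2
      have h3 := hch.pullIdeal_eq _ ι hκ.map_minorsIdeal_eq_top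
      have h4 := (prod_minorsIdeal_le ch.j (ι.hom.comp MvPolynomial.C) (ι.hom ∘ ch.a)
        (by simp [ch.a_j]) p).1
      rw [← ch.SpecMap_map, h3] at h4
      have h5 := h4.trans ((Ideal.span_singleton_le_iff_mem _).mpr he)
      obtain ⟨i, -, hi⟩ := (Ideal.IsPrime.prod_le x.2).mp h5
      rw [← Scheme.Hom.comp_apply, hw] at hx
      exact not_minorsIdeal_le_of_coordMap_eq_curvePoint _ _ _ hx (hp i) hi
    have hempty : κ ⁻¹' closure {η} = ∅ := by
      refine Set.eq_empty_of_forall_notMem fun y hy ↦ hnot ?_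
      obtain ⟨_, h1, h2⟩ := mem_closure_iff.mp hy _ κ.isOpenEmbedding.isOpen_range ⟨y, rfl⟩
      rwa [Set.mem_singleton_iff.mp h2] at h1
    refine Eq.trans ?_ PrimeSpectrum.vanishingIdeal_empty
    exact congrArg _ hempty
  · push Not at hdis
    have hF' := h.prime'
    have hprime : (Ideal.span {algebraMap R (Localization.Away g) F'}).IsPrime := by
      rw [← Set.image_singleton, ← Ideal.map_span]
      refine IsLocalization.isPrime_of_isPrime_disjoint (Submonoid.powers g) _ _
        ((Ideal.span_singleton_prime hF'.ne_zero).mpr hF') ?_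
      rw [Set.disjoint_left]
      rintro _ ⟨N, rfl⟩ hN
      exact hdis N (Ideal.mem_span_singleton.mp hN)
    have hdvd : ∀ b, algebraMap R (Localization.Away g) b ∈
        Ideal.span {algebraMap R (Localization.Away g) F'} ↔ F' ∣ b := by
      intro b
      rw [← Set.image_singleton, ← Ideal.map_span,
        IsLocalization.algebraMap_mem_map_algebraMap_iff (Submonoid.powers g)]
      constructor
      · rintro ⟨_, ⟨N, rfl⟩, hN⟩
        exact (hF'.dvd_or_dvd (Ideal.mem_span_singleton.mp hN)).resolve_left (hdis N)
      · exact fun hb ↦ ⟨1, one_mem _, by simpa [Ideal.mem_span_singleton] using hb⟩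
    let q : Spec (CommRingCat.of (Localization.Away g)) := ⟨_, hprime⟩
    have hq : κ q = η := by
      rw [← hη]
      refine eq_curvePoint _ _ _ _ fun D G hD hG ↦ ?_
      refine (hmem q hD hG).trans (not_congr ((hdvd _).trans ⟨fun h1 ↦ ?_, ?_⟩))
      · exact h.dvd_of_dvd_pull hG (N := 0) (by simpa using h1)
      · rintro ⟨G, rfl⟩
        rw [map_mul, h.pull_eq]
        exact ⟨ch.e ^ M * ch.pull G, by ring⟩
    have hcl : κ ⁻¹' closure {η} = closure {q} := by
      rw [κ.isOpenEmbedding.isInducing.closure_eq_preimage_closure_image, Set.image_singleton, hq]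
    refine Eq.trans (congrArg _ hcl) ?_
    exact (PrimeSpectrum.vanishingIdeal_closure _).trans (PrimeSpectrum.vanishingIdeal_singleton _)

end

/-! ### Linear equivalence on integral schemes -/

/-- A section of `I` multiplied by `θ` is a section of `J`, if `θ` maps local generators of `I` to
local generators of `J`. -/
lemma exists_mem_ideal_eq_mul {X : Scheme.{u}} {K : CommRingCat.{u}} (hK : IsField K)
    (ε : Spec K ⟶ X) {I J : X.IdealSheafData} {θ : K}
    (h : ∀ x : X, ∃ (A : CommRingCat.{u}) (κ : Spec A ⟶ X) (_ : IsOpenImmersion κ) (α β : A)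
      (ρ : A ⟶ K), x ∈ Set.range κ ∧ pullIdeal κ I = Ideal.span {α} ∧
        pullIdeal κ J = Ideal.span {β} ∧ Spec.map ρ ≫ κ = ε ∧ θ * ρ.hom α = ρ.hom β)
    (U : X.affineOpens) (ρ : Γ(X, U.1) ⟶ K) (hρi : Function.Injective ρ.hom)
    (hρ : Spec.map ρ ≫ IsAffineOpen.fromSpec U.2 = ε) (s : I.ideal U) :
    ∃ t : J.ideal U, ρ.hom t = θ * ρ.hom s := by
  obtain ⟨U, hU⟩ := U
  have hU' : IsAffineOpen U := hU
  change Spec.map ρ ≫ hU'.fromSpec = ε at hρ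
  -- the ideal of denominators
  let 𝔞 : Ideal Γ(X, U) :=
    { carrier := {a | ∃ t ∈ J.ideal ⟨U, hU⟩, ρ.hom t = ρ.hom a * (θ * ρ.hom s)}
      add_mem' := by
        rintro a b ⟨t, ht, h1⟩ ⟨t', ht', h2⟩
        exact ⟨t + t', add_mem ht ht', by rw [map_add, map_add, h1, h2]; ring⟩
      zero_mem' := ⟨0, zero_mem _, by simp⟩
      smul_mem' := by
        rintro c a ⟨t, ht, h1⟩
        exact ⟨c * t, Ideal.mul_mem_left _ _ ht, by
          rw [smul_eq_mul, map_mul, map_mul, h1]; ring⟩ }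
  suffices h𝔞 : 𝔞 = ⊤ by
    obtain ⟨t, ht, h1⟩ : (1 : Γ(X, U)) ∈ 𝔞 := h𝔞 ▸ Submodule.mem_top
    exact ⟨⟨t, ht⟩, by simpa using h1⟩
  by_contra hne
  obtain ⟨m, hm, hle⟩ := Ideal.exists_le_maximal 𝔞 hne
  let x : Spec Γ(X, U) := ⟨m, hm.isPrime⟩
  obtain ⟨A, κ, _, α, β, ρA, hxκ, hI, hJ, hρA, hθ⟩ := h (hU'.fromSpec x)
  obtain ⟨_, ⟨f, rfl⟩, hxf, hf⟩ :=
    PrimeSpectrum.isTopologicalBasis_basic_opens.exists_subset_of_mem_open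
      (show x ∈ hU'.fromSpec ⁻¹ᵁ κ.opensRange from hxκ) (TopologicalSpace.Opens.isOpen _)
  let B := Localization.Away f
  let ι : Γ(X, U) ⟶ CommRingCat.of B := CommRingCat.ofHom (algebraMap _ B)
  have hfx : f ∉ m := hxf
  have hf0 : f ≠ 0 := by rintro rfl; exact hfx (zero_mem _)
  have hρf : IsUnit (ρ.hom f) := by
    let := hK.toField
    exact isUnit_iff_ne_zero.mpr ((map_ne_zero_iff _ hρi).mpr hf0)
  obtain ⟨ρB, hρB⟩ : ∃ ρB : CommRingCat.of B ⟶ K, ι ≫ ρB = ρ :=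
    ⟨CommRingCat.ofHom (IsLocalization.Away.lift (S := B) f hρf),
      CommRingCat.hom_ext (IsLocalization.Away.lift_comp f hρf)⟩
  have hρB' : ∀ a, ρB.hom (algebraMap _ B a) = ρ.hom a := fun a ↦ by rw [← hρB]; rfl
  have hsub : Set.range (Spec.map ι ≫ hU'.fromSpec) ⊆ Set.range κ := by
    rintro _ ⟨y, rfl⟩
    rw [Scheme.Hom.comp_apply]
    have hy : f ∉ (Spec.map ι y).asIdeal := fun hy ↦
      y.2.ne_top (Ideal.eq_top_of_isUnit_mem _ hy (IsLocalization.Away.algebraMap_isUnit f))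
    exact hf hy
  obtain ⟨τ, hτ⟩ : ∃ τ : A ⟶ CommRingCat.of B, Spec.map τ ≫ κ = Spec.map ι ≫ hU'.fromSpec :=
    ⟨Spec.preimage (IsOpenImmersion.lift κ _ hsub), by
      rw [Spec.map_preimage, IsOpenImmersion.lift_fac]⟩
  have hτρ : τ ≫ ρB = ρA := by
    apply Spec.map_injective
    rw [← cancel_mono κ, hρA, Spec.map_comp, Category.assoc, hτ, ← Spec.map_comp_assoc, hρB, hρ]
  have hId : ∀ (L : X.IdealSheafData) (γ : A), pullIdeal κ L = Ideal.span {γ} →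
      (L.ideal ⟨U, hU⟩).map (algebraMap _ B) = Ideal.span {τ.hom γ} := by
    intro L γ hL
    have h1 := congrArg (pullIdeal · L) hτ
    simp only [pullIdeal_SpecMap, hL, Ideal.map_span, Set.image_singleton, pullIdeal_fromSpec] at h1
    exact h1.symm
  have hs : algebraMap _ B (s : Γ(X, U)) ∈ Ideal.span {τ.hom α} := by
    rw [← hId I α hI]
    exact Ideal.mem_map_of_mem _ s.2
  obtain ⟨r, hr⟩ := Ideal.mem_span_singleton'.mp hs
  have ht : r * τ.hom β ∈ (J.ideal ⟨U, hU⟩).map (algebraMap _ B) := by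
    rw [hId J β hJ]
    exact Ideal.mul_mem_left _ _ (Ideal.mem_span_singleton_self _)
  obtain ⟨⟨t, ⟨_, ⟨N, rfl⟩⟩⟩, ht⟩ :=
    (IsLocalization.mem_map_algebraMap_iff (Submonoid.powers f) B).mp ht
  refine hfx (hm.isPrime.mem_of_pow_mem N (hle ⟨t, t.2, ?_⟩))
  have h1 := congrArg ρB.hom ht
  have h2 := congrArg ρB.hom hr
  rw [map_mul, map_mul, hρB', hρB'] at h1
  rw [map_mul, hρB'] at h2
  have h3 : ∀ a, ρB.hom (τ.hom a) = ρA.hom a := fun a ↦ by rw [← hτρ]; rfl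
  rw [h3] at h1 h2
  rw [← h1, ← h2, ← hθ]
  ring

lemma SpecMap_germToFunctionField_fromSpec {X : Scheme.{u}} [IsIntegral X] {U : X.Opens}
    [Nonempty U] (hU : IsAffineOpen U) :
    Spec.map (X.germToFunctionField U) ≫ hU.fromSpec = X.fromSpecStalk (genericPoint X) :=
  hU.fromSpecStalk_eq_fromSpecStalk
    (((genericPoint_spec X).mem_open_set_iff U.isOpen).mpr (by simpa using ‹Nonempty U›))

lemma exists_injective_SpecMap_comp_eq_fromSpecStalk {X : Scheme.{u}} [IsIntegral X]
    {A : CommRingCat.{u}} (κ : Spec A ⟶ X) [IsOpenImmersion κ] (x : Spec A) :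
    ∃ ρ : A ⟶ X.functionField, Function.Injective ρ.hom ∧
      Spec.map ρ ≫ κ = X.fromSpecStalk (genericPoint X) := by
  obtain ⟨φ, _, h⟩ := exists_isIso_eq_SpecMap_fromSpec κ
  have : Nonempty κ.opensRange := ⟨⟨κ x, x, rfl⟩⟩
  refine ⟨inv φ ≫ X.germToFunctionField κ.opensRange, ?_, ?_⟩
  · rw [CommRingCat.hom_comp, RingHom.coe_comp]
    exact (X.germToFunctionField_injective _).comp
      (ConcreteCategory.bijective_of_isIso (inv φ)).injective
  · rw [← SpecMap_germToFunctionField_fromSpec (isAffineOpen_opensRange κ)]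
    refine (congrArg (Spec.map (inv φ ≫ X.germToFunctionField κ.opensRange) ≫ ·) h).trans ?_
    rw [← Spec.map_comp_assoc, IsIso.hom_inv_id_assoc]

/-- On an integral scheme, two ideal sheaves are isomorphic if multiplication by a fixed rational
function maps local generators of one to local generators of the other. -/
theorem linearlyEquivalent_of_generators {X : Scheme.{u}} [IsIntegral X] {I J : X.IdealSheafData}
    {θ : X.functionField} (hθ : θ ≠ 0)
    (h : ∀ x : X, ∃ (A : CommRingCat.{u}) (κ : Spec A ⟶ X) (_ : IsOpenImmersion κ) (α β : A)
      (ρ : A ⟶ X.functionField), x ∈ Set.range κ ∧ pullIdeal κ I = Ideal.span {α} ∧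
        pullIdeal κ J = Ideal.span {β} ∧
        Spec.map ρ ≫ κ = X.fromSpecStalk (genericPoint X) ∧ θ * ρ.hom α = ρ.hom β) :
    LinearlyEquivalent I J := by
  have hK : IsField X.functionField := Field.toIsField _
  have hgen : ∀ (U : X.affineOpens) [Nonempty U.1],
      Spec.map (X.germToFunctionField U.1) ≫ IsAffineOpen.fromSpec U.2 =
        X.fromSpecStalk (genericPoint X) := by
    intro U hne
    exact SpecMap_germToFunctionField_fromSpec U.2
  -- on every affine open set, multiplication by `θ` maps `I` to `J`, with inverse `θ⁻¹`
  have h1 : ∀ (U : X.affineOpens) [Nonempty U.1] (s : I.ideal U), ∃ t : J.ideal U,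
      (X.germToFunctionField U.1).hom t = θ * (X.germToFunctionField U.1).hom s := by
    intro U hne s
    exact exists_mem_ideal_eq_mul hK _ h U _ (X.germToFunctionField_injective U.1) (hgen U) s
  have h2 : ∀ (U : X.affineOpens) [Nonempty U.1] (s : J.ideal U), ∃ t : I.ideal U,
      (X.germToFunctionField U.1).hom t = θ⁻¹ * (X.germToFunctionField U.1).hom s := by
    intro U hne s
    refine exists_mem_ideal_eq_mul hK _ (fun x ↦ ?_) U _ (X.germToFunctionField_injective U.1)
      (hgen U) s
    obtain ⟨A, κ, hκ, α, β, ρ, hx, hI, hJ, hρ, hθ'⟩ := h x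
    exact ⟨A, κ, hκ, β, α, ρ, hx, hJ, hI, hρ, by rw [← hθ', inv_mul_cancel_left₀ hθ]⟩
  have h3 : ∀ U : X.affineOpens, ∃ φ : I.ideal U ≃ₗ[Γ(X, U.1)] J.ideal U,
      ∀ [Nonempty U.1] (s : I.ideal U), (X.germToFunctionField U.1).hom (φ s) =
        θ * (X.germToFunctionField U.1).hom s := by
    intro U
    by_cases hne : Nonempty U.1
    · have hinj := X.germToFunctionField_injective U.1
      choose φ hφ using h1 U
      let φ' : I.ideal U →ₗ[Γ(X, U.1)] J.ideal U :=
        { toFun := φ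
          map_add' := fun s t ↦ by
            apply Subtype.ext
            apply hinj
            rw [hφ, Submodule.coe_add, Submodule.coe_add, map_add, map_add, hφ, hφ, mul_add]
          map_smul' := fun r s ↦ by
            apply Subtype.ext
            apply hinj
            rw [hφ, RingHom.id_apply, Submodule.coe_smul, Submodule.coe_smul, smul_eq_mul,
              smul_eq_mul, map_mul, map_mul, hφ]
            ring }
      refine ⟨LinearEquiv.ofBijective φ' ⟨?_, ?_⟩, fun s ↦ hφ s⟩
      · intro s t hst
        apply Subtype.ext
        apply hinj
        have := congrArg (fun t : J.ideal U ↦ (X.germToFunctionField U.1).hom (t : Γ(X, U.1))) hst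
        change (X.germToFunctionField U.1).hom (φ s) = (X.germToFunctionField U.1).hom (φ t) at this
        rw [hφ, hφ] at this
        exact mul_left_cancel₀ hθ this
      · intro t
        obtain ⟨s, hs⟩ := h2 U t
        refine ⟨s, Subtype.ext (hinj ?_)⟩
        change (X.germToFunctionField U.1).hom (φ s) = _
        rw [hφ, hs, mul_inv_cancel_left₀ hθ]
    · -- nothing is to be shown on the empty set, where all sections vanish
      have hsub : Subsingleton Γ(X, U.1) := by
        have : U.1 = ⊥ := by
          rw [← TopologicalSpace.Opens.not_nonempty_iff_eq_bot]
          rintro ⟨x, hx⟩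
          exact hne ⟨⟨x, hx⟩⟩
        rw [this]
        infer_instance
      have hsub' : ∀ L : Ideal Γ(X, U.1), Subsingleton L := fun L ↦ inferInstance
      exact ⟨{ toFun := fun _ ↦ 0, map_add' := fun _ _ ↦ Subsingleton.elim _ _,
               map_smul' := fun _ _ ↦ Subsingleton.elim _ _, invFun := fun _ ↦ 0,
               left_inv := fun _ ↦ Subsingleton.elim _ _,
               right_inv := fun _ ↦ Subsingleton.elim _ _ }, fun {hne'} ↦ absurd hne' hne⟩
  choose φ hφ using h3
  refine ⟨φ, fun U V hUV s t hst ↦ ?_⟩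
  by_cases hne : Nonempty U.1
  · have hneV : Nonempty V.1 := hne.map fun x ↦ ⟨x.1, hUV x.2⟩
    apply X.germToFunctionField_injective U.1
    have hres : ∀ a : Γ(X, V.1), (X.germToFunctionField U.1).hom
        ((X.presheaf.map (homOfLE hUV).op).hom a) = (X.germToFunctionField V.1).hom a :=
      fun a ↦ X.presheaf.germ_res_apply (homOfLE hUV) _ _ a
    rw [hres, hφ, hφ, hst, hres]
  · have hsub : Subsingleton Γ(X, U.1) := by
      have : U.1 = ⊥ := by
        rw [← TopologicalSpace.Opens.not_nonempty_iff_eq_bot]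
        rintro ⟨x, hx⟩
        exact hne ⟨⟨x, hx⟩⟩
      rw [this]
      infer_instance
    exact Subsingleton.elim _ _

/-! ### The blow-up of the plane is integral, and the class of the strict transform -/

section

open MvPolynomial HomogeneousLocalization

variable {k : Type u} [Field k]

lemma mem_range_stdChart {j : Fin 3} {x : Plane k}
    (hx : x ∈ Proj.basicOpen (homogeneousSubmodule (Fin 3) k) (X j)) :
    x ∈ Set.range (stdChart k j) := by
  have hr := Proj.opensRange_awayι (homogeneousSubmodule (Fin 3) k) (X j)
    (X_mem_homogeneousSubmodule j) one_pos
  obtain ⟨c, a, ha, h⟩ := exists_eq_coordMap (Proj.awayι (homogeneousSubmodule (Fin 3) k) (X j)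
    (X_mem_homogeneousSubmodule j) one_pos) j (by rw [← hr]; exact subset_rfl)
  rw [coordMap_eq_stdChart] at h
  rw [← hr] at hx
  obtain ⟨y, rfl⟩ := hx
  have hy := congrArg (fun q : Spec (CommRingCat.of (Away (homogeneousSubmodule (Fin 3) k) (X j))) ⟶
    Plane k ↦ q y) h.symm
  dsimp only at hy
  rw [Scheme.Hom.comp_apply] at hy
  exact ⟨_, hy⟩

/-- The blow-up has exactly one point over a point of the plane outside the centre. -/
lemma IsBlowUp.existsUnique_preimage_stdChart {n : ℕ} {p : Fin n → Projectivization k (Fin 3 → k)}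
    {S : Scheme.{u}} {π : S ⟶ Plane k} (hπ : IsBlowUp π (pointsIdeal p)) {j : Fin 3}
    (z : Spec (CommRingCat.of (MvPolynomial (Fin 2) k)))
    (hz : ∀ i, ¬ minorsIdeal MvPolynomial.C (stdCoord k j) (p i).rep ≤ z.asIdeal) :
    ∃ η : S, ∀ s, π s = stdChart k j z ↔ s = η := by
  obtain ⟨g, hg, hgz⟩ : ∃ g, (∀ i, g ∈ minorsIdeal MvPolynomial.C (stdCoord k j) (p i).rep) ∧
      g ∉ z.asIdeal := by
    choose h h1 h2 using fun i ↦ Set.not_subset.mp (hz i)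
    refine ⟨∏ i, h i, fun i ↦ Ideal.mem_of_dvd _ (Finset.dvd_prod_of_mem h (Finset.mem_univ i))
      (h1 i), ?_⟩
    rw [Ideal.IsPrime.prod_mem_iff (hp := z.2)]
    simpa using h2
  obtain ⟨B, ι, z', hι, rfl, hu, -⟩ := exists_isOpenImmersion_isUnit z hgz
  have h := hπ.existsUnique_preimage (Spec.map ι ≫ stdChart k j) (by
    refine ((Chart.std_isCompatible p j).pullIdeal_eq B ι fun i _ ↦ ?_).trans ?_
    · exact Ideal.eq_top_of_isUnit_mem _ (Ideal.mem_map_of_mem _ (hg i)) hu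
    · rw [Chart.std, map_one, Ideal.span_singleton_one]) z'
  simpa only [Scheme.Hom.comp_apply] using h

lemma IsBlowUp.existsUnique_preimage_curvePoint {n : ℕ}
    {p : Fin n → Projectivization k (Fin 3 → k)} (hp : ∀ i, (p i).rep 2 ≠ 0)
    {S : Scheme.{u}} {π : S ⟶ Plane k} (hπ : IsBlowUp π (pointsIdeal p))
    {F : MvPolynomial (Fin 3) k} {d : ℕ} (hF : F.IsHomogeneous d) (hd : 2 ≤ d) (hFp : Prime F) :
    ∃ η : S, ∀ s, π s = curvePoint hF hd hFp ↔ s = η := by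
  obtain ⟨j, hj⟩ := exists_mem_basicOpen_X (curvePoint hF hd hFp)
  obtain ⟨z, hz⟩ := mem_range_stdChart hj
  rw [← hz]
  exact hπ.existsUnique_preimage_stdChart z fun i ↦
    not_minorsIdeal_le_of_coordMap_eq_curvePoint hF hd hFp hz (hp i)

/-- The image in the plane of the generic point of a chart is the generic point. -/
lemma Chart.IsBirational.map_bot_eq {n : ℕ} {ch ch' : Chart k n} (h : ch.IsBirational)
    (h' : ch'.IsBirational) {x x' : Spec (CommRingCat.of (MvPolynomial (Fin 2) k))}
    (hx : x.asIdeal = ⊥) (hx' : x'.asIdeal = ⊥) : ch.map x = ch'.map x' := by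
  have key : ∀ {ch : Chart k n} (_ : ch.IsBirational)
      {x : Spec (CommRingCat.of (MvPolynomial (Fin 2) k))} (_ : x.asIdeal = ⊥) {D G} (_ : 0 < D)
      (_ : G ∈ homogeneousSubmodule (Fin 3) k D),
      ch.map x ∈ Proj.basicOpen (homogeneousSubmodule (Fin 3) k) G ↔ G ≠ 0 := by
    intro ch h x hx D G hD hG
    rw [Chart.map, coordMap_apply_mem_basicOpen _ _ _ _ hG hD x, hx, Ideal.mem_bot, not_iff_not]
    exact ⟨h.eq_zero D G hG, by rintro rfl; exact map_zero _⟩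
  apply ProjectiveSpectrum.ext
  apply HomogeneousIdeal.ext'
  intro D G hG
  obtain rfl | hD := Nat.eq_zero_or_pos D
  · have hG0 : G.IsHomogeneous 0 := hG
    rw [← totalDegree_zero_iff_isHomogeneous, totalDegree_eq_zero_iff_eq_C] at hG0
    have : ∀ y : ProjectiveSpectrum (homogeneousSubmodule (Fin 3) k),
        G ∈ y.asHomogeneousIdeal ↔ G = 0 := by
      intro y
      refine ⟨fun hy ↦ ?_, fun hy ↦ hy ▸ zero_mem _⟩
      by_contra hne
      refine y.isPrime.ne_top (Ideal.eq_top_of_isUnit_mem _ hy ?_)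
      rw [hG0] at hne ⊢
      exact (isUnit_iff_ne_zero.mpr fun h ↦ hne (by rw [h, map_zero])).map _
    exact (this _).trans (this _).symm
  · exact not_iff_not.mp ((key h hx hD hG).trans (key h' hx' hD hG).symm)

lemma isReduced_of_cover {X : Scheme.{u}}
    (h : ∀ x : X, ∃ (A : CommRingCat.{u}) (κ : Spec A ⟶ X), IsOpenImmersion κ ∧
      _root_.IsReduced A ∧ x ∈ Set.range κ) : AlgebraicGeometry.IsReduced X := by
  have (x : X) : _root_.IsReduced (X.presheaf.stalk x) := by
    obtain ⟨A, κ, _, _, y, rfl⟩ := h x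
    exact isReduced_of_injective (κ.stalkMap y).hom
      (ConcreteCategory.bijective_of_isIso (κ.stalkMap y)).injective
  exact isReduced_of_isReduced_stalk X

lemma Chart.std_or_exc_isBirational [Infinite k] {n : ℕ} {ch : Chart k n}
    {p : Fin n → Projectivization k (Fin 3 → k)}
    (hch : (∃ j, ch = Chart.std k n j) ∨ ∃ i l, ch = Chart.exc p i l) : ch.IsBirational := by
  rcases hch with ⟨j, rfl⟩ | ⟨i, l, rfl⟩
  · exact Chart.std_isBirational _ _
  · exact Chart.exc_isBirational _ _ _

lemma Chart.std_or_exc_isCompatible {n : ℕ} {ch : Chart k n}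
    {p : Fin n → Projectivization k (Fin 3 → k)} (hp : ∀ i, (p i).rep 2 ≠ 0)
    (hch : (∃ j, ch = Chart.std k n j) ∨ ∃ i l, ch = Chart.exc p i l) : ch.IsCompatible p := by
  rcases hch with ⟨j, rfl⟩ | ⟨i, l, rfl⟩
  · exact Chart.std_isCompatible _ _
  · exact Chart.exc_isCompatible _ _ (hp i) _

lemma isDomain_localizationAway_of_mem_range {S : Scheme.{u}} {g : MvPolynomial (Fin 2) k}
    {κ : Spec (CommRingCat.of (Localization.Away g)) ⟶ S} {s : S} (hs : s ∈ Set.range κ) :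
    IsDomain (Localization.Away g) ∧
      Function.Injective (algebraMap (MvPolynomial (Fin 2) k) (Localization.Away g)) := by
  obtain ⟨x, rfl⟩ := hs
  have hg : g ≠ 0 := by
    rintro rfl
    have : IsUnit (algebraMap (MvPolynomial (Fin 2) k) (Localization.Away
      (0 : MvPolynomial (Fin 2) k)) 0) := IsLocalization.Away.algebraMap_isUnit 0
    rw [map_zero] at this
    exact x.2.ne_top (Ideal.eq_top_of_isUnit_mem _ (zero_mem _) this)
  exact ⟨IsLocalization.isDomain_localization (Submonoid.powers_le.mpr
    (mem_nonZeroDivisors_of_ne_zero hg)), IsLocalization.injective _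
      (Submonoid.powers_le.mpr (mem_nonZeroDivisors_of_ne_zero hg))⟩

/-- The blow-up is reduced since the charts are. It is irreducible since the generic point of every
chart maps to the generic point of the plane, over which there is only one point. -/
theorem IsBlowUp.isIntegral [Infinite k] {n : ℕ} {p : Fin n → Projectivization k (Fin 3 → k)}
    (hp : ∀ i, (p i).rep 2 ≠ 0) (hinj : ∀ i i', affCoord (p i) = affCoord (p i') → i = i')
    {S : Scheme.{u}} {π : S ⟶ Plane k} (hπ : IsBlowUp π (pointsIdeal p)) : IsIntegral S := by
  have hcover := exists_chart_isLocalImmersion hp hinj hπ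
  have hred : AlgebraicGeometry.IsReduced S := isReduced_of_cover fun s ↦ by
    obtain ⟨ch, -, g, κ, hκ, hs⟩ := hcover s
    have := (isDomain_localizationAway_of_mem_range hs).1
    exact ⟨_, κ, hκ.isOpenImmersion, inferInstanceAs (_root_.IsReduced (Localization.Away g)), hs⟩
  let z : Spec (CommRingCat.of (MvPolynomial (Fin 2) k)) := ⟨⊥, Ideal.isPrime_bot⟩
  obtain ⟨η, hη⟩ := hπ.existsUnique_preimage_stdChart (j := 2) z (by
    intro i hle
    have hst : stdCoord k 2 2 = 1 := by simp [stdCoord]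
    rw [minorsIdeal_eq_span_affCoord _ hst (hp i)] at hle
    have h1 : X 0 - MvPolynomial.C (affCoord (p i) 0) ∈ z.asIdeal :=
      hle (Ideal.subset_span ⟨0, rfl⟩)
    have h2 := congrArg (eval fun _ ↦ affCoord (p i) 0 + 1) (Ideal.mem_bot.mp h1)
    simp at h2)
  have hcl : closure {η} = Set.univ := by
    refine Set.eq_univ_of_forall fun s ↦ ?_
    obtain ⟨ch, hch, g, κ, hκ, hs⟩ := hcover s
    obtain ⟨hdom, hinj'⟩ := isDomain_localizationAway_of_mem_range hs
    obtain ⟨x, rfl⟩ := hs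
    let b : Spec (CommRingCat.of (Localization.Away g)) :=
      ⟨⊥, inferInstanceAs (⊥ : Ideal (Localization.Away g)).IsPrime⟩
    have hb : κ b = η := by
      rw [← hη, ← Scheme.Hom.comp_apply, hκ.comp_eq, Scheme.Hom.comp_apply]
      refine (Chart.std_or_exc_isBirational hch).map_bot_eq (Chart.std_isBirational n 2) ?_ rfl
      exact (RingHom.injective_iff_ker_eq_bot _).mp hinj'
    have hx : x ∈ closure {b} := by
      have : (b : PrimeSpectrum (Localization.Away g)) ⤳ x :=
        (PrimeSpectrum.le_iff_specializes b x).mp bot_le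
      exact this.mem_closure
    rw [← hb, ← Set.image_singleton]
    exact image_closure_subset_closure_image κ.continuous ⟨x, hx, rfl⟩
  have hirr : IrreducibleSpace S :=
    { isPreirreducible_univ := hcl ▸ isIrreducible_singleton.closure.isPreirreducible
      toNonempty := ⟨η⟩ }
  exact isIntegral_of_irreducibleSpace_of_isReduced S

/-- The product of the powers of the exceptional divisors in a chart. -/
lemma Chart.IsCompatible.prod_pullIdeal_exceptionalDivisor {n : ℕ} {ch : Chart k n}
    {p : Fin n → Projectivization k (Fin 3 → k)} (hch : ch.IsCompatible p) {S : Scheme.{u}}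
    {π : S ⟶ Plane k} {g : MvPolynomial (Fin 2) k}
    {κ : Spec (CommRingCat.of (Localization.Away g)) ⟶ S} (hκ : ch.IsLocalImmersion p π g κ)
    (m : Fin n → ℕ) {M : ℕ} (hM : M = ∑ i, Set.indicator ch.Tᶜ m i) :
    pullIdeal κ (∏ i, exceptionalDivisor π (p i) ^ m i) =
      Ideal.span {algebraMap _ (Localization.Away g) (ch.e ^ M)} := by
  have := hκ.isOpenImmersion
  have h1 : ∀ i, pullIdeal κ (exceptionalDivisor π (p i)) =
      (minorsIdeal MvPolynomial.C ch.a (p i).rep).map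
        (algebraMap (MvPolynomial (Fin 2) k) (Localization.Away g)) := by
    intro i
    rw [exceptionalDivisor, pullIdeal_comap, hκ.comp_eq, pullIdeal_SpecMap, Chart.map,
      pullIdeal_coordMap_pointIdeal]
    rfl
  rw [pullIdeal_prod, map_pow, ← Ideal.span_singleton_pow, hM, ← Finset.prod_pow_eq_pow_sum]
  refine Finset.prod_congr rfl fun i _ ↦ ?_
  rw [pullIdeal_pow, h1]
  by_cases hi : i ∈ ch.T
  · rw [hκ.map_minorsIdeal_eq_top i hi, Set.indicator_of_notMem (by simpa using hi), pow_zero,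
      ← Ideal.one_eq_top, one_pow]
  · rw [hch.minorsIdeal_eq i hi, Set.indicator_of_mem hi, Ideal.map_span, Set.image_singleton]

/-- The strict transform of an irreducible plane curve of degree `d` with multiplicity `mᵢ` at the
`i`-th point belongs to the linear system `|d H - ∑ mᵢ Eᵢ|`. The rational function relating the two
divisors is `x₀ ^ d / F`. -/
theorem closure_mem_linearSystem [Infinite k] {n : ℕ} {p : Fin n → Projectivization k (Fin 3 → k)}
    (hp : ∀ i, (p i).rep 2 ≠ 0) (hinj : ∀ i i', affCoord (p i) = affCoord (p i') → i = i')
    {S : Scheme.{u}} {π : S ⟶ Plane k} (hπ : IsBlowUp π (pointsIdeal p))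
    {F : MvPolynomial (Fin 3) k} {d : ℕ} (hF : F.IsHomogeneous d) (hd : 2 ≤ d) (hFp : Prime F)
    (m : Fin n → ℕ)
    (hch : ∀ ch : Chart k n, ((∃ j, ch = Chart.std k n j) ∨ ∃ i l, ch = Chart.exc p i l) →
      ∃ F' M, ch.IsStrictTransform F d F' M ∧ M = ∑ i, Set.indicator ch.Tᶜ m i)
    {η : S} (hη : ∀ s, π s = curvePoint hF hd hFp ↔ s = η) :
    Scheme.IdealSheafData.vanishingIdeal ⟨closure {η}, isClosed_closure⟩ ∈
      linearSystem π p d m := by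
  have hint := hπ.isIntegral hp hinj
  have hcover := exists_chart_isLocalImmersion hp hinj hπ
  set Z : TopologicalSpace.Closeds S := ⟨closure {η}, isClosed_closure⟩
  constructor
  · refine isEffectiveCartier_of_cover fun s ↦ ?_
    obtain ⟨ch, hc, g, κ, hκ, hs⟩ := hcover s
    obtain ⟨F', M, h, -⟩ := hch ch hc
    obtain ⟨hdom, hinj'⟩ := isDomain_localizationAway_of_mem_range hs
    refine ⟨_, κ, hκ.isOpenImmersion, hs, _, ?_,
      h.pullIdeal_closure hp (Chart.std_or_exc_isCompatible hp hc) hκ hη⟩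
    exact mem_nonZeroDivisors_of_ne_zero (M₀ := Localization.Away g)
      ((map_ne_zero_iff _ hinj').mpr h.ne_zero)
  · -- homogeneous coordinates `b` of the generic point, in the function field of `S`
    obtain ⟨j, c, b, hb, hε⟩ : ∃ (j : Fin 3) (c : k →+* S.functionField)
        (b : Fin 3 → S.functionField) (hb : b j = 1),
        S.fromSpecStalk (genericPoint S) ≫ π = coordMap j c b hb := by
      obtain ⟨ch, hc, g, κ, hκ, hs⟩ := hcover η
      have := hκ.isOpenImmersion
      obtain ⟨x, hx⟩ := hs
      obtain ⟨ρ, -, hρ⟩ := exists_injective_SpecMap_comp_eq_fromSpecStalk κ x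
      exact ⟨_, _, _, _, by rw [← hρ, Category.assoc, hκ.comp_eq, ← Spec.map_comp_assoc,
        Chart.SpecMap_map]⟩
    -- the value of a form at `b` in terms of its pull-back to a chart
    have hlocal : ∀ {ch : Chart k n} {g : MvPolynomial (Fin 2) k}
        {κ : Spec (CommRingCat.of (Localization.Away g)) ⟶ S} (_ : ch.IsLocalImmersion p π g κ)
        {ρ : CommRingCat.of (Localization.Away g) ⟶ S.functionField}
        (_ : Spec.map ρ ≫ κ = S.fromSpecStalk (genericPoint S)) {D : ℕ}
        {G : MvPolynomial (Fin 3) k} (_ : G.IsHomogeneous D),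
        eval₂Hom c b G = b ch.j ^ D * ρ.hom (algebraMap _ _ (ch.pull G)) := by
      intro ch g κ hκ ρ hρ D G hG
      rw [← hρ, Category.assoc, hκ.comp_eq, ← Spec.map_comp_assoc, Chart.SpecMap_map] at hε
      obtain ⟨hc, -, hb'⟩ := eq_mul_of_coordMap_eq hε.symm
      have hb'' : b = fun i ↦ b ch.j * (ρ.hom ∘ algebraMap _ (Localization.Away g) ∘ ch.a) i :=
        funext hb'
      conv_lhs => rw [hb'', hc, eval₂Hom_mul_of_isHomogeneous _ _ _ hG]
      congr 1
      · refine (MvPolynomial.eval₂_comp_left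
          (ρ.hom.comp (algebraMap (MvPolynomial (Fin 2) k) (Localization.Away g)))
          MvPolynomial.C ch.a G).symm
    have hunit : ∀ {ch : Chart k n} {g : MvPolynomial (Fin 2) k}
        {κ : Spec (CommRingCat.of (Localization.Away g)) ⟶ S} (_ : ch.IsLocalImmersion p π g κ)
        {ρ : CommRingCat.of (Localization.Away g) ⟶ S.functionField}
        (_ : Spec.map ρ ≫ κ = S.fromSpecStalk (genericPoint S)), b ch.j ≠ 0 := by
      intro ch g κ hκ ρ hρ h0
      have := hlocal hκ hρ (isHomogeneous_X k j)
      simp [h0, hb] at this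
    have hne : ∀ {D : ℕ} {G : MvPolynomial (Fin 3) k} (_ : G.IsHomogeneous D), G ≠ 0 →
        eval₂Hom c b G ≠ 0 := by
      intro D G hG hG0
      obtain ⟨ch, hc, g, κ, hκ, hs⟩ := hcover η
      have := hκ.isOpenImmersion
      obtain ⟨hdom, hinj'⟩ := isDomain_localizationAway_of_mem_range hs
      obtain ⟨x, hx⟩ := hs
      obtain ⟨ρ, hρi, hρ⟩ := exists_injective_SpecMap_comp_eq_fromSpecStalk κ x
      rw [hlocal hκ hρ hG]
      refine mul_ne_zero (pow_ne_zero _ (hunit hκ hρ)) ?_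
      rw [map_ne_zero_iff _ hρi, map_ne_zero_iff _ hinj']
      exact fun h ↦ hG0 ((Chart.std_or_exc_isBirational hc).eq_zero D G hG h)
    have hX0 : ((X 0 : MvPolynomial (Fin 3) k) ^ d).IsHomogeneous d := by
      simpa using (isHomogeneous_X k (0 : Fin 3)).pow d
    refine linearlyEquivalent_of_generators (θ := eval₂Hom c b (X 0 ^ d) / eval₂Hom c b F)
      (div_ne_zero (hne hX0 (pow_ne_zero _ (X_ne_zero _))) (hne hF hFp.ne_zero)) fun s ↦ ?_
    obtain ⟨ch, hc, g, κ, hκ, hs⟩ := hcover s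
    have := hκ.isOpenImmersion
    obtain ⟨F', M, h, hM⟩ := hch ch hc
    have hs' := hs
    obtain ⟨x, hx⟩ := hs
    obtain ⟨ρ, -, hρ⟩ := exists_injective_SpecMap_comp_eq_fromSpecStalk κ x
    refine ⟨_, κ, hκ.isOpenImmersion, algebraMap _ (Localization.Away g) (ch.pull F),
      algebraMap _ (Localization.Away g) (ch.pull (X 0 ^ d)), ρ, hs', ?_, ?_, hρ, ?_⟩
    · have hcomp := Chart.std_or_exc_isCompatible hp hc
      rw [pullIdeal_mul, h.pullIdeal_closure hp hcomp hκ hη,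
        hcomp.prod_pullIdeal_exceptionalDivisor hκ m hM, Ideal.span_singleton_mul_span_singleton,
        ← map_mul, h.pull_eq, mul_comm]
    · rw [pullIdeal_pow, hyperplaneDivisor, pullIdeal_comap, hκ.comp_eq, pullIdeal_SpecMap,
        Chart.map, pullIdeal_coordMap_lineIdeal, Ideal.map_span, Set.image_singleton,
        Ideal.span_singleton_pow, map_pow, map_pow, Chart.pull_X]
      rfl
    · have hF0 := hne hF hFp.ne_zero
      rw [hlocal hκ hρ hF] at hF0 ⊢
      rw [hlocal hκ hρ hX0]
      have hb0 := hunit hκ hρ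
      have hF1 := right_ne_zero_of_mul hF0
      field_simp

/-! ### Smoothness and connectedness of the strict transform -/

/-- The Jacobian criterion for a plane curve, on the locus where the `l`-th partial derivative does
not vanish. -/
lemma isStandardSmoothOfRelativeDimension_one (F g : MvPolynomial (Fin 2) k) (l : Fin 2)
    {T : Type u} [CommRing T] [Algebra k T]
    [Algebra (MvPolynomial (Fin 2) k ⧸ Ideal.span (Set.range fun _ : Unit ↦ F)) T]
    [IsScalarTower k (MvPolynomial (Fin 2) k ⧸ Ideal.span (Set.range fun _ : Unit ↦ F)) T]
    [IsLocalization.Away (Ideal.Quotient.mk (Ideal.span (Set.range fun _ : Unit ↦ F))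
      (g * pderiv l F)) T] : Algebra.IsStandardSmoothOfRelativeDimension 1 k T := by
  set Q := MvPolynomial (Fin 2) k ⧸ Ideal.span (Set.range fun _ : Unit ↦ F)
  set r : Q := Ideal.Quotient.mk _ (g * pderiv l F)
  let P := Algebra.PreSubmersivePresentation.naive (v := fun _ : Unit ↦ F)
    (fun _ ↦ l) (fun _ _ _ ↦ Subsingleton.elim _ _) (R := k)
  let P' := Algebra.PreSubmersivePresentation.localizationAway T r
  have hjac : IsUnit (P'.comp P).jacobian := by
    rw [Algebra.PreSubmersivePresentation.comp_jacobian_eq_jacobian_smul_jacobian,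
      Algebra.smul_def, Algebra.PreSubmersivePresentation.localizationAway_jacobian, ← map_mul]
    have h1 : P.jacobian = Ideal.Quotient.mk _ (pderiv l F) := by
      rw [Algebra.PreSubmersivePresentation.jacobian_eq_jacobiMatrix_det, Matrix.det_unique]
      exact congrArg (Ideal.Quotient.mk _)
        (Algebra.PreSubmersivePresentation.jacobiMatrix_naive (v := fun _ : Unit ↦ F) (R := k)
          (fun _ ↦ l) (fun _ _ _ ↦ Subsingleton.elim _ _) _ (Function.surjInv_eq _) () ())
    have hu : IsUnit (algebraMap Q T r) := IsLocalization.Away.algebraMap_isUnit r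
    rw [map_mul]
    refine IsUnit.mul ?_ hu
    refine isUnit_of_dvd_unit (map_dvd (algebraMap Q T) ?_) hu
    rw [h1]
    exact map_dvd _ (Dvd.intro_left _ rfl)
  let P'' : Algebra.SubmersivePresentation k T (Unit ⊕ Fin 2) (Unit ⊕ Unit) :=
    { P'.comp P with jacobian_isUnit := hjac }
  refine P''.isStandardSmoothOfRelativeDimension ?_
  change (P'.comp P).dimension = 1
  rw [Algebra.PreSubmersivePresentation.dimension_comp_eq_dimension_add_dimension]
  simp [Algebra.Presentation.dimension]

/-- The Jacobian criterion for an open part `Q` of the curve `F = 0` on which the two partial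
derivatives generate the unit ideal. -/
lemma locally_isStandardSmoothOfRelativeDimension_one_of_isLocalization
    (F g : MvPolynomial (Fin 2) k) {Q : Type u} [CommRing Q]
    [Algebra (MvPolynomial (Fin 2) k ⧸ Ideal.span (Set.range fun _ : Unit ↦ F)) Q]
    [IsLocalization.Away (Ideal.Quotient.mk (Ideal.span (Set.range fun _ : Unit ↦ F)) g) Q]
    (h : Ideal.span (Set.range fun l : Fin 2 ↦ algebraMap
      (MvPolynomial (Fin 2) k ⧸ Ideal.span (Set.range fun _ : Unit ↦ F)) Q
        (Ideal.Quotient.mk _ (pderiv l F))) = ⊤) :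
    RingHom.Locally (RingHom.IsStandardSmoothOfRelativeDimension 1)
      ((algebraMap (MvPolynomial (Fin 2) k ⧸ Ideal.span (Set.range fun _ : Unit ↦ F)) Q).comp
        ((Ideal.Quotient.mk _).comp MvPolynomial.C)) := by
  refine RingHom.locally_of_exists (RingHom.isStandardSmoothOfRelativeDimension_respectsIso)
    _ _ h (fun l ↦ Localization.Away (algebraMap
      (MvPolynomial (Fin 2) k ⧸ Ideal.span (Set.range fun _ : Unit ↦ F)) Q
        (Ideal.Quotient.mk _ (pderiv l F)))) (fun l ↦ ?_)
  generalize hJ : Ideal.span (Set.range fun _ : Unit ↦ F) = J at *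
  let T := Localization.Away (algebraMap (MvPolynomial (Fin 2) k ⧸ J) Q
    (Ideal.Quotient.mk _ (pderiv l F)))
  let : Algebra (MvPolynomial (Fin 2) k ⧸ J) T :=
    ((algebraMap Q T).comp (algebraMap (MvPolynomial (Fin 2) k ⧸ J) Q)).toAlgebra
  have h1 : @IsScalarTower (MvPolynomial (Fin 2) k ⧸ J) Q T Algebra.toSMul Algebra.toSMul
      Algebra.toSMul := IsScalarTower.of_algebraMap_eq' rfl
  let : Algebra k T := ((algebraMap Q T).comp ((algebraMap (MvPolynomial (Fin 2) k ⧸ J) Q).comp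
    ((Ideal.Quotient.mk _).comp MvPolynomial.C))).toAlgebra
  have h2 : @IsScalarTower k (MvPolynomial (Fin 2) k ⧸ J) T Algebra.toSMul Algebra.toSMul
      Algebra.toSMul := IsScalarTower.of_algebraMap_eq' rfl
  have h4 : IsLocalization.Away (Ideal.Quotient.mk J (g * pderiv l F)) T := by
    rw [map_mul]
    exact IsLocalization.Away.mul' Q T _ _
  subst hJ
  exact isStandardSmoothOfRelativeDimension_one F g l (T := T)

lemma locally_isStandardSmoothOfRelativeDimension_one (F g : MvPolynomial (Fin 2) k)
    (h : (Ideal.span {F, pderiv 0 F, pderiv 1 F}).map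
      (algebraMap (MvPolynomial (Fin 2) k) (Localization.Away g)) = ⊤) :
    RingHom.Locally (RingHom.IsStandardSmoothOfRelativeDimension 1)
      ((Ideal.Quotient.mk ((Ideal.span (Set.range fun _ : Unit ↦ F)).map
        (algebraMap (MvPolynomial (Fin 2) k) (Localization.Away g)))).comp
          ((algebraMap (MvPolynomial (Fin 2) k) (Localization.Away g)).comp MvPolynomial.C)) := by
  let B := MvPolynomial (Fin 2) k
  let J : Ideal B := Ideal.span (Set.range fun _ : Unit ↦ F)
  let ι := algebraMap B (Localization.Away g)
  have hle : J ≤ Ideal.comap ι (J.map ι) := Ideal.le_comap_map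
  let q := Ideal.Quotient.mk (J.map ι)
  let : Algebra (B ⧸ J) (Localization.Away g ⧸ J.map ι) :=
    (Ideal.quotientMap (J.map ι) ι hle).toAlgebra
  have hQ : IsLocalization.Away (Ideal.Quotient.mk J g) (Localization.Away g ⧸ J.map ι) := by
    simp only [IsLocalization.Away, ← Submonoid.map_powers]
    refine IsLocalization.of_surjective _ (Localization.Away g) (Ideal.Quotient.mk J)
      Ideal.Quotient.mk_surjective q Ideal.Quotient.mk_surjective ?_ ?_
    · exact (Ideal.quotientMap_comp_mk hle).symm
    · simp only [Ideal.mk_ker, q, ι]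
      exact le_rfl
  refine locally_isStandardSmoothOfRelativeDimension_one_of_isLocalization F g
    (Q := Localization.Away g ⧸ J.map ι) ?_
  have h1 : Ideal.map q (Ideal.map ι (Ideal.span {F, pderiv 0 F, pderiv 1 F})) = ⊤ :=
    (congrArg (Ideal.map q) h).trans (Ideal.map_top q)
  rw [Ideal.map_map, Ideal.map_span (q.comp ι)] at h1
  refine top_le_iff.mp (h1.ge.trans (Ideal.span_le.mpr ?_))
  rintro _ ⟨f, hf | hf | hf, rfl⟩ <;> rw [hf]
  · have : q (ι F) = 0 := Ideal.Quotient.eq_zero_iff_mem.mpr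
      (Ideal.mem_map_of_mem _ (Ideal.subset_span ⟨(), rfl⟩))
    change q (ι F) ∈ _
    rw [this]
    exact zero_mem _
  · exact Ideal.subset_span ⟨0, rfl⟩
  · exact Ideal.subset_span ⟨1, rfl⟩

/-- Smoothness can be checked on an open cover by spectra. -/
lemma smoothOfRelativeDimension_of_cover {X Y : Scheme.{u}} (f : X ⟶ Y) (n : ℕ)
    (h : ∀ x : X, ∃ (A : CommRingCat.{u}) (κ : Spec A ⟶ X), IsOpenImmersion κ ∧
      x ∈ Set.range κ ∧ SmoothOfRelativeDimension n (κ ≫ f)) : SmoothOfRelativeDimension n f := by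
  have hloc : HasRingHomProperty (@SmoothOfRelativeDimension.{u} n)
    (RingHom.Locally (RingHom.IsStandardSmoothOfRelativeDimension n)) := inferInstance
  have hloc' : IsZariskiLocalAtSource (@SmoothOfRelativeDimension.{u} n) :=
    HasRingHomProperty.instIsZariskiLocalAtSource
      (Q := RingHom.Locally (RingHom.IsStandardSmoothOfRelativeDimension n))
  have hiso : MorphismProperty.RespectsIso (@SmoothOfRelativeDimension.{u} n) :=
    { toRespectsLeft := hloc'.toRespectsLeft, toRespectsRight := hloc'.toRespectsRight }
  choose A κ hκ hx hf using h
  refine (IsZariskiLocalAtSource.iff_of_iSup_eq_top (P := @SmoothOfRelativeDimension n)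
    (fun x ↦ (κ x).opensRange) (top_le_iff.mp fun x _ ↦
      TopologicalSpace.Opens.mem_iSup.mpr ⟨x, hx x⟩)).mpr fun x ↦ ?_
  have h1 : (κ x).opensRange.ι = (κ x).isoOpensRange.inv ≫ κ x := by
    rw [Iso.eq_inv_comp, Scheme.Hom.isoOpensRange_hom_ι]
  rw [h1, Category.assoc]
  exact (MorphismProperty.cancel_left_of_respectsIso (@SmoothOfRelativeDimension n) _ _).mpr (hf x)

lemma exists_quotient_chart {X : Scheme.{u}} (D : X.IdealSheafData) {U : X.Opens}
    (hU : IsAffineOpen U) :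
    ∃ (f : Spec (CommRingCat.of (Γ(X, U) ⧸ D.ideal ⟨U, hU⟩)) ⟶ D.subscheme) (_ : IsOpenImmersion f),
      f.opensRange = D.subschemeι ⁻¹ᵁ U ∧
      f ≫ D.subschemeι = Spec.map (CommRingCat.ofHom (Ideal.Quotient.mk _)) ≫ hU.fromSpec := by
  have h1 : IsOpenImmersion (D.subschemeCover.f ⟨U, hU⟩) := D.subschemeCover.map_prop _
  exact ⟨D.subschemeCover.f ⟨U, hU⟩, h1, D.opensRange_subschemeCover_map ⟨U, hU⟩,
    (D.subschemeCover_map_subschemeι ⟨U, hU⟩).trans (D.glueDataObjι_ι ⟨U, hU⟩)⟩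

/-- An affine chart of a closed subscheme. -/
lemma exists_subscheme_chart {X : Scheme.{u}} (D : X.IdealSheafData) {A : CommRingCat.{u}}
    (κ : Spec A ⟶ X) [IsOpenImmersion κ] {J : Ideal A} (hJ : pullIdeal κ D = J) :
    ∃ κ' : Spec (CommRingCat.of (A ⧸ J)) ⟶ D.subscheme, IsOpenImmersion κ' ∧
      κ' ≫ D.subschemeι = Spec.map (CommRingCat.ofHom (Ideal.Quotient.mk J)) ≫ κ ∧
      ∀ y, D.subschemeι y ∈ Set.range κ → y ∈ Set.range κ' := by
  obtain ⟨φ, _, h⟩ := exists_isIso_eq_SpecMap_fromSpec κ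
  set hU := isAffineOpen_opensRange κ
  let U : X.affineOpens := ⟨κ.opensRange, hU⟩
  have hJ' : J = (D.ideal U).map φ.hom := by
    rw [← hJ, congrArg (pullIdeal · D) h, pullIdeal_SpecMap, pullIdeal_fromSpec]
  let E := (asIso φ).commRingCatIsoToRingEquiv
  let e : (Γ(X, κ.opensRange) ⧸ D.ideal U) ≃+* (A ⧸ J) := Ideal.quotientEquiv _ _ E hJ'
  let e' : CommRingCat.of (Γ(X, κ.opensRange) ⧸ D.ideal U) ≅ CommRingCat.of (A ⧸ J) :=
    e.toCommRingCatIso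
  obtain ⟨f, hf, hfr, hfD⟩ := exists_quotient_chart D hU
  refine ⟨Spec.map e'.hom ≫ f, inferInstance, ?_, fun y hy ↦ ?_⟩
  · rw [Category.assoc, hfD]
    refine Eq.trans ?_ (congrArg (Spec.map (CommRingCat.ofHom (Ideal.Quotient.mk J)) ≫ ·) h).symm
    rw [← Spec.map_comp_assoc, ← Spec.map_comp_assoc]
    rfl
  · have hy' : y ∈ D.subschemeι ⁻¹ᵁ U.1 := hy
    rw [← hfr] at hy'
    obtain ⟨z, hz⟩ := hy'
    refine ⟨Spec.map e'.inv z, ?_⟩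
    rw [Scheme.Hom.comp_apply, ← Scheme.Hom.comp_apply (Spec.map e'.inv), ← Spec.map_comp,
      Iso.hom_inv_id, Spec.map_id]
    exact hz

/-- Outside the removed points of the chart, the curve `F'` has no singular points. -/
def Chart.IsSmoothAlong {n : ℕ} (ch : Chart k n) (p : Fin n → Projectivization k (Fin 3 → k))
    (F' : MvPolynomial (Fin 2) k) : Prop :=
  ∀ w : Fin 2 → k, eval w F' = 0 → (∀ l, eval w (pderiv l F') = 0) →
    ∃ i ∈ ch.T, ∀ f ∈ minorsIdeal MvPolynomial.C ch.a (p i).rep, eval w f = 0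

/-- By the Nullstellensatz, smoothness in closed points outside the removed points implies that the
Jacobian ideal becomes trivial where the ideals of the removed points do. -/
lemma Chart.IsSmoothAlong.map_span_eq_top [IsAlgClosed k] {n : ℕ} {ch : Chart k n}
    {p : Fin n → Projectivization k (Fin 3 → k)} {F' : MvPolynomial (Fin 2) k}
    (h : ch.IsSmoothAlong p F') {A : Type*} [CommRing A] (φ : MvPolynomial (Fin 2) k →+* A)
    (hφ : ∀ i ∈ ch.T, (minorsIdeal MvPolynomial.C ch.a (p i).rep).map φ = ⊤) :
    (Ideal.span {F', pderiv 0 F', pderiv 1 F'}).map φ = ⊤ := by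
  classical
  set J := Ideal.span {F', pderiv 0 F', pderiv 1 F'} with hJ
  let I : Ideal (MvPolynomial (Fin 2) k) :=
    ∏ i ∈ Finset.univ.filter (· ∈ ch.T), minorsIdeal MvPolynomial.C ch.a (p i).rep
  have hI : I ≤ J.radical := by
    intro f hf
    rw [← MvPolynomial.vanishingIdeal_zeroLocus_eq_radical (K := k)]
    rw [mem_vanishingIdeal_iff]
    intro w hw
    have hw' : ∀ f ∈ J, eval w f = 0 := fun f hf ↦ by simpa using hw f hf
    obtain ⟨i, hi, hv⟩ := h w (hw' _ (Ideal.subset_span (by simp))) (by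
      intro l
      fin_cases l
      · exact hw' _ (Ideal.subset_span (by simp))
      · exact hw' _ (Ideal.subset_span (by simp)))
    have hf' : f ∈ minorsIdeal MvPolynomial.C ch.a (p i).rep :=
      Ideal.prod_le_inf.trans (Finset.inf_le (Finset.mem_filter.mpr ⟨Finset.mem_univ i, hi⟩)) hf
    simpa using hv f hf'
  have h1 : I.map φ = ⊤ := by
    rw [← Ideal.mapHom_apply, map_prod, ← Ideal.one_eq_top]
    refine Finset.prod_eq_one fun i hi ↦ ?_
    rw [Ideal.mapHom_apply, hφ i (Finset.mem_filter.mp hi).2, Ideal.one_eq_top]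
  have h2 : I.map φ ≤ (J.map φ).radical :=
    (Ideal.map_mono hI).trans (Ideal.map_radical_le φ)
  rw [h1, top_le_iff] at h2
  exact Ideal.radical_eq_top.mp h2

/-- The strict transform of an irreducible curve is connected as the closure of a point, and its
smoothness can be checked in the charts. -/
theorem isSmoothConnectedCurve_closure [IsAlgClosed k] {n : ℕ}
    {p : Fin n → Projectivization k (Fin 3 → k)}
    (hp : ∀ i, (p i).rep 2 ≠ 0) (hinj : ∀ i i', affCoord (p i) = affCoord (p i') → i = i')
    {S : Scheme.{u}} {π : S ⟶ Plane k} (hπ : IsBlowUp π (pointsIdeal p))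
    {F : MvPolynomial (Fin 3) k} {d : ℕ} (hF : F.IsHomogeneous d) (hd : 2 ≤ d) (hFp : Prime F)
    (hch : ∀ ch : Chart k n, ((∃ j, ch = Chart.std k n j) ∨ ∃ i l, ch = Chart.exc p i l) →
      ∃ F' M, ch.IsStrictTransform F d F' M ∧ ch.IsSmoothAlong p F')
    {η : S} (hη : ∀ s, π s = curvePoint hF hd hFp ↔ s = η) :
    IsSmoothConnectedCurve (π ≫ planeToSpec k)
      (Scheme.IdealSheafData.vanishingIdeal ⟨closure {η}, isClosed_closure⟩) := by
  set D := Scheme.IdealSheafData.vanishingIdeal (X := S) ⟨closure {η}, isClosed_closure⟩ with hD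
  constructor
  · refine smoothOfRelativeDimension_of_cover _ _ fun y ↦ ?_
    obtain ⟨ch, hc, g, κ, hκ, hs⟩ := exists_chart_isLocalImmersion hp hinj hπ (D.subschemeι y)
    obtain ⟨F', M, h, hsm⟩ := hch ch hc
    have := hκ.isOpenImmersion
    have hpull := h.pullIdeal_closure hp (Chart.std_or_exc_isCompatible hp hc) hκ hη
    rw [← Set.image_singleton, ← Ideal.map_span, ← Set.range_const (ι := Unit) (c := F')] at hpull
    obtain ⟨κ', hκ', hcomp, hmem⟩ := exists_subscheme_chart D κ hpull
    refine ⟨_, κ', hκ', hmem y hs, ?_⟩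
    have h1 : κ' ≫ D.subschemeι ≫ π ≫ planeToSpec k = Spec.map (CommRingCat.ofHom
        ((Ideal.Quotient.mk ((Ideal.span (Set.range fun _ : Unit ↦ F')).map
        (algebraMap (MvPolynomial (Fin 2) k) (Localization.Away g)))).comp
          ((algebraMap (MvPolynomial (Fin 2) k) (Localization.Away g)).comp MvPolynomial.C))) := by
      rw [reassoc_of% hcomp, reassoc_of% hκ.comp_eq, Chart.map, coordMap_planeToSpec,
        ← Spec.map_comp, ← Spec.map_comp]
      rfl
    rw [h1, HasRingHomProperty.Spec_iff (P := @SmoothOfRelativeDimension 1)]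
    exact locally_isStandardSmoothOfRelativeDimension_one F' g
      (hsm.map_span_eq_top _ hκ.map_minorsIdeal_eq_top)
  · have hr : Set.range D.subschemeι = closure {η} := by
      rw [Scheme.IdealSheafData.range_subschemeι, hD]
      simp
    have hconn : _root_.IsConnected (Set.range D.subschemeι) := by
      rw [hr]
      exact isIrreducible_singleton.closure.isConnected
    have := isConnected_iff_connectedSpace.mp hconn
    exact D.subschemeι.isEmbedding.toHomeomorph.symm.surjective.connectedSpace
      D.subschemeι.isEmbedding.toHomeomorph.symm.continuous

/-! ### Spreading out from the generic member of a linear system -/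

attribute [local instance] MvPolynomial.algebraMvPolynomial in
/-- The Nullstellensatz over an algebraic closure of the fraction field of a domain `A`, with the
denominators cleared. -/
lemma exists_C_mul_pow_mem_span {A τ : Type*} [CommRing A] [IsDomain A] [Finite τ]
    (K Ω : Type*) [Field K] [Field Ω] [Algebra A K] [IsFractionRing A K] [Algebra K Ω]
    [Algebra A Ω] [IsScalarTower A K Ω] [IsAlgClosed Ω]
    (S : Set (MvPolynomial τ A)) (h : MvPolynomial τ A)
    (hS : ∀ ξ : τ → Ω, (∀ s ∈ S, aeval ξ s = 0) → aeval ξ h = 0) :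
    ∃ g : A, g ≠ 0 ∧ ∃ n : ℕ, C g * h ^ n ∈ Ideal.span S := by
  let ι := MvPolynomial.map (σ := τ) (algebraMap A K)
  have hι : ∀ (ξ : τ → Ω) s, aeval ξ (ι s) = aeval ξ s := fun ξ s ↦ aeval_map_algebraMap K ξ s
  have h1 : ι h ∈ ((Ideal.span S).map ι).radical := by
    rw [← MvPolynomial.vanishingIdeal_zeroLocus_eq_radical (K := Ω), mem_vanishingIdeal_iff]
    intro ξ hξ
    rw [hι]
    refine hS ξ fun s hs ↦ ?_
    rw [← hι]
    exact hξ _ (Ideal.mem_map_of_mem _ (Ideal.subset_span hs))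
  obtain ⟨n, hn⟩ := h1
  rw [← map_pow] at hn
  have hloc : IsLocalization (A⁰.map (C (σ := τ))) (MvPolynomial τ K) :=
    MvPolynomial.isLocalization A⁰ K
  have hι' : ι = algebraMap (MvPolynomial τ A) (MvPolynomial τ K) := rfl
  rw [hι', IsLocalization.algebraMap_mem_map_algebraMap_iff (A⁰.map (C (σ := τ)))] at hn
  obtain ⟨_, ⟨g, hg, rfl⟩, hmem⟩ := hn
  exact ⟨g, nonZeroDivisors.ne_zero hg, n, hmem⟩

/-- A derivation `∂/∂λ` of a polynomial ring extends to every separable algebraic extension of its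
fraction field; here the extension is written as a homomorphism to the dual numbers. -/
lemma exists_algHom_trivSqZeroExt {γ : Type*} (K Ω : Type*) [Field K] [Field Ω]
    [Algebra (MvPolynomial γ k) K] [IsFractionRing (MvPolynomial γ k) K] [Algebra K Ω]
    [Algebra.IsSeparable K Ω] [Algebra (MvPolynomial γ k) Ω] [IsScalarTower (MvPolynomial γ k) K Ω]
    (c : γ) : ∃ ψ : Ω →+* TrivSqZeroExt Ω Ω, (∀ x, (ψ x).fst = x) ∧
      ∀ a : MvPolynomial γ k, (ψ (algebraMap _ Ω a)).snd = algebraMap _ Ω (pderiv c a) := by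
  let A := MvPolynomial γ k
  let θ : A →+* TrivSqZeroExt Ω Ω :=
    { toFun a := (algebraMap A Ω a, algebraMap A Ω (pderiv c a))
      map_one' := Prod.ext (map_one _) (by simp; rfl)
      map_zero' := Prod.ext (map_zero _) (by simp; rfl)
      map_mul' a b := Prod.ext (map_mul _ a b) (by
        change algebraMap A Ω (pderiv c (a * b)) = algebraMap A Ω a * algebraMap A Ω (pderiv c b) +
          algebraMap A Ω (pderiv c a) * algebraMap A Ω b
        rw [Derivation.leibniz, map_add, smul_eq_mul, smul_eq_mul, map_mul, map_mul,
          mul_comm (algebraMap A Ω b)])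
      map_add' a b := Prod.ext (map_add _ a b) (by
        change algebraMap A Ω (pderiv c (a + b)) = _
        rw [map_add, map_add]
        rfl) }
  let : Algebra A (TrivSqZeroExt Ω Ω) := θ.toAlgebra
  have : Algebra.FormallyEtale A K := Algebra.FormallyEtale.of_isLocalization A⁰
  have : Algebra.FormallyEtale K Ω := Algebra.FormallyEtale.of_isSeparable K Ω
  have : Algebra.FormallyEtale A Ω := Algebra.FormallyEtale.comp A K Ω
  let π : TrivSqZeroExt Ω Ω →ₐ[A] Ω :=
    { (TrivSqZeroExt.fstHom Ω Ω Ω : TrivSqZeroExt Ω Ω →+* Ω) with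
      commutes' a := by
        rfl }
  have hπ : Function.Surjective π := fun x ↦ ⟨TrivSqZeroExt.inl x, rfl⟩
  let ψ : Ω →ₐ[A] TrivSqZeroExt Ω Ω :=
    Algebra.FormallySmooth.liftOfSurjective (AlgHom.id A Ω) π hπ ⟨2, by
      rw [pow_two, Ideal.zero_eq_bot, eq_bot_iff, Ideal.mul_le]
      intro x hx y hy
      have hx' : x.fst = 0 := hx
      have hy' : y.fst = 0 := hy
      simp only [Ideal.mem_bot]
      ext <;> simp [hx', hy']⟩
  refine ⟨ψ, fun x ↦ ?_, fun a ↦ ?_⟩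
  · exact DFunLike.congr_fun (Algebra.FormallySmooth.comp_liftOfSurjective (AlgHom.id A Ω) π hπ _) x
  · have : ψ (algebraMap A Ω a) = θ a := ψ.commutes a
    change (ψ (algebraMap A Ω a)).snd = _
    rw [this]
    rfl

/-- The generic member `∑ λ_c f_c` of a linear system. -/
def genericMember {γ τ : Type*} [Fintype γ] (f : γ → MvPolynomial τ k) :
    MvPolynomial τ (MvPolynomial γ k) :=
  ∑ c, C (X c) * MvPolynomial.map C (f c)

lemma map_eval_genericMember {γ τ : Type*} [Fintype γ] (f : γ → MvPolynomial τ k) (t : γ → k) :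
    MvPolynomial.map (eval t) (genericMember f) = ∑ c, C (t c) * f c := by
  have : (eval t).comp (C : k →+* MvPolynomial γ k) = RingHom.id k := by ext; simp
  simp [genericMember, MvPolynomial.map_map, this, MvPolynomial.map_id]

/-- Bertini's theorem at the generic point: in characteristic zero, the singular points of the
generic member of a linear system are base points. Indeed `∂/∂λ_c` extends to an algebraic closure,
and it maps `∑ λ_c f_c(ξ) = 0` to `f_c(ξ) + (a combination of the partial derivatives) = 0`. -/
lemma aeval_eq_zero_of_singular {γ τ : Type*} [Fintype γ] [Fintype τ] (K Ω : Type*) [Field K]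
    [Field Ω] [Algebra (MvPolynomial γ k) K] [IsFractionRing (MvPolynomial γ k) K] [Algebra K Ω]
    [Algebra.IsSeparable K Ω] [Algebra (MvPolynomial γ k) Ω] [IsScalarTower (MvPolynomial γ k) K Ω]
    (f : γ → MvPolynomial τ k) (ξ : τ → Ω)
    (h0 : aeval ξ (genericMember f) = 0)
    (h1 : ∀ l, aeval ξ (genericMember fun c ↦ pderiv l (f c)) = 0) (c : γ) :
    aeval ξ (MvPolynomial.map C (f c) : MvPolynomial τ (MvPolynomial γ k)) = 0 := by
  classical
  obtain ⟨ψ, hψ, hψ'⟩ := exists_algHom_trivSqZeroExt (k := k) K Ω c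
  let ev (q : MvPolynomial τ k) : Ω :=
    aeval ξ (MvPolynomial.map C q : MvPolynomial τ (MvPolynomial γ k))
  have hadd (q r) : ev (q + r) = ev q + ev r := by simp [ev]
  have hmul (q r) : ev (q * r) = ev q * ev r := by simp [ev]
  have hX (l) : ev (X l) = ξ l := by simp [ev]
  have hC (a : k) : ev (C a) = algebraMap (MvPolynomial γ k) Ω (C a) := by simp [ev]
  -- the chain rule, for polynomials with constant coefficients
  have key (q : MvPolynomial τ k) :
      (ψ (ev q)).snd = ∑ l, ev (pderiv l q) * (ψ (ξ l)).snd := by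
    induction q using MvPolynomial.induction_on with
    | C a => simp [hC, hψ', ev]
    | add p q hp hq => simp only [hadd, map_add, TrivSqZeroExt.snd_add, hp, hq, add_mul,
        Finset.sum_add_distrib]
    | mul_X p l hp =>
      rw [hmul, map_mul, TrivSqZeroExt.snd_mul, hp, hψ, hX, hψ]
      simp only [Derivation.leibniz, smul_eq_mul, hadd, hmul, hX, add_mul, Finset.sum_add_distrib,
        pderiv_X, Pi.single_apply]
      have : ∀ l', ev (if l = l' then 1 else 0) = if l = l' then 1 else 0 := by
        intro l'; split_ifs <;> simp [ev]
      simp only [this, ite_mul, mul_ite, mul_one, mul_zero, zero_mul, Finset.sum_ite_eq,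
        Finset.mem_univ, if_true]
      rw [op_smul_eq_smul, smul_eq_mul, Finset.mul_sum]
      congr 1
      exact Finset.sum_congr rfl fun x _ ↦ by ring
  have hgen (q : γ → MvPolynomial τ k) : aeval ξ (genericMember q) =
      ∑ c, algebraMap (MvPolynomial γ k) Ω (X c) * ev (q c) := by
    simp [genericMember, ev]
  rw [hgen] at h0
  have h2 := congrArg (fun x ↦ (ψ x).snd) h0
  simp only [map_sum, map_mul, TrivSqZeroExt.snd_sum, TrivSqZeroExt.snd_mul, hψ, hψ', key, map_zero,
    TrivSqZeroExt.snd_zero, Finset.sum_add_distrib] at h2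
  have h3 : ∑ c, algebraMap (MvPolynomial γ k) Ω (X c) •
      ∑ l, ev (pderiv l (f c)) * (ψ (ξ l)).snd = 0 := by
    simp only [smul_eq_mul, Finset.mul_sum]
    rw [Finset.sum_comm]
    refine Finset.sum_eq_zero fun l _ ↦ ?_
    have := h1 l
    rw [hgen] at this
    simp_rw [← mul_assoc]
    rw [← Finset.sum_mul, this, zero_mul]
  rw [h3, zero_add] at h2
  simpa [pderiv_X, Pi.single_apply, apply_ite] using h2

/-- Bertini's theorem: in characteristic zero, the singular points of a general member of a linear
system are base points. -/
theorem exists_forall_singular [CharZero k] {γ τ : Type*} [Fintype γ] [Fintype τ]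
    (f : γ → MvPolynomial τ k) :
    ∃ g : MvPolynomial γ k, g ≠ 0 ∧ ∀ t : γ → k, eval t g ≠ 0 → ∀ w : τ → k,
      eval w (∑ c, C (t c) * f c) = 0 → (∀ l, eval w (pderiv l (∑ c, C (t c) * f c)) = 0) →
        ∀ c, eval w (f c) = 0 := by
  classical
  let A := MvPolynomial γ k
  let K := FractionRing A
  let Ω := AlgebraicClosure K
  have : CharZero A := charZero_of_injective_algebraMap (C_injective γ k)
  let S : Set (MvPolynomial τ A) :=
    insert (genericMember f) (Set.range fun l ↦ genericMember fun c ↦ pderiv l (f c))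
  have h (c : γ) := exists_C_mul_pow_mem_span K Ω S (MvPolynomial.map C (f c)) fun ξ hξ ↦
    aeval_eq_zero_of_singular K Ω f ξ (hξ _ (Set.mem_insert _ _))
      (fun l ↦ hξ _ (Set.mem_insert_of_mem _ ⟨l, rfl⟩)) c
  choose g hg n hn using h
  refine ⟨∏ c, g c, Finset.prod_ne_zero_iff.mpr fun c _ ↦ hg c, fun t ht w h0 h1 c ↦ ?_⟩
  rw [map_prod, Finset.prod_ne_zero_iff] at ht
  have hle : Ideal.span S ≤ RingHom.ker ((eval w).comp (MvPolynomial.map (eval t))) := by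
    rw [Ideal.span_le]
    rintro _ (rfl | ⟨l, rfl⟩)
    · rw [SetLike.mem_coe, RingHom.mem_ker, RingHom.comp_apply, map_eval_genericMember, h0]
    · rw [SetLike.mem_coe, RingHom.mem_ker, RingHom.comp_apply, map_eval_genericMember, ← h1 l]
      simp
  have h2 : (eval t).comp (C : k →+* MvPolynomial γ k) = RingHom.id k := by ext; simp
  have := hle (hn c)
  simp only [RingHom.mem_ker, RingHom.comp_apply, map_mul, map_pow, MvPolynomial.map_map, h2,
    MvPolynomial.map_C, eval_C, mul_eq_zero] at this
  have h3 := this.resolve_left (ht c (Finset.mem_univ c))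
  simpa [MvPolynomial.map_id] using eq_zero_of_pow_eq_zero h3

/-! ### Irreducibility of a general member -/

lemma emultiplicity_X_pow_mul {σ L : Type*} [Field L] {x : σ} {w : σ → L} (hw : w x = 0) (m : ℕ)
    {q : MvPolynomial σ L} (hq : eval w q ≠ 0) :
    emultiplicity (X x : MvPolynomial σ L) (X x ^ m * q) = m := by
  have h : ¬ (X x : MvPolynomial σ L) ∣ q := by
    rintro ⟨r, rfl⟩
    simp [hw] at hq
  have hX : Prime (X x : MvPolynomial σ L) := X_prime
  rw [emultiplicity_mul hX, emultiplicity_eq_zero.mpr h, add_zero,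
    emultiplicity_pow_self hX.ne_zero hX.not_isUnit]

lemma totalDegree_finsetProd_of_isDomain {σ ι L : Type*} [Field L] (s : Finset ι)
    (f : ι → MvPolynomial σ L) (hf : ∀ i ∈ s, f i ≠ 0) :
    (∏ i ∈ s, f i).totalDegree = ∑ i ∈ s, (f i).totalDegree := by
  classical
  induction s using Finset.induction_on with
  | empty => simp
  | insert a s ha ih =>
    rw [Finset.prod_insert ha, Finset.sum_insert ha, totalDegree_mul_of_isDomain
      (hf a (Finset.mem_insert_self a s))
      (Finset.prod_ne_zero_iff.mpr fun i hi ↦ hf i (Finset.mem_insert_of_mem hi)),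
      ih fun i hi ↦ hf i (Finset.mem_insert_of_mem hi)]

lemma totalDegree_map_of_field {σ K L : Type*} [Field K] [Field L] (φ : K →+* L)
    (f : MvPolynomial σ K) : (MvPolynomial.map φ f).totalDegree = f.totalDegree := by
  simp only [totalDegree, support_map_of_injective f φ.injective]

lemma exists_map_eq_of_forall_map_eq {σ K L : Type*} [Field K] [Field L] [Algebra K L]
    [FiniteDimensional K L] [IsGalois K L] {f : MvPolynomial σ L}
    (h : ∀ g : L ≃ₐ[K] L, MvPolynomial.map (g : L →+* L) f = f) :
    ∃ r : MvPolynomial σ K, MvPolynomial.map (algebraMap K L) r = f := by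
  refine RingHom.mem_range.mp (mem_range_map_iff_coeffs_subset.mpr ?_)
  intro c hc
  obtain ⟨α, -, rfl⟩ := mem_coeffs_iff.mp hc
  refine (IsGalois.mem_range_algebraMap_iff_fixed (F := K) _).mpr fun g ↦ ?_
  conv_rhs => rw [← h g, coeff_map]
  rfl

/-- The multiplicities along the exceptional divisors over two rational points, as invariants of
a factor over a Galois extension. -/
lemma card_mul_emultiplicity_eq {σ τ K L : Type*} [Field K] [Field L] [Algebra K L]
    [FiniteDimensional K L] [IsGalois K L] {F : MvPolynomial τ K} {P : MvPolynomial τ L} {s m : ℕ}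
    (hs : Associated (∏ g : L ≃ₐ[K] L, MvPolynomial.map (g : L →+* L) P)
      (MvPolynomial.map (algebraMap K L) F ^ s))
    (a : τ → MvPolynomial σ K) (x : σ) {F' : MvPolynomial σ K} (hF : eval₂Hom C a F = X x ^ m * F')
    {w : σ → K} (hw : w x = 0) (hF' : eval w F' ≠ 0) :
    (Nat.card (L ≃ₐ[K] L) : ℕ∞) * emultiplicity (X x : MvPolynomial σ L)
      (eval₂Hom C (fun i ↦ MvPolynomial.map (algebraMap K L) (a i)) P) = s * m := by
  let β := eval₂Hom (C : L →+* MvPolynomial σ L) (fun i ↦ MvPolynomial.map (algebraMap K L) (a i))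
  have hX : Prime (X x : MvPolynomial σ L) := X_prime
  have hβ (p : MvPolynomial τ K) : β (MvPolynomial.map (algebraMap K L) p) =
      MvPolynomial.map (algebraMap K L) (eval₂Hom C a p) := by
    have : β.comp (MvPolynomial.map (algebraMap K L)) =
        (MvPolynomial.map (algebraMap K L)).comp (eval₂Hom C a) := by
      apply MvPolynomial.ringHom_ext <;> intro <;> simp [β]
    exact DFunLike.congr_fun this p
  have h1 (g : L ≃ₐ[K] L) : emultiplicity (X x : MvPolynomial σ L)
      (β (MvPolynomial.map (g : L →+* L) P)) = emultiplicity (X x : MvPolynomial σ L) (β P) := by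
    have h2 : β (MvPolynomial.map (g : L →+* L) P) =
        MvPolynomial.mapEquiv σ g.toRingEquiv (β P) := by
      have : β.comp (MvPolynomial.map (g : L →+* L)) =
          ((MvPolynomial.mapEquiv σ g.toRingEquiv : _ ≃+* _) : _ →+* _).comp β := by
        apply MvPolynomial.ringHom_ext
        · intro; simp [β]
        · intro i
          have : (g : L →+* L).comp (algebraMap K L) = algebraMap K L := by ext; simp
          simp only [β, RingHom.comp_apply, MvPolynomial.map_X, coe_eval₂Hom, eval₂_X]
          refine Eq.trans ?_ (MvPolynomial.map_map (algebraMap K L) (g : L →+* L) (a i)).symm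
          rw [this]
      exact DFunLike.congr_fun this P
    have h3 : MvPolynomial.mapEquiv σ g.toRingEquiv (X x : MvPolynomial σ L) = X x := by simp
    rw [h2]
    nth_rw 1 [← h3]
    exact emultiplicity_map_eq _
  have h4 := emultiplicity_eq_of_associated_right (a := (X x : MvPolynomial σ L)) (hs.map β)
  rw [map_prod, map_pow, Finset.emultiplicity_prod hX, emultiplicity_pow hX, hβ, hF, map_mul,
    map_pow, MvPolynomial.map_X, emultiplicity_X_pow_mul (w := fun i ↦ algebraMap K L (w i))
      (by simp [hw])] at h4
  · simp only [h1, Finset.sum_const, Finset.card_univ, nsmul_eq_mul] at h4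
    rw [Nat.card_eq_fintype_card, h4]
  · have := MvPolynomial.eval₂_comp_left (algebraMap K L) (RingHom.id K) w F'
    rw [RingHom.comp_id] at this
    rw [MvPolynomial.eval_map]
    refine fun h ↦ hF' ((map_eq_zero (algebraMap K L)).mp (this.trans h))

/-- A form which is irreducible over `K` and has multiplicities `m` and `m + 1` at two rational
points stays irreducible over every finite Galois extension: if `P` is a factor, then the norm of
`P` is a power of `F`, so that the degree and the multiplicities of `P` are proportional to those
of `F`. -/
lemma totalDegree_eq_zero_or_of_isGalois {σ τ K L : Type*} [Field K] [Field L] [Algebra K L]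
    [FiniteDimensional K L] [IsGalois K L] {F : MvPolynomial τ K} (hFp : Prime F) {m : ℕ}
    {a b : τ → MvPolynomial σ K} {x : σ} {Fa Fb : MvPolynomial σ K}
    (ha : eval₂Hom C a F = X x ^ m * Fa) (hb : eval₂Hom C b F = X x ^ (m + 1) * Fb)
    {wa wb : σ → K} (hwa : wa x = 0) (hwb : wb x = 0) (hFa : eval wa Fa ≠ 0) (hFb : eval wb Fb ≠ 0)
    {P Q : MvPolynomial τ L} (hPQ : P * Q = MvPolynomial.map (algebraMap K L) F) :
    P.totalDegree = 0 ∨ Q.totalDegree = 0 := by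
  -- the norm
  let N (p : MvPolynomial τ L) := ∏ g : L ≃ₐ[K] L, MvPolynomial.map (g : L →+* L) p
  have hinj := MvPolynomial.map_injective (σ := τ) _ (algebraMap K L).injective
  have hF0 : MvPolynomial.map (algebraMap K L) F ≠ 0 :=
    (map_ne_zero_iff _ hinj).mpr hFp.ne_zero
  have hP0 : P ≠ 0 := by rintro rfl; exact hF0 (by rw [← hPQ, zero_mul])
  have hQ0 : Q ≠ 0 := by rintro rfl; exact hF0 (by rw [← hPQ, mul_zero])
  have hN (p) : ∃ r : MvPolynomial τ K, MvPolynomial.map (algebraMap K L) r = N p := by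
    refine exists_map_eq_of_forall_map_eq fun g ↦ ?_
    simp only [N, map_prod, MvPolynomial.map_map]
    exact Fintype.prod_equiv (Equiv.mulLeft g) _ _ fun g' ↦ rfl
  obtain ⟨r, hr⟩ := hN P
  obtain ⟨r', hr'⟩ := hN Q
  have hmul : r * r' = F ^ Nat.card (L ≃ₐ[K] L) := by
    refine hinj ?_
    rw [map_mul, hr, hr', ← Finset.prod_mul_distrib, map_pow]
    simp only [← map_mul, hPQ, MvPolynomial.map_map]
    have (g : L ≃ₐ[K] L) : (g : L →+* L).comp (algebraMap K L) = algebraMap K L := by ext; simp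
    simp [this, Nat.card_eq_fintype_card]
  obtain ⟨s, -, hs⟩ := (dvd_prime_pow hFp _).mp (Dvd.intro _ hmul)
  have hs' : Associated (N P) (MvPolynomial.map (algebraMap K L) F ^ s) := by
    rw [← hr, ← map_pow]
    exact hs.map _
  have hdeg : Nat.card (L ≃ₐ[K] L) * P.totalDegree = s * F.totalDegree := by
    obtain ⟨v, hv⟩ := hs'
    have hv0 : (v : MvPolynomial τ L).totalDegree = 0 :=
      (isUnit_iff_totalDegree_of_isReduced.mp v.isUnit).2
    have h0 (g : L ≃ₐ[K] L) : MvPolynomial.map (g : L →+* L) P ≠ 0 :=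
      (map_ne_zero_iff _ (MvPolynomial.map_injective _ (g : L →+* L).injective)).mpr hP0
    have := congrArg totalDegree hv
    rw [totalDegree_mul_of_isDomain (Finset.prod_ne_zero_iff.mpr fun g _ ↦ h0 g) v.ne_zero, hv0,
      totalDegree_finsetProd_of_isDomain _ _ (fun g _ ↦ h0 g), ← Finset.card_range s,
      ← Finset.prod_const,
      totalDegree_finsetProd_of_isDomain _ _ (fun _ _ ↦ hF0)] at this
    simpa [totalDegree_map_of_field, Nat.card_eq_fintype_card] using this
  have hPa := card_mul_emultiplicity_eq hs' a x ha hwa hFa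
  have hPb := card_mul_emultiplicity_eq hs' b x hb hwb hFb
  have hcard : 0 < Nat.card (L ≃ₐ[K] L) := Nat.card_pos
  have hfin {e : ℕ∞} {m : ℕ} (h : (Nat.card (L ≃ₐ[K] L) : ℕ∞) * e = s * m) :
      ∃ n : ℕ, Nat.card (L ≃ₐ[K] L) * n = s * m := by
    induction e with
    | top =>
      rw [ENat.mul_top (by exact_mod_cast hcard.ne')] at h
      exact absurd h.symm (by exact_mod_cast ENat.natCast_ne_top (s * m))
    | coe n => exact ⟨n, by exact_mod_cast h⟩
  obtain ⟨na, hna⟩ := hfin hPa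
  obtain ⟨nb, hnb⟩ := hfin hPb
  have hdeg' : P.totalDegree + Q.totalDegree = F.totalDegree := by
    rw [← totalDegree_mul_of_isDomain hP0 hQ0, hPQ, totalDegree_map_of_field]
  -- the difference of the two multiplicities shows that the order of the group divides `s`
  have h1 : Nat.card (L ≃ₐ[K] L) * nb = Nat.card (L ≃ₐ[K] L) * na + s := by rw [hnb, hna]; ring
  obtain ⟨e, rfl⟩ : ∃ e, nb = na + e := Nat.exists_eq_add_of_le
    (Nat.le_of_mul_le_mul_left (by lia) hcard)
  have h2 : s = Nat.card (L ≃ₐ[K] L) * e := by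
    rw [mul_add] at h1
    lia
  have h3 : P.totalDegree = e * F.totalDegree := by
    refine Nat.eq_of_mul_eq_mul_left hcard ?_
    rw [hdeg, h2, mul_assoc]
  match e with
  | 0 => left; simpa using h3
  | 1 => right; lia
  | e + 2 => left; nlinarith

/-- Two factors over an algebraic closure are defined over a finite Galois extension. -/
lemma totalDegree_eq_zero_or_of_isAlgClosure {σ τ K Ω : Type*} [Field K] [Field Ω] [Algebra K Ω]
    [CharZero K] [IsAlgClosure K Ω] {F : MvPolynomial τ K} (hFp : Prime F) {m : ℕ}
    {a b : τ → MvPolynomial σ K} {x : σ} {Fa Fb : MvPolynomial σ K}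
    (ha : eval₂Hom C a F = X x ^ m * Fa) (hb : eval₂Hom C b F = X x ^ (m + 1) * Fb)
    {wa wb : σ → K} (hwa : wa x = 0) (hwb : wb x = 0) (hFa : eval wa Fa ≠ 0) (hFb : eval wb Fb ≠ 0)
    {P Q : MvPolynomial τ Ω} (hPQ : P * Q = MvPolynomial.map (algebraMap K Ω) F) :
    P.totalDegree = 0 ∨ Q.totalDegree = 0 := by
  classical
  have : IsGalois K Ω := IsAlgClosure.isGalois K Ω
  let s : Set Ω := (P.coeffs ∪ Q.coeffs : Finset Ω)
  let L := FiniteGaloisIntermediateField.adjoin K s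
  have hL : s ⊆ (L.toIntermediateField : Set Ω) := FiniteGaloisIntermediateField.subset_adjoin K s
  have hlift (p : MvPolynomial τ Ω) (hp : (p.coeffs : Set Ω) ⊆ s) :
      ∃ r : MvPolynomial τ L, MvPolynomial.map (algebraMap L Ω) r = p := by
    refine RingHom.mem_range.mp (mem_range_map_iff_coeffs_subset.mpr fun c hc ↦ ?_)
    exact ⟨⟨c, hL (hp hc)⟩, rfl⟩
  obtain ⟨P', hP'⟩ := hlift P (by simp [s])
  obtain ⟨Q', hQ'⟩ := hlift Q (by simp [s])
  have h := totalDegree_eq_zero_or_of_isGalois (L := L) hFp ha hb hwa hwb hFa hFb (P := P')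
    (Q := Q') (by
      refine MvPolynomial.map_injective _ (algebraMap L Ω).injective ?_
      rw [map_mul, hP', hQ', hPQ, MvPolynomial.map_map, ← IsScalarTower.algebraMap_eq])
  rw [← hP', ← hQ', totalDegree_map_of_field, totalDegree_map_of_field]
  exact h

lemma map_genericMember {γ τ R : Type*} [Fintype γ] [CommRing R] (f : γ → MvPolynomial τ k)
    (φ : MvPolynomial γ k →+* R) : MvPolynomial.map φ (genericMember f) =
      ∑ c, C (φ (X c)) * MvPolynomial.map (φ.comp C) (f c) := by
  simp [genericMember, MvPolynomial.map_map]

lemma isHomogeneous_genericMember {γ τ : Type*} [Fintype γ] {f : γ → MvPolynomial τ k} {d : ℕ}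
    (hf : ∀ c, (f c).IsHomogeneous d) : (genericMember f).IsHomogeneous d :=
  IsHomogeneous.sum _ _ _ fun c _ ↦ by
    simpa using (isHomogeneous_C τ (X c : MvPolynomial γ k)).mul ((hf c).map C)

lemma genericMember_ne_zero {γ τ : Type*} [Fintype γ] {f : γ → MvPolynomial τ k} {c : γ}
    (hc : f c ≠ 0) : genericMember f ≠ 0 := by
  classical
  intro h
  have := map_eval_genericMember f (Pi.single c 1)
  rw [h, map_zero, Finset.sum_eq_single c (fun c' _ h ↦ by simp [h]) (by simp)] at this
  simp at this
  exact hc this.symm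

/-- The generic member of a linear system without fixed components is irreducible, because it is
linear in the parameters. -/
lemma prime_genericMember {γ τ : Type*} [Fintype γ] {f : γ → MvPolynomial τ k}
    (hf : ∃ c, f c ≠ 0) (hgcd : ∀ r, (∀ c, r ∣ f c) → IsUnit r) : Prime (genericMember f) := by
  let e := MvPolynomial.commAlgEquiv k τ γ
  have h : e (genericMember f) = sumSMulX (Finsupp.equivFunOnFinite.symm f) := by
    rw [sumSMulX, Finsupp.linearCombination_apply, Finsupp.sum_fintype _ _ (by simp)]
    simp only [genericMember, map_sum, map_mul, e]
    refine Finset.sum_congr rfl fun c _ ↦ ?_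
    rw [MvPolynomial.commAlgEquiv_C_X, MvPolynomial.smul_eq_C_mul, mul_comm]
    congr 1
    have : (e.toRingEquiv.toRingHom).comp (MvPolynomial.map C) = C := by
      apply MvPolynomial.ringHom_ext <;> intro <;> simp [e]
    exact DFunLike.congr_fun this (f c)
  refine (MulEquiv.prime_iff e.toMulEquiv).mp ?_
  change Prime (e (genericMember f))
  rw [h]
  refine (irreducible_sumSMulX _ ?_ fun r hr ↦ hgcd r fun c ↦ by simpa using hr c).prime
  obtain ⟨c, hc⟩ := hf
  exact ⟨c, by simpa using hc⟩

attribute [local instance] MvPolynomial.algebraMvPolynomial in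
/-- Gauss's lemma for the generic member, which has no factor of degree zero in `τ`, being
homogeneous of positive degree. -/
lemma prime_map_genericMember {γ τ : Type*} [Fintype γ] (K : Type*) [Field K]
    [Algebra (MvPolynomial γ k) K] [IsFractionRing (MvPolynomial γ k) K]
    {f : γ → MvPolynomial τ k} {d : ℕ} (hd : 0 < d) (hfd : ∀ c, (f c).IsHomogeneous d)
    (hf : ∃ c, f c ≠ 0) (hgcd : ∀ r, (∀ c, r ∣ f c) → IsUnit r) :
    Prime (MvPolynomial.map (algebraMap (MvPolynomial γ k) K) (genericMember f)) := by
  let A := MvPolynomial γ k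
  have hF := prime_genericMember hf hgcd
  have hloc : IsLocalization (A⁰.map (C (σ := τ))) (MvPolynomial τ K) :=
    MvPolynomial.isLocalization A⁰ K
  have h1 := IsLocalization.isPrime_of_isPrime_disjoint (A⁰.map (C (σ := τ))) (MvPolynomial τ K)
    (Ideal.span {genericMember f}) ((Ideal.span_singleton_prime hF.ne_zero).mpr hF) (by
      rw [Set.disjoint_left]
      rintro _ ⟨a, ha, rfl⟩ h
      obtain ⟨q, hq⟩ := Ideal.mem_span_singleton.mp h
      have ha0 : (C a : MvPolynomial τ A) ≠ 0 := by simpa using nonZeroDivisors.ne_zero ha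
      have hq0 : q ≠ 0 := by rintro rfl; exact ha0 (by rw [hq, mul_zero])
      have := congrArg totalDegree hq
      rw [totalDegree_C, totalDegree_mul_of_isDomain hF.ne_zero hq0,
        (isHomogeneous_genericMember hfd).totalDegree hF.ne_zero] at this
      lia)
  rw [Ideal.map_span, Set.image_singleton] at h1
  refine (Ideal.span_singleton_prime ?_).mp h1
  exact (map_ne_zero_iff _ (MvPolynomial.map_injective _ (IsFractionRing.injective A K))).mpr
    hF.ne_zero

/-- A general member of a linear system of forms without fixed components is irreducible, if the
multiplicities at two points are `m` and `m + 1`. -/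
theorem exists_forall_irreducible [CharZero k] {γ τ σ : Type*} [Fintype γ] [Finite τ]
    {f : γ → MvPolynomial τ k} {d : ℕ} (hd : 0 < d) (hfd : ∀ c, (f c).IsHomogeneous d)
    (hgcd : ∀ r, (∀ c, r ∣ f c) → IsUnit r) {m : ℕ} {a b : τ → MvPolynomial σ k} {x : σ}
    {fa fb : γ → MvPolynomial σ k} (ha : ∀ c, eval₂Hom C a (f c) = X x ^ m * fa c)
    (hb : ∀ c, eval₂Hom C b (f c) = X x ^ (m + 1) * fb c) {wa wb : σ → k} (hwa : wa x = 0)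
    (hwb : wb x = 0) (hfa : ∃ c, eval wa (fa c) ≠ 0) (hfb : ∃ c, eval wb (fb c) ≠ 0) :
    ∃ g : MvPolynomial γ k, g ≠ 0 ∧ ∀ t : γ → k, eval t g ≠ 0 →
      Irreducible (∑ c, C (t c) * f c) := by
  classical
  let A := MvPolynomial γ k
  let K := FractionRing A
  let Ω := AlgebraicClosure K
  have : CharZero A := charZero_of_injective_algebraMap (C_injective γ k)
  have hf : ∃ c, f c ≠ 0 := by
    obtain ⟨c, hc⟩ := hfa
    refine ⟨c, fun h ↦ hc ?_⟩
    have := ha c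
    rw [h, map_zero, eq_comm, mul_eq_zero] at this
    simp [this.resolve_left (pow_ne_zero _ (X_ne_zero x))]
  have hprime := prime_map_genericMember K hd hfd hf hgcd
  have hinjK : Function.Injective (algebraMap A K) := IsFractionRing.injective A K
  let φ : k →+* K := (algebraMap A K).comp C
  let FK := MvPolynomial.map (algebraMap A K) (genericMember f)
  have hpull (a : τ → MvPolynomial σ k) (m : ℕ) (fa : γ → MvPolynomial σ k)
      (ha : ∀ c, eval₂Hom C a (f c) = X x ^ m * fa c) :
      eval₂Hom C (fun i ↦ MvPolynomial.map φ (a i)) FK =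
        X x ^ m * MvPolynomial.map (algebraMap A K) (genericMember fa) := by
    have h1 (p : MvPolynomial τ k) : eval₂Hom C (fun i ↦ MvPolynomial.map φ (a i))
        (MvPolynomial.map φ p) = MvPolynomial.map φ (eval₂Hom C a p) := by
      have : (eval₂Hom C (fun i ↦ MvPolynomial.map φ (a i))).comp (MvPolynomial.map φ) =
          (MvPolynomial.map φ).comp (eval₂Hom C a) := by
        apply MvPolynomial.ringHom_ext <;> intro <;> simp
      exact DFunLike.congr_fun this p
    simp only [FK]
    rw [map_genericMember, map_genericMember, map_sum, Finset.mul_sum]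
    refine Finset.sum_congr rfl fun c _ ↦ ?_
    rw [map_mul, h1, ha c]
    simp
    ring
  have heval (fa : γ → MvPolynomial σ k) (w : σ → k) (h : ∃ c, eval w (fa c) ≠ 0) :
      eval (fun i ↦ φ (w i)) (MvPolynomial.map (algebraMap A K) (genericMember fa)) ≠ 0 := by
    have h1 : eval (fun i ↦ φ (w i)) (MvPolynomial.map (algebraMap A K) (genericMember fa)) =
        algebraMap A K (∑ c, X c * C (eval w (fa c))) := by
      have h2 (p : MvPolynomial σ k) : eval (fun i ↦ φ (w i)) (MvPolynomial.map φ p) =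
          φ (eval w p) := by
        have := MvPolynomial.eval₂_comp_left φ (RingHom.id k) w p
        rw [RingHom.comp_id] at this
        rw [MvPolynomial.eval_map]
        exact this.symm
      rw [map_genericMember, map_sum, map_sum]
      refine Finset.sum_congr rfl fun c _ ↦ ?_
      rw [map_mul, h2, map_mul, eval_C]
      rfl
    rw [h1]
    refine (map_ne_zero_iff _ hinjK).mpr fun h3 ↦ ?_
    obtain ⟨c, hc⟩ := h
    refine hc ?_
    have := congrArg (eval (Pi.single c 1)) h3
    rw [map_sum, Finset.sum_eq_single c (fun c' _ h ↦ by simp [h]) (by simp)] at this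
    simpa using this
  have habs {P Q : MvPolynomial τ Ω} (hPQ : P * Q = MvPolynomial.map (algebraMap K Ω) FK) :
      P.totalDegree = 0 ∨ Q.totalDegree = 0 :=
    totalDegree_eq_zero_or_of_isAlgClosure hprime (hpull a m fa ha) (hpull b (m + 1) fb hb)
      (wa := fun i ↦ φ (wa i)) (wb := fun i ↦ φ (wb i)) (by simp [hwa]) (by simp [hwb])
      (heval fa wa hfa) (heval fb wb hfb) hPQ
  -- `P` and `Q` are polynomials of degree less than `d` with unknown coefficients; the equations
  -- `S` for a factorization have no solution over `Ω`
  have hTfin : {α : τ →₀ ℕ | α.degree < d}.Finite := by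
    have := Fintype.ofFinite τ
    refine (Set.finite_Iic (Finsupp.equivFunOnFinite.symm fun _ : τ ↦ d)).subset fun α hα i ↦ ?_
    exact (Finsupp.le_degree i α).trans (le_of_lt hα)
  let T := hTfin.toFinset
  have hT (α) : α ∈ T ↔ α.degree < d := by simp [T]
  let U := T ⊕ T
  let P : MvPolynomial τ (MvPolynomial U A) := ∑ α : T, monomial α.1 (X (.inl α))
  let Q : MvPolynomial τ (MvPolynomial U A) := ∑ α : T, monomial α.1 (X (.inr α))
  let S : Set (MvPolynomial U A) :=
    Set.range fun β ↦ coeff β (P * Q - MvPolynomial.map C (genericMember f))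
  have hdegT {R : Type _} [CommRing R] (v : T → R) :
      (∑ α : T, monomial α.1 (v α)).totalDegree < d := by
    refine (totalDegree_finsetSum_le (d := d - 1) fun α _ ↦ ?_).trans_lt (by lia)
    refine (totalDegree_monomial_le _ _).trans ?_
    have := (hT α.1).mp α.2
    rw [Finsupp.degree_apply] at this
    exact Nat.le_sub_one_of_lt this
  obtain ⟨g, hg, n, hn⟩ := exists_C_mul_pow_mem_span K Ω S 1 fun ξ hξ ↦ by
    exfalso
    let ψ : MvPolynomial U A →+* Ω := (aeval ξ : MvPolynomial U A →ₐ[A] Ω)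
    have hψ : ψ.comp C = algebraMap A Ω := (aeval ξ).comp_algebraMap
    have hPQ : MvPolynomial.map ψ P * MvPolynomial.map ψ Q =
        MvPolynomial.map (algebraMap K Ω) FK := by
      rw [← sub_eq_zero, MvPolynomial.map_map, ← IsScalarTower.algebraMap_eq A K Ω, ← hψ,
        ← MvPolynomial.map_map, ← map_mul, ← map_sub]
      ext β
      rw [coeff_map, coeff_zero]
      exact hξ _ ⟨β, rfl⟩
    have hF0 : MvPolynomial.map (algebraMap K Ω) FK ≠ 0 :=
      (map_ne_zero_iff _ (MvPolynomial.map_injective _ (algebraMap K Ω).injective)).mpr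
        hprime.ne_zero
    have hdegF : (MvPolynomial.map (algebraMap K Ω) FK).totalDegree = d :=
      (((isHomogeneous_genericMember hfd).map _).map _).totalDegree hF0
    have hP : (MvPolynomial.map ψ P).totalDegree < d := by
      simpa only [P, map_sum, map_monomial] using hdegT fun α ↦ ψ (X (.inl α))
    have hQ : (MvPolynomial.map ψ Q).totalDegree < d := by
      simpa only [Q, map_sum, map_monomial] using hdegT fun α ↦ ψ (X (.inr α))
    have h := habs hPQ
    rw [← hPQ] at hF0 hdegF
    rw [totalDegree_mul_of_isDomain (left_ne_zero_of_mul hF0) (right_ne_zero_of_mul hF0)] at hdegF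
    rcases h with h | h <;> omega
  rw [one_pow, mul_one] at hn
  obtain ⟨c₀, hc₀⟩ := hf
  obtain ⟨β₀, hβ₀⟩ := MvPolynomial.ne_zero_iff.mp (genericMember_ne_zero hc₀)
  refine ⟨g * coeff β₀ (genericMember f), mul_ne_zero hg hβ₀, fun t ht ↦ ?_⟩
  rw [map_mul, mul_ne_zero_iff] at ht
  set F := ∑ c, C (t c) * f c with hFdef
  have hFt : F = MvPolynomial.map (eval t) (genericMember f) := (map_eval_genericMember f t).symm
  have hF0 : F ≠ 0 := by
    intro h
    refine ht.2 ?_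
    rw [← coeff_map, ← hFt, h, coeff_zero]
  have hFd : F.totalDegree = d := by
    rw [hFt] at hF0 ⊢
    exact ((isHomogeneous_genericMember hfd).map _).totalDegree hF0
  have hunit {p : MvPolynomial τ k} (hp : p ≠ 0) (h : ¬ IsUnit p) : 0 < p.totalDegree := by
    by_contra h0
    have h1 := totalDegree_eq_zero_iff_eq_C.mp (Nat.eq_zero_of_not_pos h0)
    rw [h1] at h hp
    exact h (IsUnit.map C (isUnit_iff_ne_zero.mpr (by simpa using hp)))
  refine ⟨fun h ↦ hd.ne' (hFd ▸ (isUnit_iff_totalDegree_of_isReduced.mp h).2), fun {p q} hpq ↦ ?_⟩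
  by_contra! hcon
  have hpq0 := hpq ▸ hF0
  have hp0 := left_ne_zero_of_mul hpq0
  have hq0 := right_ne_zero_of_mul hpq0
  have hdeg : p.totalDegree + q.totalDegree = d := by
    rw [← totalDegree_mul_of_isDomain hp0 hq0, ← hpq, hFd]
  have hpd := hunit hp0 hcon.1
  have hqd := hunit hq0 hcon.2
  have hsum (p : MvPolynomial τ k) (hp : p.totalDegree < d) :
      ∑ α : T, monomial α.1 (coeff α.1 p) = p := by
    rw [Finset.sum_coe_sort T fun α ↦ monomial α (coeff α p)]
    conv_rhs => rw [p.as_sum]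
    refine (Finset.sum_subset (fun α hα ↦ (hT α).mpr ?_) fun α _ hα ↦ by
      simp [notMem_support_iff.mp hα]).symm
    exact (le_totalDegree hα).trans_lt hp
  let θ : MvPolynomial U A →+* k :=
    eval₂Hom (eval t) (Sum.elim (fun α ↦ coeff α.1 p) (fun α ↦ coeff α.1 q))
  have hle : Ideal.span S ≤ RingHom.ker θ := by
    rw [Ideal.span_le]
    rintro _ ⟨β, rfl⟩
    have h1 : θ.comp C = eval t := by ext <;> simp [θ]
    have h2 : MvPolynomial.map θ P = p := by
      rw [← hsum p (by lia)]
      simp [P, θ]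
    have h3 : MvPolynomial.map θ Q = q := by
      rw [← hsum q (by lia)]
      simp [Q, θ]
    rw [SetLike.mem_coe, RingHom.mem_ker, ← coeff_map, map_sub, map_mul, h2, h3,
      MvPolynomial.map_map, h1, ← hFt, ← hpq, sub_self, coeff_zero]
  have := hle hn
  rw [RingHom.mem_ker] at this
  exact ht.1 (by simpa [θ] using this)

/-! ### Smooth connected members of a base point free linear system -/

/-- The forms `f_c` of degree `d` have multiplicity at least `m i` at the point `[z i : 1]`, and
their strict transforms have no common zero on the blow-up of the plane in these points. The latter
is expressed on the complement of the points and on the two charts `(z + (u, uv), 1)` and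
`(z + (uv, u), 1)` around each exceptional divisor `u = 0`. -/
structure IsBasePointFree {n : ℕ} (z : Fin n → Fin 2 → k) (m : Fin n → ℕ) (d : ℕ) {γ : Type*}
    (f : γ → MvPolynomial (Fin 3) k) : Prop where
  isHomogeneous : ∀ c, (f c).IsHomogeneous d
  exists_eq_mul : ∀ ξ : Fin 3 → k, ξ ≠ 0 → (∀ c, eval ξ (f c) = 0) →
    ∃ i, ∀ l : Fin 2, ξ l.castSucc = z i l * ξ 2
  exists_strictTransform : ∀ i l, ∃ f' : γ → MvPolynomial (Fin 2) k,
    (∀ c, eval₂Hom C (excCoord (z i) l) (f c) = X 0 ^ m i * f' c) ∧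
      ∀ w : Fin 2 → k, w 0 = 0 → ∃ c, eval w (f' c) ≠ 0

/-- The lines `x = a` and `y = b` have no common component. -/
lemma not_dvd_of_isPrime_of_dvd {a b : k} {q : MvPolynomial (Fin 3) k} (hq : Prime q)
    (h0 : q ∣ X 0 - C a * X 2) (h1 : q ∣ X 1 - C b * X 2) : False := by
  obtain ⟨s, hs⟩ := h0
  obtain ⟨s', hs'⟩ := h1
  have hL : (X 0 - C a * X 2 : MvPolynomial (Fin 3) k) ≠ 0 := by
    intro h
    simpa using congrArg (eval ![1, 0, 0]) h
  have hs0 : s ≠ 0 := by rintro rfl; exact hL (by rw [hs, mul_zero])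
  have hdeg : q.totalDegree + s.totalDegree ≤ 1 := by
    rw [← totalDegree_mul_of_isDomain hq.ne_zero hs0, ← hs]
    refine (totalDegree_sub _ _).trans (max_le (by simp) ?_)
    refine (totalDegree_mul _ _).trans (by simp)
  have hq0 : q.totalDegree ≠ 0 := by
    intro h
    have h' := totalDegree_eq_zero_iff_eq_C.mp h
    have := hq.ne_zero
    have hu := hq.not_isUnit
    rw [h'] at this hu
    exact hu (IsUnit.map C (isUnit_iff_ne_zero.mpr (by simpa using this)))
  have hs1 := totalDegree_eq_zero_iff_eq_C.mp (show s.totalDegree = 0 by lia)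
  have hc : coeff 0 s ≠ 0 := fun h ↦ hs0 (by rw [hs1, h, C_0])
  have e0 := congrArg (eval ![a, b + 1, 1]) hs
  have e1 := congrArg (eval ![a, b + 1, 1]) hs'
  rw [hs1] at e0
  simp only [map_sub, map_mul, eval_X, eval_C] at e0 e1
  simp [hc] at e0
  simp [e0] at e1

namespace IsBasePointFree

variable {n : ℕ} {z : Fin n → Fin 2 → k} {m : Fin n → ℕ} {d : ℕ} {γ : Type*}
  {f : γ → MvPolynomial (Fin 3) k}

/-- A common factor of the `f c` would vanish on a curve, but their common zeros are finite in
number. -/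
lemma isUnit_of_forall_dvd [IsAlgClosed k] (h : IsBasePointFree z m d f) (i₀ : Fin n)
    (r : MvPolynomial (Fin 3) k) (hr : ∀ c, r ∣ f c) : IsUnit r := by
  classical
  by_contra hu
  have hr0 : r ≠ 0 := by
    rintro rfl
    obtain ⟨f', hf', hw⟩ := h.exists_strictTransform i₀ 0
    obtain ⟨c, hc⟩ := hw 0 rfl
    have := hf' c
    rw [zero_dvd_iff.mp (hr c), map_zero, eq_comm, mul_eq_zero] at this
    exact hc (by simp [this.resolve_left (pow_ne_zero _ (X_ne_zero _))])
  obtain ⟨q, hq, hqr⟩ := WfDvdMonoid.exists_irreducible_factor hu hr0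
  have hqp := hq.prime
  have hzero (ξ : Fin 3 → k) (hξ : eval ξ q = 0) (l : Fin 2) :
      eval ξ (∏ i, (X l.castSucc - C (z i l) * X 2)) = 0 := by
    rw [map_prod, Finset.prod_eq_zero_iff]
    by_cases hξ0 : ξ = 0
    · exact ⟨i₀, Finset.mem_univ _, by simp [hξ0]⟩
    · obtain ⟨i, hi⟩ := h.exists_eq_mul ξ hξ0 fun c ↦ by
        obtain ⟨s, hs⟩ := hqr.trans (hr c)
        rw [hs, map_mul, hξ, zero_mul]
      exact ⟨i, Finset.mem_univ _, by simp [hi l]⟩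
  have hdvd (l : Fin 2) : ∃ i, q ∣ X l.castSucc - C (z i l) * X 2 := by
    have h1 : ∏ i, (X l.castSucc - C (z i l) * X 2) ∈ (Ideal.span {q}).radical := by
      rw [← MvPolynomial.vanishingIdeal_zeroLocus_eq_radical (K := k), mem_vanishingIdeal_iff]
      intro ξ hξ
      have := hξ q (Ideal.subset_span rfl)
      simpa using hzero ξ (by simpa using this) l
    obtain ⟨N, hN⟩ := h1
    obtain ⟨i, -, hi⟩ := (Prime.dvd_finsetProd_iff hqp _).mp
      (hqp.dvd_of_dvd_pow (Ideal.mem_span_singleton.mp hN))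
    exact ⟨i, hi⟩
  obtain ⟨i, hi⟩ := hdvd 0
  obtain ⟨i', hi'⟩ := hdvd 1
  exact not_dvd_of_isPrime_of_dvd hqp hi hi'

end IsBasePointFree

lemma eval_eval₂Hom {σ τ : Type*} (a : τ → MvPolynomial σ k) (w : σ → k) (q : MvPolynomial τ k) :
    eval w (eval₂Hom C a q) = eval (fun i ↦ eval w (a i)) q := by
  have : (eval w).comp (eval₂Hom C a) = eval fun i ↦ eval w (a i) := by
    apply MvPolynomial.ringHom_ext <;> intro <;> simp
  exact DFunLike.congr_fun this q

lemma excCoord_castSucc (z : Fin 2 → k) (l l' : Fin 2) : excCoord z l l'.castSucc =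
    MvPolynomial.C (z l') + X 0 * (if l' = l then 1 else X 1) :=
  Fin.snoc_castSucc (α := fun _ ↦ MvPolynomial (Fin 2) k) _ _ _

lemma excCoord_two (z : Fin 2 → k) (l : Fin 2) : excCoord z l 2 = 1 :=
  Fin.snoc_last (α := fun _ ↦ MvPolynomial (Fin 2) k) _ _

lemma eval_eq_zero_of_mem_minorsIdeal {p : Projectivization k (Fin 3 → k)} (hp : p.rep 2 ≠ 0)
    {a : Fin 3 → MvPolynomial (Fin 2) k} {w : Fin 2 → k}
    (h : ∀ l : Fin 2, eval w (a l.castSucc) = affCoord p l * eval w (a 2))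
    {q : MvPolynomial (Fin 2) k} (hq : q ∈ minorsIdeal MvPolynomial.C a p.rep) : eval w q = 0 := by
  have h' (j : Fin 3) : eval w (a j) = p.rep j / p.rep 2 * eval w (a 2) := by
    induction j using Fin.lastCases with
    | last =>
      change _ = p.rep 2 / p.rep 2 * _
      rw [div_self hp, one_mul]
      rfl
    | cast l => exact h l
  have hle : minorsIdeal MvPolynomial.C a p.rep ≤ RingHom.ker (eval w) := by
    rw [minorsIdeal, Ideal.span_le]
    rintro _ ⟨⟨i, j⟩, rfl⟩
    simp only [SetLike.mem_coe, RingHom.mem_ker, map_sub, map_mul, eval_C, h' i, h' j]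
    ring
  exact hle hq

/-- The strict transform of a general member of a base point free linear system is a smooth
connected curve. Finitely many open conditions on the coefficients are imposed: irreducibility
(`g₁`), smoothness in the standard charts (`g₂`) and in the charts around the exceptional divisors
(`g₃`), and that the multiplicities are not higher than prescribed (`g₄`). -/
theorem IsBasePointFree.exists_mem_linearSystem [IsAlgClosed k] [CharZero k] {n : ℕ}
    {p : Fin n → Projectivization k (Fin 3 → k)} (hp : ∀ i, (p i).rep 2 ≠ 0)
    (hinj : ∀ i i', affCoord (p i) = affCoord (p i') → i = i') {m : Fin n → ℕ} {d : ℕ} (hd : 2 ≤ d)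
    {γ : Type*} [Fintype γ] {f : γ → MvPolynomial (Fin 3) k}
    (h : IsBasePointFree (fun i ↦ affCoord (p i)) m d f) {i₁ i₂ : Fin n} (hm : m i₂ = m i₁ + 1)
    {S : Scheme.{u}} {π : S ⟶ Plane k} (hπ : IsBlowUp π (pointsIdeal p)) :
    ∃ D ∈ linearSystem π p d m, IsSmoothConnectedCurve (π ≫ planeToSpec k) D := by
  classical
  choose f' hf' hw using h.exists_strictTransform
  obtain ⟨g₁, hg₁, hirr⟩ := exists_forall_irreducible (by lia) h.isHomogeneous
    (h.isUnit_of_forall_dvd i₁) (hf' i₁ 0) (fun c ↦ hm ▸ hf' i₂ 0 c) (wa := 0) (wb := 0) rfl rfl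
    (hw i₁ 0 0 rfl) (hw i₂ 0 0 rfl)
  choose g₂ hg₂ hstd using fun j ↦
    exists_forall_singular fun c ↦ (Chart.std k n j).pull (f c)
  choose g₃ hg₃ hexc using fun (il : Fin n × Fin 2) ↦ exists_forall_singular (f' il.1 il.2)
  let g₄ (il : Fin n × Fin 2) : MvPolynomial γ k := ∑ c, X c * C (eval 0 (f' il.1 il.2 c))
  have hg₄ (il) : g₄ il ≠ 0 := by
    intro h0
    obtain ⟨c, hc⟩ := hw il.1 il.2 0 rfl
    have := congrArg (eval (Pi.single c 1)) h0
    simp only [g₄] at this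
    rw [map_sum, Finset.sum_eq_single c (fun c' _ h ↦ by simp [h]) (by simp)] at this
    exact hc (by simpa using this)
  obtain ⟨t, ht⟩ : ∃ t, eval t (g₁ * (∏ j, g₂ j) * ((∏ il, g₃ il) * ∏ il, g₄ il)) ≠ 0 := by
    by_contra! h0
    have hne : g₁ * (∏ j, g₂ j) * ((∏ il, g₃ il) * ∏ il, g₄ il) ≠ 0 :=
      mul_ne_zero (mul_ne_zero hg₁ (Finset.prod_ne_zero_iff.mpr fun j _ ↦ hg₂ j))
        (mul_ne_zero (Finset.prod_ne_zero_iff.mpr fun j _ ↦ hg₃ j)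
          (Finset.prod_ne_zero_iff.mpr fun j _ ↦ hg₄ j))
    exact hne (MvPolynomial.funext fun t ↦ by rw [h0 t, map_zero])
  simp only [map_mul, map_prod, mul_ne_zero_iff, Finset.prod_ne_zero_iff, Finset.mem_univ,
    true_imp_iff] at ht
  obtain ⟨⟨ht₁, ht₂⟩, ht₃, ht₄⟩ := ht
  let F := ∑ c, C (t c) * f c
  have hF : F.IsHomogeneous d := IsHomogeneous.sum _ _ _ fun c _ ↦ by
    simpa using (isHomogeneous_C (Fin 3) (t c)).mul (h.isHomogeneous c)
  have hFp : Prime F := (hirr t ht₁).prime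
  have hpull (ch : Chart k n) : ch.pull F = ∑ c, C (t c) * ch.pull (f c) := by
    simp [F]
  have hch (ch : Chart k n) (hc : (∃ j, ch = Chart.std k n j) ∨ ∃ i l, ch = Chart.exc p i l) :
      ∃ F' M, ch.IsStrictTransform F d F' M ∧ M = ∑ i, Set.indicator ch.Tᶜ m i ∧
        ch.IsSmoothAlong p F' := by
    obtain ⟨j, rfl⟩ | ⟨i, l, rfl⟩ := hc
    · refine ⟨(Chart.std k n j).pull F, 0, ⟨Chart.std_isBirational n j, one_ne_zero, hF, hd, hFp,
        by simp, fun b hb ↦ by simpa [Chart.std] using hb⟩, by simp [Chart.std], fun w h0 h1 ↦ ?_⟩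
      rw [hpull] at h0 h1
      have h2 := hstd j t (ht₂ j) w h0 h1
      obtain ⟨i, hi⟩ := h.exists_eq_mul (fun i ↦ eval w ((Chart.std k n j).a i)) (fun h3 ↦ by
        have := congrFun h3 (Chart.std k n j).j
        simp [(Chart.std k n j).a_j] at this) (fun c ↦ by
          rw [← eval_eval₂Hom]
          exact h2 c)
      exact ⟨i, trivial, fun q hq ↦ eval_eq_zero_of_mem_minorsIdeal (hp i) hi hq⟩
    · let F' := ∑ c, C (t c) * f' i l c
      have hpull' : (Chart.exc p i l).pull F = X 0 ^ m i * F' := by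
        rw [hpull, Finset.mul_sum]
        refine Finset.sum_congr rfl fun c _ ↦ ?_
        rw [mul_left_comm, ← hf' i l c]
        rfl
      have hX : ¬ (X 0 ∣ F') := by
        rintro ⟨s, hs⟩
        refine ht₄ (i, l) ?_
        have := congrArg (eval 0) hs
        simpa [F', g₄] using this
      refine ⟨F', m i, ⟨Chart.exc_isBirational p i l, X_ne_zero _, hF, hd, hFp, hpull',
        fun b hb ↦ ?_⟩, ?_, fun w h0 h1 ↦ ?_⟩
      · obtain ⟨s, hs⟩ := hb
        change X 0 * b = F' * s at hs
        obtain ⟨s', rfl⟩ := (X_prime.dvd_mul.mp (Dvd.intro _ hs)).resolve_left hX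
        rw [mul_left_comm] at hs
        exact ⟨s', mul_left_cancel₀ (X_ne_zero _) hs⟩
      · rw [Finset.sum_eq_single i]
        · simp [Chart.exc]
        · intro i' _ hi'
          simp [Chart.exc, hi']
        · simp
      · have h2 := hexc (i, l) t (ht₃ (i, l)) w h0 h1
        have hw0 : w 0 ≠ 0 := by
          intro h3
          obtain ⟨c, hc⟩ := hw i l w h3
          exact hc (h2 c)
        obtain ⟨i', hi'⟩ := h.exists_eq_mul (fun j ↦ eval w (excCoord (affCoord (p i)) l j))
          (fun h3 ↦ by
            have := congrFun h3 2
            simp [excCoord_two] at this) (fun c ↦ by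
              rw [← eval_eval₂Hom, hf' i l c, map_mul, h2 c, mul_zero])
        refine ⟨i', ?_, fun q hq ↦ eval_eq_zero_of_mem_minorsIdeal (hp i') hi' hq⟩
        rintro rfl
        have := hi' l
        rw [excCoord_castSucc, excCoord_two] at this
        simp [hw0] at this
  obtain ⟨η, hη⟩ := hπ.existsUnique_preimage_curvePoint hp hF hd hFp
  refine ⟨_, closure_mem_linearSystem hp hinj hπ hF hd hFp m (fun ch hc ↦ ?_) hη,
    isSmoothConnectedCurve_closure hp hinj hπ hF hd hFp (fun ch hc ↦ ?_) hη⟩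
  · obtain ⟨F', M, h1, h2, -⟩ := hch ch hc
    exact ⟨F', M, h1, h2⟩
  · obtain ⟨F', M, h1, -, h2⟩ := hch ch hc
    exact ⟨F', M, h1, h2⟩

/-! ### Base point freeness from a surjectivity and a generation statement -/

/-- The expansion of a form at the point `[z : 1]`, in the affine coordinates centred there. -/
def expansion {R : Type*} [CommRing R] (z : Fin 2 → R) :
    MvPolynomial (Fin 3) R →+* MvPolynomial (Fin 2) R :=
  eval₂Hom C (Fin.snoc (α := fun _ ↦ MvPolynomial (Fin 2) R) (fun l ↦ C (z l) + X l) 1)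

section

variable {R : Type*} [CommRing R] (z : Fin 2 → R)

@[simp] lemma expansion_C (r : R) : expansion z (C r) = C r := by simp [expansion]

@[simp] lemma expansion_X_castSucc (l : Fin 2) : expansion z (X l.castSucc) = C (z l) + X l := by
  simp only [expansion, coe_eval₂Hom, eval₂_X]
  exact Fin.snoc_castSucc (α := fun _ ↦ MvPolynomial (Fin 2) R) _ _ _

@[simp] lemma expansion_X_two : expansion z (X 2) = 1 := by
  simp only [expansion, coe_eval₂Hom, eval₂_X]
  exact Fin.snoc_last (α := fun _ ↦ MvPolynomial (Fin 2) R) _ _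

end

/-- A polynomial with nonzero constant coefficient is a unit modulo every power of the maximal ideal
of the origin, by the geometric series. -/
lemma exists_mul_sub_one_mem_pow {σ : Type*} {q : MvPolynomial σ k} (hq : constantCoeff q ≠ 0)
    (N : ℕ) : ∃ r, r * q - 1 ∈ idealOfVars σ k ^ N := by
  set x := 1 - C (constantCoeff q)⁻¹ * q with hx
  have hxm : x ∈ idealOfVars σ k := by
    rw [← pow_one (idealOfVars σ k), mem_pow_idealOfVars_iff']
    intro α hα
    obtain rfl : α = 0 := (Finsupp.degree_eq_zero_iff α).mp (by lia)
    change constantCoeff x = 0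
    simp [hx, hq]
  refine ⟨(∑ i ∈ Finset.range N, x ^ i) * C (constantCoeff q)⁻¹, ?_⟩
  have h1 : C (constantCoeff q)⁻¹ * q = 1 - x := by rw [hx]; ring
  rw [mul_assoc, h1, geom_sum_mul_neg]
  have : 1 - x ^ N - 1 = - x ^ N := by ring
  rw [this]
  exact neg_mem (Ideal.pow_mem_pow hxm N)

/-- A line through `ξ` which avoids finitely many points `[z i : 1]` different from `[ξ]`. The line
is spanned by `ξ` and a point `t`; the line `g i` through `ξ` and `[z i : 1]` has to avoid `t`. -/
lemma exists_linear_form [Infinite k] {n : ℕ} (z : Fin n → Fin 2 → k) {ξ : Fin 3 → k}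
    (h : ∀ i, ∃ l : Fin 2, ξ l.castSucc ≠ z i l * ξ 2) :
    ∃ ℓ : MvPolynomial (Fin 3) k, ℓ.IsHomogeneous 1 ∧ eval ξ ℓ = 0 ∧
      ∀ i, constantCoeff (expansion (z i) ℓ) ≠ 0 := by
  classical
  let g (i : Fin n) : MvPolynomial (Fin 3) k := C (ξ 1 - ξ 2 * z i 1) * X 0 +
    C (ξ 2 * z i 0 - ξ 0) * X 1 + C (ξ 0 * z i 1 - ξ 1 * z i 0) * X 2
  have hg (i) : g i ≠ 0 := by
    intro h0
    have e0 := congrArg (eval ![1, 0, 0]) h0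
    have e1 := congrArg (eval ![0, 1, 0]) h0
    simp [g] at e0 e1
    obtain ⟨l, hl⟩ := h i
    refine hl ?_
    fin_cases l
    · change ξ 0 = z i 0 * ξ 2
      linear_combination -e1
    · change ξ 1 = z i 1 * ξ 2
      linear_combination e0
  obtain ⟨t, ht⟩ : ∃ t, eval t (∏ i, g i) ≠ 0 := by
    by_contra! h0
    have hne : ∏ i, g i ≠ 0 := Finset.prod_ne_zero_iff.mpr fun i _ ↦ hg i
    exact hne (MvPolynomial.funext fun t ↦ by rw [h0 t, map_zero])
  rw [map_prod, Finset.prod_ne_zero_iff] at ht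
  refine ⟨C (t 1 * ξ 2 - t 2 * ξ 1) * X 0 + C (t 2 * ξ 0 - t 0 * ξ 2) * X 1 +
    C (t 0 * ξ 1 - t 1 * ξ 0) * X 2, ?_, ?_, fun i ↦ ?_⟩
  · have (c : k) (j : Fin 3) : (C c * X j).IsHomogeneous 1 := by
      simpa using (isHomogeneous_C (Fin 3) c).mul (isHomogeneous_X k j)
    exact ((this _ _).add (this _ _)).add (this _ _)
  · simp
    ring
  · have h1 := ht i (Finset.mem_univ i)
    have e0 : expansion (z i) (X 0) = C (z i 0) + X 0 := expansion_X_castSucc (z i) 0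
    have e1 : expansion (z i) (X 1) = C (z i 1) + X 1 := expansion_X_castSucc (z i) 1
    convert h1 using 1
    simp [e0, e1, g]
    ring

/-- Multiplication of the affine coordinates by the equation of the exceptional divisor. -/
def blowUpChart (k : Type u) [Field k] (l : Fin 2) :
    MvPolynomial (Fin 2) k →+* MvPolynomial (Fin 2) k :=
  eval₂Hom C fun l' ↦ X 0 * (if l' = l then 1 else X 1)

lemma blowUpChart_expansion (z : Fin 2 → k) (l : Fin 2) (f : MvPolynomial (Fin 3) k) :
    blowUpChart k l (expansion z f) = eval₂Hom C (excCoord z l) f := by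
  have : (blowUpChart k l).comp (expansion z) = eval₂Hom C (excCoord z l) := by
    apply MvPolynomial.ringHom_ext
    · intro; simp [blowUpChart]
    · intro j
      induction j using Fin.lastCases with
      | last =>
        change blowUpChart k l (expansion z (X 2)) = eval₂Hom C (excCoord z l) (X 2)
        simp [excCoord_two]
      | cast l' => simp [excCoord_castSucc, blowUpChart]
  exact DFunLike.congr_fun this f

lemma X_pow_dvd_blowUpChart (l : Fin 2) {m : ℕ} {q : MvPolynomial (Fin 2) k}
    (hq : q ∈ idealOfVars (Fin 2) k ^ m) : X 0 ^ m ∣ blowUpChart k l q := by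
  have hle : (idealOfVars (Fin 2) k).map (blowUpChart k l) ≤ Ideal.span {X 0} := by
    rw [idealOfVars, Ideal.map_span, Ideal.span_le]
    rintro _ ⟨_, ⟨l', rfl⟩, rfl⟩
    refine Ideal.mem_span_singleton.mpr ?_
    simp only [blowUpChart, coe_eval₂Hom, eval₂_X]
    exact Dvd.intro _ rfl
  have h1 := Ideal.mem_map_of_mem (blowUpChart k l) hq
  rw [Ideal.map_pow] at h1
  have h2 := Ideal.pow_right_mono hle m h1
  rw [Ideal.span_singleton_pow] at h2
  exact Ideal.mem_span_singleton.mp h2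

/-- If the multiplicity conditions are independent in degree `d` and the forms `f_c` generate the
forms of degree `d + 3` with these multiplicities, then the system of the `f_c` is base point free:
a form of degree `d + 3` of the shape `g - ℓ ^ 3 h'` does not vanish at a given further point, and
one of the shape `x₂ ^ 2 (x_l - z_l x₂) h'` has a prescribed tangent cone at one of the points. -/
theorem isBasePointFree_of_generates [Infinite k] {n : ℕ} {z : Fin n → Fin 2 → k} {m : Fin n → ℕ}
    (hm : ∀ i, 0 < m i) {d : ℕ} {γ : Type*} [Fintype γ] {f : γ → MvPolynomial (Fin 3) k}
    (hf : ∀ c, (f c).IsHomogeneous d)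
    (hfm : ∀ c i, expansion (z i) (f c) ∈ idealOfVars (Fin 2) k ^ m i)
    (hsurj : ∀ b : Fin n → MvPolynomial (Fin 2) k, ∃ h : MvPolynomial (Fin 3) k,
      h.IsHomogeneous d ∧ ∀ i, expansion (z i) h - b i ∈ idealOfVars (Fin 2) k ^ m i)
    (hgen : ∀ h : MvPolynomial (Fin 3) k, h.IsHomogeneous (d + 3) →
      (∀ i, expansion (z i) h ∈ idealOfVars (Fin 2) k ^ m i) → h ∈ Ideal.span (Set.range f)) :
    IsBasePointFree z m d f := by
  classical
  refine ⟨hf, fun ξ hξ h0 ↦ ?_, fun i l ↦ ?_⟩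
  · by_contra! hcon
    obtain ⟨ℓ, hℓ, hℓξ, hℓz⟩ := exists_linear_form z hcon
    obtain ⟨j, hj⟩ := Function.ne_iff.mp hξ
    choose q hq using fun i ↦ exists_mul_sub_one_mem_pow (q := expansion (z i) ℓ ^ 3)
      (by rw [map_pow]; exact pow_ne_zero _ (hℓz i)) (m i)
    obtain ⟨h', hh', hb⟩ := hsurj fun i ↦ expansion (z i) (X j ^ (d + 3)) * q i
    -- `h'` is chosen such that this form satisfies the conditions; at `ξ` it takes the value of
    -- `X j ^ (d + 3)`
    have h1 : X j ^ (d + 3) - ℓ ^ 3 * h' ∈ Ideal.span (Set.range f) := by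
      refine hgen _ ((isHomogeneous_X_pow j _).sub ?_) fun i ↦ ?_
      · simpa [add_comm] using (hℓ.pow 3).mul hh'
      · have : expansion (z i) (X j ^ (d + 3) - ℓ ^ 3 * h') =
            - (expansion (z i) (X j ^ (d + 3)) * (q i * expansion (z i) ℓ ^ 3 - 1)) -
              expansion (z i) ℓ ^ 3 *
                (expansion (z i) h' - expansion (z i) (X j ^ (d + 3)) * q i) := by
          rw [map_sub, map_mul, map_pow (expansion (z i)) ℓ]
          ring
        rw [this]
        exact sub_mem (neg_mem (Ideal.mul_mem_left _ _ (hq i))) (Ideal.mul_mem_left _ _ (hb i))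
    have hle : Ideal.span (Set.range f) ≤ RingHom.ker (eval ξ) := by
      rw [Ideal.span_le]
      rintro _ ⟨c, rfl⟩
      exact h0 c
    have h2 : eval ξ (X j ^ (d + 3) - ℓ ^ 3 * h') = 0 := hle h1
    rw [map_sub, map_mul, map_pow _ ℓ, hℓξ] at h2
    simp at h2
    exact hj h2
  · choose f' hf' using fun c ↦ X_pow_dvd_blowUpChart l (hfm c i)
    refine ⟨f', fun c ↦ by rw [← blowUpChart_expansion, hf'], fun w hw ↦ ?_⟩
    by_contra! hcon
    obtain ⟨h', hh', hb⟩ := hsurj fun i' ↦ if i' = i then X l ^ (m i - 1) else 0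
    have hself : expansion (z i) (X l.castSucc - C (z i l) * X 2) = X l := by simp
    have hX : (X l : MvPolynomial (Fin 2) k) ∈ idealOfVars (Fin 2) k :=
      Ideal.subset_span ⟨l, rfl⟩
    have hexp (i') : expansion (z i') (X 2 ^ 2 * (X l.castSucc - C (z i l) * X 2) * h') =
        expansion (z i') (X l.castSucc - C (z i l) * X 2) * expansion (z i') h' := by
      rw [map_mul, map_mul, map_pow, expansion_X_two, one_pow, one_mul]
    -- near the `i`-th point, the form `h'` is `X l ^ (m i - 1)` up to terms of higher order, and
    -- its product with `X l` has a strict transform without zeros on the exceptional divisor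
    have hbi := hb i
    simp only [if_true] at hbi
    have h1 : X 2 ^ 2 * (X l.castSucc - C (z i l) * X 2) * h' ∈ Ideal.span (Set.range f) := by
      refine hgen _ ?_ fun i' ↦ ?_
      · have h2 : (X l.castSucc - C (z i l) * X 2 : MvPolynomial (Fin 3) k).IsHomogeneous 1 :=
          (isHomogeneous_X k _).sub
            (by simpa using (isHomogeneous_C (Fin 3) (z i l)).mul (isHomogeneous_X k 2))
        have := ((isHomogeneous_X_pow (R := k) (2 : Fin 3) 2).mul h2).mul hh'
        rwa [show 2 + 1 + d = d + 3 by ring] at this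
      · rw [hexp]
        by_cases hi : i' = i
        · subst hi
          rw [hself]
          have : X l * expansion (z i') h' = X l * (expansion (z i') h' - X l ^ (m i' - 1)) +
              X l ^ m i' := by
            conv_rhs => rw [← Nat.sub_add_cancel (hm i'), pow_succ]
            simp only [Nat.add_sub_cancel]
            ring
          rw [this]
          exact add_mem (Ideal.mul_mem_left _ _ hbi) (Ideal.pow_mem_pow hX _)
        · have := hb i'
          rw [if_neg hi, sub_zero] at this
          exact Ideal.mul_mem_left _ _ this
    obtain ⟨a, ha⟩ := Ideal.mem_span_range_iff_exists_fun.mp h1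
    obtain ⟨e, he⟩ := X_pow_dvd_blowUpChart l hbi
    have hl : blowUpChart k l (X l) = X 0 := by simp [blowUpChart]
    have h2 : X 0 ^ m i * (1 + X 0 * e) =
        X 0 ^ m i * ∑ c, blowUpChart k l (expansion (z i) (a c)) * f' c := by
      have h3 := congrArg (fun q ↦ blowUpChart k l (expansion (z i) q)) ha
      simp only [map_sum, hexp, hself, map_mul] at h3
      rw [map_sub, map_pow, hl, sub_eq_iff_eq_add] at he
      rw [he, hl] at h3
      have h4 : X 0 ^ m i * (1 + X 0 * e) =
          X 0 * (X 0 ^ m i * e + X 0 ^ (m i - 1) : MvPolynomial (Fin 2) k) := by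
        conv_lhs => rw [← Nat.sub_add_cancel (hm i), pow_succ]
        conv_rhs => rw [← Nat.sub_add_cancel (hm i), pow_succ]
        simp only [Nat.add_sub_cancel]
        ring
      rw [h4, ← h3, Finset.mul_sum]
      refine Finset.sum_congr rfl fun c _ ↦ ?_
      rw [hf' c]
      ring
    have h5 := congrArg (eval w) (mul_left_cancel₀ (pow_ne_zero _ (X_ne_zero _)) h2)
    simp [hw, hcon] at h5

end

/-! ### Gaussian elimination over the field with 7 elements -/

/-- `f n`, where the recursor makes the kernel evaluate `n` to a literal before `f` is applied. -/
def force {α : Sort*} (n : ℕ) (f : ℕ → α) : α :=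
  Nat.rec (f 0) (fun m _ ↦ f (m + 1)) n

lemma force_eq {α : Sort*} (n : ℕ) (f : ℕ → α) : force n f = f n := by
  cases n <;> rfl

/-- `f (l.map g)`, with the evaluation of the entries of the list forced first. -/
def forceMap {α : Type*} (g : α → ℕ) : List α → (List ℕ → Bool) → Bool
  | [], f => f []
  | a :: l, f => force (g a) fun n ↦ forceMap g l fun l' ↦ f (n :: l')

lemma forceMap_eq {α : Type*} (g : α → ℕ) (l : List α) (f : List ℕ → Bool) :
    forceMap g l f = f (l.map g) := by
  induction l generalizing f with
  | nil => rfl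
  | cons a l ih => rw [forceMap, force_eq, ih, List.map_cons]

/-- A row vector over the field with 7 elements is encoded as a number with digits in this base,
which is large enough to make a reduction of the digits unnecessary. -/
def base : ℕ := 2 ^ 288

/-- The value in `{0, …, 6}` of the `j`-th entry of a row. -/
def digit (N j : ℕ) : ℕ := N / base ^ j % base % 7

/-- Gaussian elimination with a given list of pivot columns, on rows encoded in base `base`. The
result is `true` if no pivot vanishes; then the rows are linearly independent. The inverse of a
pivot `x` is `x ^ 5`, and `6` stands for `-1`. -/
def eliminate : List ℕ → List ℕ → Bool
  | _, [] => true
  | [], _ :: _ => false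
  | j :: js, r :: rs =>
    force (digit r j) fun x ↦ x != 0 &&
      forceMap (fun s ↦ s + 6 * digit s j * x ^ 5 % 7 * r) rs (eliminate js)

section

open Polynomial

/-- The digits of `N` in base `base` are the coefficients of `P`, which are at most `b`. -/
structure Encodes (N b : ℕ) (P : ℕ[X]) : Prop where
  eval_eq : P.eval base = N
  coeff_le : ∀ j, P.coeff j ≤ b

lemma Encodes.div_mod {N b : ℕ} {P : ℕ[X]} (h : Encodes N b P) (hb : b < base) (j : ℕ) :
    N / base ^ j % base = P.coeff j := by
  obtain ⟨rfl, h2⟩ := h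
  have hpos : 0 < base := by lia
  induction j generalizing P with
  | zero =>
    conv_lhs => rw [← divX_mul_X_add P]
    simp [Nat.mod_eq_of_lt ((h2 0).trans_lt hb)]
  | succ j ih =>
    have h1 : P.eval base / base = (divX P).eval base := by
      conv_lhs => rw [← divX_mul_X_add P]
      rw [eval_add, eval_mul, eval_X, eval_C, mul_comm, Nat.mul_add_div hpos,
        Nat.div_eq_of_lt ((h2 0).trans_lt hb), add_zero]
    rw [pow_succ', ← Nat.div_div_eq_div_mul, h1, ih fun j ↦ by rw [coeff_divX]; exact h2 _,
      coeff_divX]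

/-- The reduction of a polynomial modulo 7. -/
def reduce (P : ℕ[X]) : (ZMod 7)[X] := P.map (Nat.castRingHom (ZMod 7))

lemma coeff_reduce (P : ℕ[X]) (j : ℕ) : (reduce P).coeff j = (P.coeff j : ZMod 7) := by
  simp [reduce]

lemma Encodes.digit_eq {N b : ℕ} {P : ℕ[X]} (h : Encodes N b P) (hb : b < base) (j : ℕ) :
    (digit N j : ZMod 7) = (reduce P).coeff j := by
  rw [digit, h.div_mod hb, ZMod.natCast_mod, coeff_reduce]

lemma Encodes.add_mul {N N' b c : ℕ} {P P' : ℕ[X]} (h : Encodes N b P) (h' : Encodes N' b P')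
    (hc : c ≤ 6) : Encodes (N + c * N') (b * 7) (P + c • P') where
  eval_eq := by simp [h.eval_eq, h'.eval_eq]
  coeff_le j := by
    have h1 := h.coeff_le j
    have h2 := Nat.mul_le_mul hc (h'.coeff_le j)
    rw [coeff_add, coeff_smul, smul_eq_mul]
    lia

/-- One step of Gaussian elimination, with pivot `φ r`. -/
lemma linearIndependent_cons_of_eliminate {F V : Type*} [Field F] [AddCommGroup V] [Module F V]
    {n : ℕ} {r : V} {s : Fin n → V} (φ : V →ₗ[F] F) (hr : φ r ≠ 0) (c : Fin n → F)
    (hc : ∀ i, φ (s i + c i • r) = 0) (h : LinearIndependent F fun i ↦ s i + c i • r) :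
    LinearIndependent F (Fin.cons r s : Fin (n + 1) → V) := by
  rw [Fintype.linearIndependent_iff] at h ⊢
  intro g hg
  rw [Fin.sum_univ_succ] at hg
  simp only [Fin.cons_zero, Fin.cons_succ] at hg
  have h1 : (g 0 - ∑ i, g i.succ * c i) • r + ∑ i, g i.succ • (s i + c i • r) = 0 := by
    simp only [smul_add, Finset.sum_add_distrib, sub_smul, Finset.sum_smul, smul_smul]
    rw [← hg]
    abel
  have h2 : g 0 - ∑ i, g i.succ * c i = 0 := by
    have := congrArg φ h1
    have h0 : ∑ i, φ (g i.succ • (s i + c i • r)) = 0 :=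
      Finset.sum_eq_zero fun i _ ↦ by rw [map_smul, hc, smul_zero]
    rw [map_add, map_smul, map_sum, map_zero, h0, add_zero, smul_eq_mul] at this
    exact (mul_eq_zero.mp this).resolve_right hr
  rw [h2, zero_smul, zero_add] at h1
  have h3 := h (fun i ↦ g i.succ) h1
  intro i
  induction i using Fin.cases with
  | zero => simpa [h3] using h2
  | succ i => exact h3 i

instance : Fact (Nat.Prime 7) := ⟨by norm_num⟩

/-- Soundness of the elimination. A step multiplies the bound on the digits by 7 at most, so that
digits do not overflow as long as `b * 7 ^ js.length < base`. -/
theorem linearIndependent_of_eliminate (js : List ℕ) {m : ℕ} (rows : List ℕ) (P : Fin m → ℕ[X])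
    (hm : rows.length = m) {b : ℕ} (hP : ∀ i : Fin m, Encodes (rows.getD i 0) b (P i))
    (hb : b * 7 ^ js.length < base) (h : eliminate js rows = true) :
    LinearIndependent (ZMod 7) fun i ↦ reduce (P i) := by
  induction js generalizing m rows b with
  | nil =>
    cases rows with
    | nil =>
      obtain rfl : 0 = m := hm
      exact linearIndependent_empty_type
    | cons r rs => simp [eliminate] at h
  | cons j js ih =>
    cases rows with
    | nil =>
      obtain rfl : 0 = m := hm
      exact linearIndependent_empty_type
    | cons r rs =>
      obtain rfl : rs.length + 1 = m := hm
      rw [eliminate, force_eq, forceMap_eq, Bool.and_eq_true] at h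
      obtain ⟨h0, h⟩ := h
      set x := digit r j with hx
      have hb' : b < base := lt_of_le_of_lt (Nat.le_mul_of_pos_right b (by positivity)) hb
      have hr : Encodes r b (P 0) := hP 0
      have hs (i : Fin rs.length) : Encodes (rs.getD i 0) b (P i.succ) := by simpa using hP i.succ
      have hx' : (x : ZMod 7) = (reduce (P 0)).coeff j := hr.digit_eq hb' j
      have hx0 : (x : ZMod 7) ≠ 0 := by
        rw [Ne, ZMod.natCast_eq_zero_iff]
        have h1 : x < 7 := Nat.mod_lt _ (by norm_num)
        have h2 : x ≠ 0 := by simpa using h0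
        exact fun h3 ↦ h2 (Nat.eq_zero_of_dvd_of_lt h3 h1)
      let c (i : Fin rs.length) : ℕ := 6 * digit (rs.getD i 0) j * x ^ 5 % 7
      have hli := ih (m := rs.length) (b := b * 7)
        (rs.map fun s ↦ s + 6 * digit s j * x ^ 5 % 7 * r)
        (fun i ↦ P i.succ + c i • P 0) (by simp) (fun i ↦ by
          have h1 := (hs i).add_mul hr (Nat.le_of_lt_succ (Nat.mod_lt (6 * digit (rs.getD i 0) j *
            x ^ 5) (by norm_num : 0 < 7)))
          have h2 : (rs.map fun s ↦ s + 6 * digit s j * x ^ 5 % 7 * r).getD i 0 =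
              rs.getD i 0 + c i * r := by
            simp [List.getD_eq_getElem?_getD, c]
          rw [h2]
          exact h1) (by rw [mul_assoc, ← pow_succ']; exact hb) h
      have hcons : (fun i ↦ reduce (P i)) =
          (Fin.cons (reduce (P 0)) fun i ↦ reduce (P (Fin.succ i)) :
            Fin (rs.length + 1) → (ZMod 7)[X]) := by
        funext i
        induction i using Fin.cases <;> rfl
      have hred (i : Fin rs.length) : reduce (P i.succ + c i • P 0) =
          reduce (P i.succ) + (c i : ZMod 7) • reduce (P 0) := by
        ext j
        simp [coeff_reduce]
      rw [hcons]
      refine linearIndependent_cons_of_eliminate (lcoeff (ZMod 7) j) ?_ (fun i ↦ (c i : ZMod 7))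
        (fun i ↦ ?_) (by simpa only [hred] using hli)
      · rw [lcoeff_apply, ← hx']
        exact hx0
      · have h1 := (hs i).digit_eq hb' j
        rw [map_add, map_smul, lcoeff_apply, lcoeff_apply, ← hx', ← h1]
        simp only [c, ZMod.natCast_mod, smul_eq_mul]
        push_cast
        have h2 : (x : ZMod 7) ^ 6 = 1 := ZMod.pow_card_sub_one_eq_one hx0
        have h3 : (7 : ZMod 7) = 0 := by decide
        linear_combination (6 * (digit (rs.getD i 0) j : ZMod 7)) * h2 +
          (digit (rs.getD i 0) j : ZMod 7) * h3

end

/-! ### A special configuration of points over the field with 7 elements -/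

/-- Twenty-one points of the affine plane over the field with 7 elements, chosen at random. -/
def specialPoints : List (ℕ × ℕ) :=
  [(3, 2), (2, 6), (6, 1), (3, 4), (1, 6), (0, 6), (3, 0), (0, 2), (0, 1), (1, 3), (3, 5), (6, 5),
   (0, 5), (2, 2), (6, 0), (3, 1), (2, 3), (1, 1), (5, 0), (6, 3), (0, 0)]

/-- The coefficients modulo 7 of six forms of degree 13 which satisfy the multiplicity conditions,
as digits in base 7. The digit `j` belongs to the monomial with exponents `j / 17` and `j % 17` in
the affine coordinates; as `17` exceeds `16`, this numbering is compatible with products up to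
degree 16. -/
def kernelDigits : List ℕ :=
  [107977553361949299249499508682960500936238390831544322705934103149426665202514699311994661924001974703424252364290546088874170719246662754361358108907743491665,
   755842873527484776120859399129089516145420797551656487279128048652519764850386948395578136230158327266553528564689329401352118919603147919252801434792306051311,
   5290900114688816159213723189773003997507011102397634874911044118613662342693354178126412582600516421819291186545062971738166881916437876361867552291911608721097,
   25118873737445771577220378461837375871952797681739385438826200309503376885366682197586396490713398988191409832145540862355877601192277205798146513965336246302408726506102303,
   175832116162120401040542646321656204642117294074755682771551196253814271313640751315607003908266752869361223513502803417595506856508057936464983319263765202165670644596126158,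
   5843416508321765137412223462176261055754262745023924734640697189325608569707354146518398253500624546391671423035368105397995963921843417587068446961730990901475352591056890347998327886219]

/-- The pivot columns of the elimination for the multiplicity conditions in degree 13. -/
def conditionPivots : List ℕ :=
  [0, 17, 1, 2, 18, 3, 4, 19, 5, 6, 20, 7, 34, 51, 21, 68, 85, 35, 8, 22, 9, 36, 52, 23, 37, 53,
   24, 10, 25, 11, 38, 26, 12, 13, 27, 28, 39, 29, 41, 54, 69, 40, 86, 55, 42, 102, 119, 70, 136,
   87, 44, 71, 88, 43, 103, 56, 45, 57, 58, 59, 72, 60, 61, 73, 89, 74, 104, 75, 76, 77, 91, 90,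
   92, 93, 105, 120, 137, 106, 153, 107, 108, 109, 121, 122, 123, 124, 125, 139, 138, 140, 141,
   154, 155, 156, 157, 170, 171, 172, 173]

/-- The pivot columns of the elimination for the products of degree 16. -/
def productPivots : List ℕ :=
  [3, 4, 5, 6, 20, 21, 22, 37, 38, 54, 7, 19, 24, 23, 25, 36, 39, 40, 53, 55, 26, 27, 41, 35, 42,
   44, 43, 56, 57, 70, 45, 47, 46, 51, 52, 58, 60, 61, 59, 71, 62, 63, 64, 68, 72, 69, 73, 74, 75,
   76, 77, 78, 85, 79]

/-- The sum of `f i` for `i < n`, in a form which the kernel evaluates by structural recursion. -/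
def natSum (f : ℕ → ℕ) : ℕ → ℕ
  | 0 => 0
  | n + 1 => natSum f n + f n

/-- The binomial coefficient `a.choose s`, for `s ≤ 2`. -/
def smallChoose (a : ℕ) : ℕ → ℕ
  | 0 => 1
  | 1 => a
  | _ => a * (a - 1) / 2

/-- The coefficient of `X ^ s * Y ^ t` in `(x + X) ^ a * (y + Y) ^ b` modulo 7, if `a + b ≤ 13`. -/
def entry (x y s t a b : ℕ) : ℕ :=
  bif Nat.ble (a + b) 13 then
    smallChoose a s * x ^ (a - s) * (smallChoose b t * y ^ (b - t)) % 7 else 0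

/-- The multiplicity conditions: the index `i` of a point and the exponents `s`, `t` of a monomial
of degree less than the multiplicity, which is 2 for `i < 9` and 3 otherwise. -/
def conditions : List (ℕ × ℕ × ℕ) :=
  (List.range 21).flatMap fun i ↦
    (bif Nat.ble 9 i then [(0, 0), (1, 0), (0, 1), (2, 0), (1, 1), (0, 2)] else
      [(0, 0), (1, 0), (0, 1)]).map fun st ↦ (i, st)

/-- The coefficient of a multiplicity condition at the monomial `X ^ (j / 17) * Y ^ (j % 17)`. -/
def conditionEntry (c : ℕ × ℕ × ℕ) (j : ℕ) : ℕ :=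
  entry (specialPoints.getD c.1 (0, 0)).1 (specialPoints.getD c.1 (0, 0)).2 c.2.1 c.2.2
    (j / 17) (j % 17)

/-- The linear form of a multiplicity condition, as a row. -/
def conditionRow (c : ℕ × ℕ × ℕ) : ℕ := natSum (fun j ↦ conditionEntry c j * base ^ j) 289

/-- The coefficient of the `c`-th form at the monomial `X ^ (j / 17) * Y ^ (j % 17)`. -/
def kernelEntry (c j : ℕ) : ℕ :=
  bif Nat.ble (j / 17 + j % 17) 13 then kernelDigits.getD c 0 / 7 ^ j % 7 else 0

/-- The coefficients of the `c`-th form, as a row. -/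
def kernelRow (c : ℕ) : ℕ := natSum (fun j ↦ kernelEntry c j * base ^ j) 289

/-- The coefficients of the `c`-th form in reversed order, as a row. The entry 288 of the product of
a row with this number is a scalar product. -/
def kernelCol (c : ℕ) : ℕ := natSum (fun j ↦ kernelEntry c (288 - j) * base ^ j) 289

/-- The index `c` of a form and the exponents of a monomial `X ^ a * Y ^ b` with `a + b ≤ 3`, for a
maximal set of independent products. -/
def products : List (ℕ × ℕ × ℕ) :=
  ((List.range 5).flatMap fun c ↦ (List.range 4).flatMap fun a ↦ (List.range (4 - a)).map fun b ↦
    (c, a, b)) ++ [(5, 0, 0), (5, 0, 2), (5, 0, 3), (5, 3, 0)]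

/-- The coefficients of the product of a form with a monomial, as a row. -/
def productRow (q : ℕ × ℕ × ℕ) : ℕ := kernelRow q.1 * base ^ (17 * q.2.1 + q.2.2)

theorem eliminate_conditions :
    forceMap conditionRow conditions (eliminate conditionPivots) = true := by
  decide +kernel

theorem eliminate_products :
    forceMap productRow products (eliminate productPivots) = true := by
  decide +kernel

theorem condition_kernel : ((List.range 6).all fun c ↦ conditions.all fun q ↦
    digit (conditionRow q * kernelCol c) 288 == 0) = true := by
  decide +kernel

/-! ### The matrix of the multiplicity conditions -/

section

open MvPolynomial

/-- The exponent vector `(s, t)`. -/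
def exponent (s t : ℕ) : Fin 2 →₀ ℕ := Finsupp.single 0 s + Finsupp.single 1 t

/-- The monomial of degree `d` with exponents `j / 17` and `j % 17` of `x₀` and `x₁`, or `0` if
their sum exceeds `d`. -/
def formMonomial (R : Type*) [CommRing R] (d j : ℕ) : MvPolynomial (Fin 3) R :=
  if j / 17 + j % 17 ≤ d then X 0 ^ (j / 17) * X 1 ^ (j % 17) * X 2 ^ (d - (j / 17 + j % 17)) else 0

/-- The form of degree `d` with given coefficients. -/
def form {R : Type*} [CommRing R] (d : ℕ) (u : Fin 289 → R) : MvPolynomial (Fin 3) R :=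
  ∑ j, C (u j) * formMonomial R d j

/-- The matrix of the multiplicity conditions at the points `z i` on the forms of degree 13. -/
def conditionMatrix {R : Type*} [CommRing R] (z : Fin 21 → Fin 2 → R) :
    Matrix (Fin conditions.length) (Fin 289) R :=
  fun r j ↦ coeff (exponent (conditions.get r).2.1 (conditions.get r).2.2)
    (expansion (z (Fin.ofNat 21 (conditions.get r).1)) (formMonomial R 13 j))

section

variable {R R' : Type*} [CommRing R] [CommRing R'] (φ : R →+* R')

lemma map_formMonomial (d j : ℕ) :
    MvPolynomial.map φ (formMonomial R d j) = formMonomial R' d j := by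
  unfold formMonomial
  split_ifs <;> simp

lemma map_form (d : ℕ) (u : Fin 289 → R) :
    MvPolynomial.map φ (form d u) = form d fun j ↦ φ (u j) := by
  simp [form, map_formMonomial]

lemma map_expansion (z : Fin 2 → R) (f : MvPolynomial (Fin 3) R) :
    MvPolynomial.map φ (expansion z f) = expansion (fun l ↦ φ (z l)) (MvPolynomial.map φ f) := by
  have : (MvPolynomial.map φ).comp (expansion z) =
      (expansion fun l ↦ φ (z l)).comp (MvPolynomial.map φ) := by
    apply MvPolynomial.ringHom_ext
    · intro; simp
    · intro j
      induction j using Fin.lastCases with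
      | last =>
        change MvPolynomial.map φ (expansion z (X 2)) =
          expansion (fun l ↦ φ (z l)) (MvPolynomial.map φ (X 2))
        simp
      | cast l' => simp
  exact DFunLike.congr_fun this f

lemma map_conditionMatrix (z : Fin 21 → Fin 2 → R) :
    (conditionMatrix z).map φ = conditionMatrix fun i l ↦ φ (z i l) := by
  ext r j
  simp only [Matrix.map_apply, conditionMatrix, ← coeff_map, map_expansion, map_formMonomial]

lemma isHomogeneous_formMonomial (d j : ℕ) : (formMonomial R d j).IsHomogeneous d := by
  unfold formMonomial
  split_ifs with h
  · have := ((isHomogeneous_X_pow (R := R) (0 : Fin 3) (j / 17)).mul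
      (isHomogeneous_X_pow (1 : Fin 3) (j % 17))).mul
        (isHomogeneous_X_pow (2 : Fin 3) (d - (j / 17 + j % 17)))
    rwa [Nat.add_sub_cancel' h] at this
  · exact isHomogeneous_zero _ _ _

lemma isHomogeneous_form (d : ℕ) (u : Fin 289 → R) : (form d u).IsHomogeneous d :=
  IsHomogeneous.sum _ _ _ fun j _ ↦ by
    simpa using (isHomogeneous_C (Fin 3) (u j)).mul (isHomogeneous_formMonomial d j)

lemma conditionMatrix_mulVec (z : Fin 21 → Fin 2 → R) (u : Fin 289 → R)
    (r : Fin conditions.length) : (conditionMatrix z).mulVec u r =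
      coeff (exponent (conditions.get r).2.1 (conditions.get r).2.2)
        (expansion (z (Fin.ofNat 21 (conditions.get r).1)) (form 13 u)) := by
  simp only [form, map_sum, coeff_sum, Matrix.mulVec, dotProduct, conditionMatrix, map_mul,
    expansion_C, coeff_C_mul]
  exact Finset.sum_congr rfl fun j _ ↦ mul_comm _ _

/-- The binomial theorem in two variables. -/
lemma coeff_exponent_add_pow_mul (x y : R) (a b s t : ℕ) :
    coeff (exponent s t) ((C x + X 0) ^ a * (C y + X 1) ^ b : MvPolynomial (Fin 2) R) =
      a.choose s * x ^ (a - s) * (b.choose t * y ^ (b - t)) := by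
  have h (x : R) (l : Fin 2) (a : ℕ) : (C x + X l : MvPolynomial (Fin 2) R) ^ a =
      ∑ m ∈ Finset.range (a + 1), monomial (Finsupp.single l m) (a.choose m * x ^ (a - m)) := by
    rw [add_comm, add_pow]
    refine Finset.sum_congr rfl fun m _ ↦ ?_
    have h1 : ((a.choose m : ℕ) : MvPolynomial (Fin 2) R) = C (a.choose m : R) :=
      (map_natCast C _).symm
    rw [h1, mul_assoc, ← map_pow, ← C_mul, mul_comm, X_pow_eq_monomial, C_mul_monomial, mul_one,
      mul_comm]
  rw [h, h, Finset.sum_mul_sum, coeff_sum]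
  have hinj (m n : ℕ) : (Finsupp.single 0 m + Finsupp.single 1 n : Fin 2 →₀ ℕ) = exponent s t ↔
      m = s ∧ n = t := by
    refine ⟨fun h ↦ ?_, fun ⟨h1, h2⟩ ↦ by rw [h1, h2, exponent]⟩
    have h0 := DFunLike.congr_fun h 0
    have h1 := DFunLike.congr_fun h 1
    simp [exponent] at h0 h1
    exact ⟨h0, h1⟩
  simp only [coeff_sum, monomial_mul, coeff_monomial, hinj, ite_and]
  rw [Finset.sum_eq_single s, Finset.sum_eq_single t]
  · simp
  · intro n _ hn
    simp [hn]
  · intro ht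
    have : b < t := by simpa [Nat.lt_succ_iff] using ht
    simp [Nat.choose_eq_zero_of_lt this]
  · intro m _ hm
    simp [hm]
  · intro hs
    have : a < s := by simpa [Nat.lt_succ_iff] using hs
    simp [Nat.choose_eq_zero_of_lt this]

end

lemma smallChoose_eq (a : ℕ) {s : ℕ} (hs : s ≤ 2) : smallChoose a s = a.choose s := by
  interval_cases s
  · simp [smallChoose]
  · simp [smallChoose]
  · simp [smallChoose, Nat.choose_two_right]

lemma ble_eq_false {a b : ℕ} (h : b < a) : Nat.ble a b = false := by
  rw [← Bool.not_eq_true, Nat.ble_eq]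
  lia

lemma mem_conditions {c : ℕ × ℕ × ℕ} : c ∈ conditions ↔
    c.1 < 21 ∧ c.2.1 + c.2.2 < if c.1 < 9 then 2 else 3 := by
  obtain ⟨i, s, t⟩ := c
  simp only [conditions, List.mem_flatMap, List.mem_range, List.mem_map, Prod.mk.injEq]
  constructor
  · rintro ⟨i', hi', ⟨s', t'⟩, hst, rfl, rfl, rfl⟩
    refine ⟨hi', ?_⟩
    by_cases h : i' < 9
    · have := ble_eq_false h
      simp [this] at hst
      rw [if_pos h]
      lia
    · have : Nat.ble 9 i' = true := by simpa [Nat.ble_eq] using h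
      simp [this] at hst
      rw [if_neg h]
      lia
  · rintro ⟨hi, h⟩
    refine ⟨i, hi, (s, t), ?_, rfl, rfl⟩
    by_cases h9 : i < 9
    · have := ble_eq_false h9
      rw [if_pos h9] at h
      simp [this]
      lia
    · have : Nat.ble 9 i = true := by simpa [Nat.ble_eq] using h9
      rw [if_neg h9] at h
      simp [this]
      lia

/-- The special points, with coordinates in the field with 7 elements. -/
def specialPoint (i : Fin 21) (l : Fin 2) : ZMod 7 :=
  if l = 0 then ((specialPoints.getD i (0, 0)).1 : ZMod 7) else (specialPoints.getD i (0, 0)).2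

lemma conditionMatrix_specialPoint (r : Fin conditions.length) (j : Fin 289) :
    conditionMatrix specialPoint r j = (conditionEntry (conditions.get r) j : ZMod 7) := by
  obtain ⟨h1, h2⟩ := mem_conditions.mp (List.get_mem conditions r)
  have e0 (z : Fin 2 → ZMod 7) : expansion z (X 0) = C (z 0) + X 0 := expansion_X_castSucc z 0
  have e1 (z : Fin 2 → ZMod 7) : expansion z (X 1) = C (z 1) + X 1 := expansion_X_castSucc z 1
  simp only [conditionMatrix]
  generalize conditions.get r = c at *
  obtain ⟨i, s, t⟩ := c
  have hs : s ≤ 2 := by dsimp only at h2; split_ifs at h2 <;> lia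
  have ht : t ≤ 2 := by dsimp only at h2; split_ifs at h2 <;> lia
  simp only [conditionEntry, entry, formMonomial]
  by_cases h : (j : ℕ) / 17 + (j : ℕ) % 17 ≤ 13
  · rw [if_pos h, Nat.ble_eq_true_of_le h, cond_true, map_mul, map_mul, map_pow, map_pow, map_pow,
      e0, e1, expansion_X_two, one_pow, mul_one, coeff_exponent_add_pow_mul, ZMod.natCast_mod,
      smallChoose_eq _ hs, smallChoose_eq _ ht]
    simp [specialPoint, Nat.mod_eq_of_lt h1]
  · rw [if_neg h, ble_eq_false (by lia)]
    simp

end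

/-! ### The special configuration is sufficiently general -/

section

open Polynomial

/-- The polynomial with coefficients `f j`, for `j < 289`. -/
def rowPolynomial (f : ℕ → ℕ) : ℕ[X] := ∑ j ∈ Finset.range 289, C (f j) * X ^ j

lemma coeff_rowPolynomial (f : ℕ → ℕ) (j : ℕ) :
    (rowPolynomial f).coeff j = if j < 289 then f j else 0 := by
  simp [rowPolynomial, Polynomial.coeff_X_pow]

lemma natSum_eq (f : ℕ → ℕ) (n : ℕ) : natSum f n = ∑ j ∈ Finset.range n, f j := by
  induction n with
  | zero => rfl
  | succ n ih => rw [natSum, ih, Finset.sum_range_succ]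

lemma encodes_rowPolynomial {f : ℕ → ℕ} {b : ℕ} (hf : ∀ j, f j ≤ b) :
    Encodes (natSum (fun j ↦ f j * base ^ j) 289) b (rowPolynomial f) where
  eval_eq := by simp [natSum_eq, rowPolynomial, eval_finsetSum]
  coeff_le j := by
    rw [coeff_rowPolynomial]
    split_ifs
    · exact hf j
    · exact Nat.zero_le b

lemma coeff_le_eval_one (P : ℕ[X]) (j : ℕ) : P.coeff j ≤ P.eval 1 := by
  rw [eval_eq_sum, Polynomial.sum]
  by_cases h : j ∈ P.support
  · simpa using Finset.single_le_sum (f := fun i ↦ P.coeff i * 1 ^ i) (fun _ _ ↦ Nat.zero_le _) h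
  · rw [notMem_support_iff.mp h]
    exact Nat.zero_le _

lemma eval_one_rowPolynomial_le {f : ℕ → ℕ} {b : ℕ} (hf : ∀ j, f j ≤ b) :
    (rowPolynomial f).eval 1 ≤ 289 * b := by
  simpa [rowPolynomial, eval_finsetSum] using
    Finset.sum_le_card_nsmul (Finset.range 289) f b fun j _ ↦ hf j

lemma conditionEntry_le (c : ℕ × ℕ × ℕ) (j : ℕ) : conditionEntry c j ≤ 6 := by
  unfold conditionEntry entry
  cases Nat.ble (j / 17 + j % 17) 13
  · exact Nat.zero_le _
  · exact Nat.le_of_lt_succ (Nat.mod_lt _ (by norm_num))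

lemma kernelEntry_le (c : ℕ) (j : ℕ) : kernelEntry c j ≤ 6 := by
  unfold kernelEntry
  cases Nat.ble (j / 17 + j % 17) 13
  · exact Nat.zero_le _
  · exact Nat.le_of_lt_succ (Nat.mod_lt _ (by norm_num))

lemma getD_map_get {α : Type*} (l : List α) (g : α → ℕ) (i : Fin l.length) :
    (l.map g).getD i 0 = g (l.get i) := by
  simp [List.getD_eq_getElem?_getD]

/-- The multiplicity conditions at the special points are independent in degree 13. -/
theorem linearIndependent_conditionMatrix :
    LinearIndependent (ZMod 7) (conditionMatrix specialPoint).row := by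
  have h := eliminate_conditions
  rw [forceMap_eq] at h
  have h1 := linearIndependent_of_eliminate conditionPivots (m := conditions.length)
    (conditions.map conditionRow) (fun r ↦ rowPolynomial (conditionEntry (conditions.get r)))
    (by simp) (fun r ↦ by
      rw [getD_map_get]
      exact encodes_rowPolynomial (conditionEntry_le _)) (by decide +kernel) h
  let T : (Fin 289 → ZMod 7) →ₗ[ZMod 7] (ZMod 7)[X] :=
    ∑ j : Fin 289, Polynomial.monomial (j : ℕ) ∘ₗ LinearMap.proj j
  refine LinearIndependent.of_comp T ?_
  convert h1 using 1
  funext r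
  have hT (v : Fin 289 → ZMod 7) : T v = ∑ j : Fin 289, Polynomial.monomial (j : ℕ) (v j) := by
    simp [T]
  rw [Function.comp_apply, hT]
  simp only [Matrix.row, conditionMatrix_specialPoint, reduce, rowPolynomial, Polynomial.map_sum,
    Polynomial.map_mul, Polynomial.map_pow, Polynomial.map_C, Polynomial.map_X]
  rw [Finset.sum_range]
  refine Finset.sum_congr rfl fun j _ ↦ ?_
  rw [Polynomial.C_mul_X_pow_eq_monomial]
  rfl

/-- The coefficients of the six forms. -/
def kernelVector (c : Fin 6) (j : Fin 289) : ZMod 7 := (kernelEntry c j : ZMod 7)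

/-- The six forms satisfy the multiplicity conditions. The scalar product of two rows is read off as
the middle coefficient of a product of polynomials, one of them reversed. -/
theorem conditionMatrix_mulVec_kernelVector (c : Fin 6) :
    (conditionMatrix specialPoint).mulVec (kernelVector c) = 0 := by
  funext r
  have h := condition_kernel
  rw [List.all_eq_true] at h
  have h1 := h c (List.mem_range.mpr c.2)
  rw [List.all_eq_true] at h1
  have h2 := h1 _ (List.get_mem conditions r)
  rw [beq_iff_eq] at h2
  set q := conditions.get r with hq
  have hE : Encodes (conditionRow q * kernelCol c) (289 * 6 * (289 * 6))
      (rowPolynomial (conditionEntry q) * rowPolynomial fun j ↦ kernelEntry c (288 - j)) := by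
    refine ⟨?_, fun j ↦ (coeff_le_eval_one _ j).trans ?_⟩
    · rw [eval_mul, (encodes_rowPolynomial (conditionEntry_le q)).eval_eq,
        (encodes_rowPolynomial fun j ↦ kernelEntry_le c (288 - j)).eval_eq]
      rfl
    · rw [eval_mul]
      exact Nat.mul_le_mul (eval_one_rowPolynomial_le (conditionEntry_le q))
        (eval_one_rowPolynomial_le fun j ↦ kernelEntry_le c _)
  have h3 := hE.digit_eq (by decide +kernel) 288
  rw [h2, Nat.cast_zero, coeff_reduce, coeff_mul,
    Finset.Nat.sum_antidiagonal_eq_sum_range_succ_mk] at h3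
  simp only [Matrix.mulVec, dotProduct, conditionMatrix_specialPoint, kernelVector, Pi.zero_apply]
  rw [h3, Finset.sum_range]
  push_cast
  refine Finset.sum_congr rfl fun j _ ↦ ?_
  have hj : (j : ℕ) ≤ 288 := Nat.le_of_lt_succ j.2
  rw [coeff_rowPolynomial, coeff_rowPolynomial, if_pos (by lia), if_pos (by lia),
    Nat.sub_sub_self hj]

lemma products_bounds : (products.all fun q ↦ Nat.blt q.1 6 &&
    Nat.ble ((17 * q.2.1 + q.2.2) / 17 + (17 * q.2.1 + q.2.2) % 17) 3) = true := by
  decide +kernel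

/-- The product of one of several forms of degree 13 with a monomial of degree 3. -/
def productForm {R : Type*} [CommRing R] (f : Fin 6 → MvPolynomial (Fin 3) R)
    (q : Fin products.length) : MvPolynomial (Fin 3) R :=
  formMonomial R 3 (17 * (products.get q).2.1 + (products.get q).2.2) *
    f (Fin.ofNat 6 (products.get q).1)

/-- The chosen products are independent. To see this, forms are mapped to polynomials in one
variable by the Kronecker substitution `x₀ = X ^ 17`, `x₁ = X`, `x₂ = 1`. -/
theorem linearIndependent_productForm :
    LinearIndependent (ZMod 7) (productForm fun c ↦ form 13 (kernelVector c)) := by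
  have h := eliminate_products
  rw [forceMap_eq] at h
  have h1 := linearIndependent_of_eliminate productPivots (m := products.length)
    (products.map productRow) (fun q ↦ rowPolynomial (kernelEntry (products.get q).1) *
      X ^ (17 * (products.get q).2.1 + (products.get q).2.2)) (b := 6) (by simp) (fun q ↦ by
      rw [getD_map_get]
      have hE := encodes_rowPolynomial (kernelEntry_le (products.get q).1)
      refine ⟨by rw [eval_mul, hE.eval_eq]; simp [productRow, kernelRow], fun j ↦ ?_⟩
      rw [coeff_mul_X_pow']
      split_ifs
      · exact hE.coeff_le _
      · exact Nat.zero_le _) (by decide +kernel) h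
  let T : MvPolynomial (Fin 3) (ZMod 7) →ₐ[ZMod 7] (ZMod 7)[X] :=
    MvPolynomial.aeval ![X ^ 17, X, 1]
  have hT (d j : ℕ) : T (formMonomial (ZMod 7) d j) =
      if j / 17 + j % 17 ≤ d then X ^ j else 0 := by
    unfold formMonomial
    split_ifs
    · simp only [map_mul, map_pow, T, MvPolynomial.aeval_X]
      simp only [Matrix.cons_val_zero, Matrix.cons_val_one, Matrix.cons_val, one_pow, mul_one]
      rw [← pow_mul, ← pow_add, Nat.div_add_mod]
    · exact map_zero T
  refine LinearIndependent.of_comp T.toLinearMap ?_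
  suffices heq : (T.toLinearMap ∘ productForm fun c ↦ form 13 (kernelVector c)) =
      fun q ↦ reduce (rowPolynomial (kernelEntry (products.get q).1) *
        X ^ (17 * (products.get q).2.1 + (products.get q).2.2)) by
    rw [heq]
    exact h1
  funext q
  have hb := products_bounds
  rw [List.all_eq_true] at hb
  have hb' := hb _ (List.get_mem products q)
  rw [Bool.and_eq_true, Nat.ble_eq] at hb'
  have hc : (products.get q).1 < 6 := Nat.blt_eq.mp hb'.1
  rw [Function.comp_apply, AlgHom.toLinearMap_apply, productForm, map_mul, hT, if_pos hb'.2, form,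
    map_sum, reduce, Polynomial.map_mul, Polynomial.map_pow, Polynomial.map_X, mul_comm]
  generalize (X : (ZMod 7)[X]) ^ (17 * (products.get q).2.1 + (products.get q).2.2) = Y
  refine congrArg (· * Y) ?_
  rw [rowPolynomial, Polynomial.map_sum, Finset.sum_range]
  refine Finset.sum_congr rfl fun j _ ↦ ?_
  rw [map_mul, hT, Polynomial.map_mul, Polynomial.map_pow, Polynomial.map_X, Polynomial.map_C]
  have hmod : ((Fin.ofNat 6 (products.get q).1 : Fin 6) : ℕ) = (products.get q).1 :=
    Nat.mod_eq_of_lt hc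
  have hTC (r : ZMod 7) : T (MvPolynomial.C r) = C r := T.commutes r
  rw [hTC, kernelVector, hmod]
  split_ifs with hj
  · rfl
  · rw [kernelEntry, ble_eq_false (by lia)]
    simp

end

/-! ### Independence of vectors under specialization -/

/-- A matrix whose specialization has independent rows has a right inverse up to specialization. -/
lemma exists_map_mul_eq_one {A F m n : Type*} [CommRing A] [Field F] [Fintype m] [Fintype n]
    [DecidableEq m] {ev : A →+* F} (hev : Function.Surjective ev) (M : Matrix m n A)
    (h : LinearIndependent F (M.map ev).row) : ∃ P : Matrix n m A, (M * P).map ev = 1 := by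
  classical
  have hinj : Function.Injective (M.map ev).vecMulLinear := Matrix.vecMul_injective_iff.mpr h
  obtain ⟨g, hg⟩ := LinearMap.exists_leftInverse_of_injective _ (LinearMap.ker_eq_bot.mpr hinj)
  let P₀ : Matrix n m F := fun j i ↦ g (Pi.single j 1) i
  choose s hs using hev
  refine ⟨P₀.map s, ?_⟩
  have hP : (P₀.map s).map ev = P₀ := by
    ext i j
    simp [hs]
  rw [Matrix.map_mul, hP]
  ext i j
  have h1 := congrFun (DFunLike.congr_fun hg (Pi.single i 1)) j
  have h2 (w : n → F) : g w = ∑ j, w j • g (Pi.single j 1) := by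
    conv_lhs => rw [pi_eq_sum_univ' w]
    simp
  rw [LinearMap.comp_apply, h2] at h1
  simp only [Matrix.vecMulLinear_apply, Matrix.single_one_vecMul, LinearMap.id_apply,
    Finset.sum_apply, Pi.smul_apply, smul_eq_mul] at h1
  rw [Matrix.mul_apply, Matrix.one_apply]
  simpa [Pi.single_apply, eq_comm, P₀] using h1

lemma linearIndependent_row_of_det_ne_zero {A K m n : Type*} [CommRing A] [Field K] [Fintype m]
    [Fintype n] [DecidableEq m] (e : A →+* K) (M : Matrix m n A) (P : Matrix n m A)
    (h : e (M * P).det ≠ 0) : LinearIndependent K (M.map e).row := by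
  rw [← Matrix.vecMul_injective_iff]
  have h1 : IsUnit (M.map e * P.map e) := by
    rw [Matrix.isUnit_iff_isUnit_det, ← Matrix.map_mul, isUnit_iff_ne_zero]
    rw [RingHom.map_det] at h
    exact h
  have h2 := Matrix.vecMul_injective_iff_isUnit.mpr h1
  intro v w hvw
  refine h2 ?_
  simp only [← Matrix.vecMul_vecMul]
  exact congrArg (fun x ↦ Matrix.vecMul x (P.map e)) hvw

/-- Linear independence of polynomials is an open condition on their coefficients. -/
lemma exists_forall_linearIndependent {A F m τ : Type*} [CommRing A] [Field F] [Fintype m]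
    {ev : A →+* F} (hev : Function.Surjective ev) (f : m → MvPolynomial τ A)
    (h : LinearIndependent F fun i ↦ MvPolynomial.map ev (f i)) :
    ∃ g : A, ev g ≠ 0 ∧ ∀ (K : Type u) [Field K] (e : A →+* K), e g ≠ 0 →
      LinearIndependent K fun i ↦ MvPolynomial.map e (f i) := by
  classical
  let T : Finset (τ →₀ ℕ) := Finset.univ.biUnion fun i ↦ (f i).support
  let M : Matrix m T A := fun i α ↦ (f i).coeff α.1
  have hrow : LinearIndependent F (M.map ev).row := by
    rw [Fintype.linearIndependent_iff] at h ⊢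
    intro g hg
    refine h g ?_
    ext α
    rw [MvPolynomial.coeff_sum, MvPolynomial.coeff_zero]
    by_cases hα : α ∈ T
    · have := congrFun hg ⟨α, hα⟩
      rw [Finset.sum_apply] at this
      simp only [MvPolynomial.coeff_smul, MvPolynomial.coeff_map]
      exact this
    · refine Finset.sum_eq_zero fun i _ ↦ ?_
      have : (f i).coeff α = 0 := by
        rw [← MvPolynomial.notMem_support_iff]
        exact fun hi ↦ hα (Finset.mem_biUnion.mpr ⟨i, Finset.mem_univ i, hi⟩)
      simp [MvPolynomial.coeff_map, this]
  obtain ⟨P, hP⟩ := exists_map_mul_eq_one hev M hrow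
  refine ⟨(M * P).det, ?_, fun K _ e he ↦ ?_⟩
  · rw [RingHom.map_det]
    change ((M * P).map ev).det ≠ 0
    rw [hP, Matrix.det_one]
    exact one_ne_zero
  · have h1 := linearIndependent_row_of_det_ne_zero e M P he
    let L : MvPolynomial τ K →ₗ[K] (T → K) := LinearMap.pi fun α ↦ MvPolynomial.lcoeff K α.1
    refine LinearIndependent.of_comp L ?_
    convert h1 using 1
    ext i α
    exact MvPolynomial.coeff_map e (f i) α.1

section

open MvPolynomial

-- `conditions.length` and `products.length` are sizes of index sets and must not be evaluated by
-- unification.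
attribute [local irreducible] conditions products

/-! ### Forms with given multiplicities at general points -/

/-- The prescribed multiplicities: two at the first nine points, three at the others. -/
abbrev multiplicity (i : Fin 21) : ℕ := if (i : ℕ) < 9 then 2 else 3

lemma exponent_self (α : Fin 2 →₀ ℕ) : exponent (α 0) (α 1) = α := by
  ext l
  fin_cases l <;> simp [exponent]

lemma degree_exponent (s t : ℕ) : (exponent s t).degree = s + t := by
  simp [exponent]

lemma forall_mem_pow_idealOfVars_iff {R : Type*} [CommRing R]
    (w : Fin 21 → MvPolynomial (Fin 2) R) :
    (∀ i, w i ∈ idealOfVars (Fin 2) R ^ multiplicity i) ↔ ∀ r : Fin conditions.length,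
      coeff (exponent (conditions.get r).2.1 (conditions.get r).2.2)
        (w (Fin.ofNat 21 (conditions.get r).1)) = 0 := by
  simp only [mem_pow_idealOfVars_iff']
  constructor
  · intro h r
    obtain ⟨h1, h2⟩ := mem_conditions.mp (List.get_mem conditions r)
    refine h _ _ ?_
    rw [degree_exponent, multiplicity]
    have : ((Fin.ofNat 21 (conditions.get r).1 : Fin 21) : ℕ) = (conditions.get r).1 :=
      Nat.mod_eq_of_lt h1
    rwa [this]
  · intro h i α hα
    rw [← exponent_self α, degree_exponent] at hα
    have hmem : ((i : ℕ), α 0, α 1) ∈ conditions := mem_conditions.mpr ⟨i.2, hα⟩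
    obtain ⟨r, hr⟩ := List.get_of_mem hmem
    have := h r
    rw [hr] at this
    simpa [exponent_self] using this

lemma mem_span_formMonomial {K : Type*} [Field K] {d : ℕ} (hd : d ≤ 16)
    {h : MvPolynomial (Fin 3) K} (hh : h.IsHomogeneous d) :
    h ∈ Submodule.span K (Set.range fun j : Fin 289 ↦ formMonomial K d j) := by
  rw [h.as_sum]
  refine Submodule.sum_mem _ fun α hα ↦ ?_
  have hdeg : α 0 + α 1 + α 2 = d := by
    have := hh (mem_support_iff.mp hα)
    rw [Finsupp.weight_apply, Finsupp.sum_fintype _ _ (by simp), Fin.sum_univ_three] at this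
    simpa using this
  have hmon : monomial α (coeff α h) = coeff α h • formMonomial K d (17 * α 0 + α 1) := by
    have h1 : (17 * α 0 + α 1) / 17 = α 0 := by lia
    have h2 : (17 * α 0 + α 1) % 17 = α 1 := by lia
    rw [formMonomial, h1, h2, if_pos (by lia), show d - (α 0 + α 1) = α 2 by lia, monomial_eq,
      Finsupp.prod_fintype _ _ (by simp), Fin.prod_univ_three, smul_eq_C_mul]
  rw [hmon]
  exact Submodule.smul_mem _ _ (Submodule.subset_span ⟨⟨17 * α 0 + α 1, by lia⟩, rfl⟩)

lemma card_monomials :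
    ((Finset.range 289).filter fun j ↦ j / 17 + j % 17 ≤ 16).card = 153 := by
  decide +kernel

lemma finrank_span_formMonomial_le (K : Type*) [Field K] :
    Module.finrank K (Submodule.span K (Set.range fun j : Fin 289 ↦ formMonomial K 16 j)) ≤
      153 := by
  classical
  let s := ((Finset.range 289).filter fun j ↦ j / 17 + j % 17 ≤ 16).image (formMonomial K 16)
  have hs : Submodule.span K (Set.range fun j : Fin 289 ↦ formMonomial K 16 j) ≤
      Submodule.span K (s : Set (MvPolynomial (Fin 3) K)) := by
    rw [Submodule.span_le]
    rintro _ ⟨j, rfl⟩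
    by_cases hj : (j : ℕ) / 17 + j % 17 ≤ 16
    · exact Submodule.subset_span (Finset.mem_coe.mpr (Finset.mem_image.mpr
        ⟨j, Finset.mem_filter.mpr ⟨Finset.mem_range.mpr j.2, hj⟩, rfl⟩))
    · simp only [formMonomial, if_neg hj]
      exact Submodule.zero_mem _
  have : FiniteDimensional K (Submodule.span K (s : Set (MvPolynomial (Fin 3) K))) :=
    FiniteDimensional.span_finset K s
  refine (Submodule.finrank_mono hs).trans ((finrank_span_finset_le_card s).trans ?_)
  exact Finset.card_image_le.trans card_monomials.le

/-- Dimension count: if `a` independent conditions are imposed on a space of dimension at most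
`a + b`, then `b` independent solutions span the space of solutions. -/
lemma mem_span_range_of_finrank_le {K E : Type*} [Field K] [AddCommGroup E] [Module K E] {a b : ℕ}
    {V : Submodule K E} [FiniteDimensional K V] {Φ : E →ₗ[K] (Fin a → K)}
    (hΦ : ∀ w, ∃ v ∈ V, Φ v = w) {p : Fin b → E} (hp : LinearIndependent K p)
    (hpV : ∀ q, p q ∈ V) (hpΦ : ∀ q, Φ (p q) = 0) (hdim : Module.finrank K V ≤ a + b)
    {v : E} (hv : v ∈ V) (hvΦ : Φ v = 0) : v ∈ Submodule.span K (Set.range p) := by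
  have hsurj : Function.Surjective (Φ.domRestrict V) := fun w ↦ by
    obtain ⟨v, hv, hvw⟩ := hΦ w
    exact ⟨⟨v, hv⟩, hvw⟩
  have h1 := (Φ.domRestrict V).finrank_range_add_finrank_ker
  rw [LinearMap.range_eq_top.mpr hsurj, finrank_top, Module.finrank_fin_fun] at h1
  have hW (x : E) (hx : x ∈ V) (hx0 : Φ x = 0) :
      x ∈ (LinearMap.ker (Φ.domRestrict V)).map V.subtype := ⟨⟨x, hx⟩, hx0, rfl⟩
  have hle : Submodule.span K (Set.range p) ≤
      (LinearMap.ker (Φ.domRestrict V)).map V.subtype := by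
    rw [Submodule.span_le]
    rintro _ ⟨q, rfl⟩
    exact hW _ (hpV q) (hpΦ q)
  rw [Submodule.eq_of_le_of_finrank_le hle (by
    rw [finrank_span_eq_card hp, Fintype.card_fin]
    exact (Submodule.finrank_map_le _ _).trans (by lia))]
  exact hW v hv hvΦ

/-- The map `expansion w` as a linear map. -/
def expansionLinear {K : Type*} [Field K] (w : Fin 2 → K) :
    MvPolynomial (Fin 3) K →ₗ[K] MvPolynomial (Fin 2) K where
  toFun := expansion w
  map_add' := map_add _
  map_smul' a p := by simp [smul_eq_C_mul]

/-- The coefficients of a form which vanish if it has the prescribed multiplicities. -/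
def conditionMap {K : Type*} [Field K] (z : Fin 21 → Fin 2 → K) :
    MvPolynomial (Fin 3) K →ₗ[K] (Fin conditions.length → K) :=
  LinearMap.pi fun r ↦
    MvPolynomial.lcoeff K (exponent (conditions.get r).2.1 (conditions.get r).2.2) ∘ₗ
      expansionLinear (z (Fin.ofNat 21 (conditions.get r).1))

lemma conditionMap_apply {K : Type*} [Field K] (z : Fin 21 → Fin 2 → K)
    (p : MvPolynomial (Fin 3) K) (r : Fin conditions.length) : conditionMap z p r =
      coeff (exponent (conditions.get r).2.1 (conditions.get r).2.2)
        (expansion (z (Fin.ofNat 21 (conditions.get r).1)) p) :=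
  rfl

lemma conditionMap_eq_zero_iff {K : Type*} [Field K] {z : Fin 21 → Fin 2 → K}
    {p : MvPolynomial (Fin 3) K} : conditionMap z p = 0 ↔
      ∀ i, expansion (z i) p ∈ idealOfVars (Fin 2) K ^ multiplicity i := by
  rw [forall_mem_pow_idealOfVars_iff, funext_iff]
  simp only [conditionMap_apply, Pi.zero_apply]

/-- If the multiplicity conditions on the forms of degree 13 are independent, then the forms of
degree 16 satisfying them make up a space of dimension at most `153 - 99 = 54`; hence it is spanned
by any 54 independent ones. -/
theorem mem_span_range_productForm {K : Type*} [Field K] {z : Fin 21 → Fin 2 → K}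
    (hz : Function.Surjective (conditionMatrix z).mulVec) {f : Fin 6 → MvPolynomial (Fin 3) K}
    (hf : ∀ c, (f c).IsHomogeneous 13)
    (hfm : ∀ c i, expansion (z i) (f c) ∈ idealOfVars (Fin 2) K ^ multiplicity i)
    (hind : LinearIndependent K (productForm f)) {h : MvPolynomial (Fin 3) K}
    (hh : h.IsHomogeneous 16)
    (hhm : ∀ i, expansion (z i) h ∈ idealOfVars (Fin 2) K ^ multiplicity i) :
    h ∈ Submodule.span K (Set.range (productForm f)) := by
  have : FiniteDimensional K
      (Submodule.span K (Set.range fun j : Fin 289 ↦ formMonomial K 16 j)) :=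
    FiniteDimensional.span_of_finite K (Set.finite_range _)
  have hdim : 153 = conditions.length + products.length := by decide +kernel
  refine mem_span_range_of_finrank_le (Φ := conditionMap z) (fun w ↦ ?_) hind (fun q ↦ ?_)
    (fun q ↦ ?_) (hdim ▸ finrank_span_formMonomial_le K) (mem_span_formMonomial le_rfl hh)
    (conditionMap_eq_zero_iff.mpr hhm)
  · obtain ⟨u, hu⟩ := hz w
    have hhom : (form 13 u * X 2 ^ 3).IsHomogeneous 16 :=
      (isHomogeneous_form 13 u).mul (isHomogeneous_X_pow 2 3)
    refine ⟨_, mem_span_formMonomial le_rfl hhom, funext fun r ↦ ?_⟩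
    rw [← hu, conditionMatrix_mulVec, conditionMap_apply, map_mul, map_pow, expansion_X_two,
      one_pow, mul_one]
  · exact mem_span_formMonomial le_rfl ((isHomogeneous_formMonomial 3 _).mul (hf _))
  · refine conditionMap_eq_zero_iff.mpr fun i ↦ ?_
    rw [productForm, map_mul]
    exact Ideal.mul_mem_left _ _ (hfm _ i)

/-- Two points with independent conditions are distinct: some form has the value `1` at one of them
and `0` at the other. -/
theorem isBasePointFree_of_linearIndependent {K : Type*} [Field K] [Infinite K]
    {z : Fin 21 → Fin 2 → K} (hz : Function.Surjective (conditionMatrix z).mulVec)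
    {f : Fin 6 → MvPolynomial (Fin 3) K} (hf : ∀ c, (f c).IsHomogeneous 13)
    (hfm : ∀ c i, expansion (z i) (f c) ∈ idealOfVars (Fin 2) K ^ multiplicity i)
    (hind : LinearIndependent K (productForm f)) :
    IsBasePointFree z multiplicity 13 f ∧ ∀ i i', z i = z i' → i = i' := by
  have hsurj (b : Fin 21 → MvPolynomial (Fin 2) K) : ∃ h : MvPolynomial (Fin 3) K,
      h.IsHomogeneous 13 ∧
        ∀ i, expansion (z i) h - b i ∈ idealOfVars (Fin 2) K ^ multiplicity i := by
    obtain ⟨u, hu⟩ := hz fun r ↦ coeff (exponent (conditions.get r).2.1 (conditions.get r).2.2)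
      (b (Fin.ofNat 21 (conditions.get r).1))
    refine ⟨form 13 u, isHomogeneous_form 13 u, ?_⟩
    rw [forall_mem_pow_idealOfVars_iff fun i ↦ expansion (z i) (form 13 u) - b i]
    intro r
    rw [coeff_sub, ← conditionMatrix_mulVec, hu, sub_self]
  have hpos (i : Fin 21) : 0 < multiplicity i := by
    unfold multiplicity
    split_ifs <;> norm_num
  refine ⟨isBasePointFree_of_generates hpos hf hfm hsurj fun h hh hhm ↦ ?_, fun i i' hii ↦ ?_⟩
  · refine (Submodule.span_le (p := (Ideal.span (Set.range f)).restrictScalars K)).mpr ?_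
      (mem_span_range_productForm hz hf hfm hind hh hhm)
    rintro _ ⟨q, rfl⟩
    exact Ideal.mul_mem_left _ _ (Ideal.subset_span ⟨_, rfl⟩)
  · by_contra hne
    obtain ⟨h, -, hh⟩ := hsurj fun j ↦ if j = i then 1 else 0
    have h1 := Ideal.pow_le_self (hpos i).ne' (hh i)
    have h2 := Ideal.pow_le_self (hpos i').ne' (hh i')
    rw [← hii, if_neg (Ne.symm hne)] at h2
    rw [if_pos rfl] at h1
    have h3 := Ideal.sub_mem _ h2 h1
    rw [← pow_one (idealOfVars (Fin 2) K), mem_pow_idealOfVars_iff'] at h3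
    simpa using h3 0 (by simp)

/-- A solution of a specialized linear system of equations lifts, if the equations are independent
after specialization: an arbitrary lift is multiplied by `det (M * P)` and corrected by Cramer's
rule. -/
lemma exists_lift_of_mulVec_eq_zero {A F m n : Type*} [CommRing A] [Field F] [Fintype m]
    [Fintype n] [DecidableEq m] {ev : A →+* F} (hev : Function.Surjective ev) {M : Matrix m n A}
    {P : Matrix n m A} (hP : (M * P).map ev = 1) {w : n → F} (hw : (M.map ev).mulVec w = 0) :
    ∃ u : n → A, M.mulVec u = 0 ∧ ∀ j, ev (u j) = w j := by
  choose s hs using hev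
  let u₀ : n → A := fun j ↦ s (w j)
  have hu₀ : ev ∘ u₀ = w := funext fun j ↦ hs (w j)
  refine ⟨(M * P).det • u₀ - P.mulVec ((M * P).adjugate.mulVec (M.mulVec u₀)), ?_, fun j ↦ ?_⟩
  · rw [Matrix.mulVec_sub, Matrix.mulVec_smul, Matrix.mulVec_mulVec, Matrix.mulVec_mulVec,
      Matrix.mul_adjugate, Matrix.smul_mulVec, Matrix.one_mulVec, sub_self]
  · have h1 : ev (M * P).det = 1 := by
      rw [RingHom.map_det]
      change ((M * P).map ev).det = 1
      rw [hP, Matrix.det_one]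
    have h2 : ev ∘ (M.mulVec u₀) = 0 := by
      funext i
      rw [Function.comp_apply, RingHom.map_mulVec, hu₀, hw]
    have h3 : ev ∘ (M * P).adjugate.mulVec (M.mulVec u₀) = 0 := by
      funext i
      rw [Function.comp_apply, RingHom.map_mulVec, h2, Matrix.mulVec_zero]
    rw [Pi.sub_apply, map_sub, RingHom.map_mulVec, h3, Matrix.mulVec_zero, Pi.zero_apply, sub_zero,
      Pi.smul_apply, smul_eq_mul, map_mul, h1, one_mul]
    exact hs _

lemma map_productForm {R R' : Type*} [CommRing R] [CommRing R'] (φ : R →+* R')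
    (f : Fin 6 → MvPolynomial (Fin 3) R) (q : Fin products.length) :
    MvPolynomial.map φ (productForm f q) = productForm (fun c ↦ MvPolynomial.map φ (f c)) q := by
  rw [productForm, map_mul, map_formMonomial, productForm]

/-- Everything happens over the integers: independence modulo 7 at the special configuration
persists at all points where one polynomial with integral coefficients does not vanish. -/
theorem exists_forall_isBasePointFree : ∃ G : MvPolynomial (Fin 21 × Fin 2) ℤ, G ≠ 0 ∧
    ∀ (K : Type u) [Field K] [Infinite K] (z : Fin 21 → Fin 2 → K),
      eval₂Hom (Int.castRingHom K) (fun il ↦ z il.1 il.2) G ≠ 0 →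
        (∃ f : Fin 6 → MvPolynomial (Fin 3) K, IsBasePointFree z multiplicity 13 f) ∧
          ∀ i i', z i = z i' → i = i' := by
  let zA : Fin 21 → Fin 2 → MvPolynomial (Fin 21 × Fin 2) ℤ := fun i l ↦ X (i, l)
  let ev : MvPolynomial (Fin 21 × Fin 2) ℤ →+* ZMod 7 :=
    eval₂Hom (Int.castRingHom (ZMod 7)) fun il ↦ specialPoint il.1 il.2
  have hev : Function.Surjective ev := fun x ↦ by
    obtain ⟨a, rfl⟩ := ZMod.intCast_surjective x
    exact ⟨C a, by simp [ev]⟩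
  have hM : (conditionMatrix zA).map ev = conditionMatrix specialPoint := by
    rw [map_conditionMatrix]
    simp [zA, ev]
  obtain ⟨P, hP⟩ := exists_map_mul_eq_one hev (conditionMatrix zA)
    (by rw [hM]; exact linearIndependent_conditionMatrix)
  choose u hu huw using fun c ↦ exists_lift_of_mulVec_eq_zero hev hP (w := kernelVector c)
    (by rw [hM]; exact conditionMatrix_mulVec_kernelVector c)
  have hprod : (fun q ↦ MvPolynomial.map ev (productForm (fun c ↦ form 13 (u c)) q)) =
      productForm fun c ↦ form 13 (kernelVector c) := by
    funext q
    rw [map_productForm]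
    simp only [map_form, huw]
  obtain ⟨g, hg0, hg⟩ := exists_forall_linearIndependent.{u} hev
    (productForm fun c ↦ form 13 (u c)) (by rw [hprod]; exact linearIndependent_productForm)
  refine ⟨(conditionMatrix zA * P).det * g, fun h0 ↦ ?_, fun K _ _ z hz ↦ ?_⟩
  · have h1 := congrArg ev h0
    rw [map_mul, map_zero, RingHom.map_det] at h1
    change ((conditionMatrix zA * P).map ev).det * ev g = 0 at h1
    rw [hP, Matrix.det_one, one_mul] at h1
    exact hg0 h1
  · set e := eval₂Hom (Int.castRingHom K) fun il : Fin 21 × Fin 2 ↦ z il.1 il.2 with he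
    rw [map_mul] at hz
    have hMz : (conditionMatrix zA).map e = conditionMatrix z := by
      rw [map_conditionMatrix]
      simp [zA, he]
    have hsurj : Function.Surjective (conditionMatrix z).mulVec := by
      have h1 : IsUnit (conditionMatrix z * P.map e) := by
        rw [← hMz, Matrix.isUnit_iff_isUnit_det, ← Matrix.map_mul, isUnit_iff_ne_zero]
        have := left_ne_zero_of_mul hz
        rw [RingHom.map_det] at this
        exact this
      intro w
      obtain ⟨v, hv⟩ := Matrix.mulVec_surjective_iff_isUnit.mpr h1 w
      exact ⟨(P.map e).mulVec v, by rw [Matrix.mulVec_mulVec, hv]⟩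
    have hind := hg K e (right_ne_zero_of_mul hz)
    simp only [map_productForm, map_form] at hind
    refine (fun h ↦ ⟨⟨_, h.1⟩, h.2⟩) (isBasePointFree_of_linearIndependent hsurj
      (fun c ↦ isHomogeneous_form 13 _) (fun c ↦ ?_) hind)
    rw [forall_mem_pow_idealOfVars_iff fun i ↦ expansion (z i) (form 13 fun j ↦ e (u c j))]
    intro r
    have h2 : (conditionMatrix z).mulVec (e ∘ u c) r = 0 := by
      rw [← hMz, ← RingHom.map_mulVec, hu, Pi.zero_apply, map_zero]
    rwa [conditionMatrix_mulVec] at h2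

end

/-! ### General points of the plane -/

section

open MvPolynomial

variable {k : Type u} [Field k]

/-- Homogenization: the denominators of a polynomial in affine coordinates are cleared. -/
lemma exists_eval_eq_prod_pow_mul {ι : Type*} [Fintype ι] (G : MvPolynomial (ι × Fin 2) k) :
    ∃ (N : ℕ) (H : MvPolynomial (ι × Fin 3) k), ∀ v : ι → Fin 3 → k, (∀ i, v i 2 ≠ 0) →
      eval (fun ij ↦ v ij.1 ij.2) H =
        (∏ i, v i 2) ^ N * eval (fun il ↦ v il.1 il.2.castSucc / v il.1 2) G := by
  classical
  induction G using MvPolynomial.induction_on with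
  | C a => exact ⟨0, C a, fun v _ ↦ by simp⟩
  | add p q hp hq =>
    obtain ⟨N₁, H₁, h₁⟩ := hp
    obtain ⟨N₂, H₂, h₂⟩ := hq
    refine ⟨N₁ + N₂, (∏ i, X (i, 2)) ^ N₂ * H₁ + (∏ i, X (i, 2)) ^ N₁ * H₂, fun v hv ↦ ?_⟩
    simp only [map_add, map_mul, map_pow, map_prod, eval_X, h₁ v hv, h₂ v hv]
    ring
  | mul_X p il hp =>
    obtain ⟨N, H, h⟩ := hp
    refine ⟨N + 1, H * (X (il.1, il.2.castSucc) * ∏ i ∈ Finset.univ.erase il.1, X (i, 2)),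
      fun v hv ↦ ?_⟩
    simp only [map_mul, map_prod, eval_X, h v hv]
    rw [pow_succ, ← Finset.mul_prod_erase _ _ (Finset.mem_univ il.1)]
    field_simp [hv il.1]

/-- A property of points of the plane holds for general points as soon as it holds for the points
`[zᵢ : 1]`, where the affine coordinates do not solve some polynomial equation. -/
lemma holdsForGeneralPoints_of_affCoord [Infinite k] {n : ℕ}
    {P : (Fin n → Projectivization k (Fin 3 → k)) → Prop} {G : MvPolynomial (Fin n × Fin 2) k}
    (hG : G ≠ 0) (h : ∀ p : Fin n → Projectivization k (Fin 3 → k), (∀ i, (p i).rep 2 ≠ 0) →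
      eval (fun il ↦ affCoord (p il.1) il.2) G ≠ 0 → P p) : HoldsForGeneralPoints P := by
  obtain ⟨N, H, hH⟩ := exists_eval_eq_prod_pow_mul G
  refine ⟨H * ∏ i, X (i, 2), fun h0 ↦ hG ?_, fun v hv hne ↦ ?_⟩
  · refine MvPolynomial.funext fun x ↦ ?_
    let v : Fin n → Fin 3 → k := fun i ↦ ![x (i, 0), x (i, 1), 1]
    have h1 := congrArg (eval fun ij : Fin n × Fin 3 ↦ v ij.1 ij.2) h0
    rw [map_mul, hH v fun i ↦ by simp [v]] at h1
    have h2 : (fun il : Fin n × Fin 2 ↦ v il.1 il.2.castSucc / v il.1 2) = x := by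
      funext ⟨i, l⟩
      fin_cases l <;> simp [v]
    rw [h2] at h1
    simpa [v] using h1
  · rw [map_mul, map_prod] at hne
    have hv2 (i : Fin n) : v i 2 ≠ 0 := by
      have := Finset.prod_ne_zero_iff.mp (right_ne_zero_of_mul hne) i (Finset.mem_univ i)
      simpa using this
    have hrep (i : Fin n) : ∃ t : k, t ≠ 0 ∧
        ∀ j, (Projectivization.mk k (v i) (hv i)).rep j = t * v i j := by
      obtain ⟨t, ht⟩ := Projectivization.exists_smul_eq_mk_rep k (v i) (hv i)
      exact ⟨t, t.ne_zero, fun j ↦ by rw [← ht]; rfl⟩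
    refine h _ (fun i ↦ ?_) ?_
    · obtain ⟨t, ht, h1⟩ := hrep i
      rw [h1]
      exact mul_ne_zero ht (hv2 i)
    · have h1 := left_ne_zero_of_mul hne
      rw [hH v hv2] at h1
      have haff (i : Fin n) (l : Fin 2) :
          affCoord (Projectivization.mk k (v i) (hv i)) l = v i l.castSucc / v i 2 := by
        obtain ⟨t, ht, h2⟩ := hrep i
        rw [affCoord, h2, h2, mul_div_mul_left _ _ ht]
      simp only [haff]
      exact right_ne_zero_of_mul h1

end

end PlaneBlowUp

end

theorem mainTheorem7 (k : Type u) [Field k] [IsAlgClosed k] [CharZero k] :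
    PlaneBlowUp.HoldsForGeneralPoints
      (fun p : Fin 21 → Projectivization k (Fin 3 → k) =>
        ∀ (S : Scheme.{u}) (π : S ⟶ PlaneBlowUp.Plane k),
          PlaneBlowUp.IsBlowUp π (PlaneBlowUp.pointsIdeal p) →
          ∃ D ∈ PlaneBlowUp.linearSystem π p 13 (fun j => if (j : ℕ) < 9 then 2 else 3),
            PlaneBlowUp.IsSmoothConnectedCurve (π ≫ PlaneBlowUp.planeToSpec k) D) := by
  obtain ⟨G, hG, h⟩ := PlaneBlowUp.exists_forall_isBasePointFree.{u}
  have hG' : MvPolynomial.map (Int.castRingHom k) G ≠ 0 := fun h0 ↦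
    hG (MvPolynomial.map_injective _ Int.cast_injective (by rw [h0, map_zero]))
  refine PlaneBlowUp.holdsForGeneralPoints_of_affCoord hG' fun p hp hpG S π hπ ↦ ?_
  rw [MvPolynomial.eval_map] at hpG
  obtain ⟨⟨f, hf⟩, hinj⟩ := h k (fun i ↦ PlaneBlowUp.affCoord (p i)) hpG
  exact hf.exists_mem_linearSystem (i₁ := 0) (i₂ := 20) hp hinj (by norm_num)
    (by simp [PlaneBlowUp.multiplicity]) hπ
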